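/- Let $\mathbb T$ be the unit circle, let $\beta\in\mathbb C$ with $|\beta|>1$, put $\lambda:=i\sqrt{|\beta|^2-1}$, and let $\alpha(t)=\dfrac{t-\beta}{\overline\beta t-1}$, a map of $\mathbb T$ onto itself with the two fixed points $t_\pm=(1\pm\lambda)/\overline\beta$. Let $1<p<\infty$ and $1/p+1/q=1$. Write $\widehat f_k$ for the Fourier coefficients of $f\in L^1(\mathbb T)$, $H^p=\{f\in L^p:\widehat f_k=0 \text{ for } k<0\}$, $\overline{H^p}=\{f\in L^p:\widehat f_k=0\text{ for }k>0\}$, let $P:\sum_{k\in\mathbb Z} \widehat f_kt^k\mapsto\sum_{k\ge0}\widehat f_kt^k$, and let $T(g):H^p\to H^p$, $T(g)\varphi=P(g\varphi)$, be the Toeplitz operator generated by $g\in L^\infty(\mathbb T)$. The index of a Fredholm operator $A$ is $\dim\ker A-\dim\operatorname{coker}A$. A Wiener–Hopf factorization of $g$ in $H^p$ is a representation $g=g_-t^{m}g_+$ with $m\in\mathbb Z$, $g_+\in H^q$, $g_+^{-1}\in H^p$, $g_-\in\overline{H^p}$, $g_-^{-1}\in\overline{H^q}$, $g_-(\infty)=1$,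 such that the operator $g_+^{-1}Pg_-^{-1}I$, defined on the polynomials, extends to a bounded operator on $H^p$. If $g=g_-t^{-n}g_+$ is a Wiener–Hopf factorization of $g$ in $H^p$, the $\alpha$-signature of $g$ is the number $$\boldsymbol\sigma_\alpha(g)=\Big(\frac{\lambda}{\overline\beta}\Big)^{n}g_+^{-1}\Big(\frac1{\overline\beta}\Big),$$ where $g_+^{-1}$ is extended analytically to the unit disk. **Proposition.** Let $g\in L^\infty(\mathbb T)$ satisfy $g\cdot(g\circ\alpha)=1$ almost everywhere, and let $T(g):H^p\to H^p$ be Fredholm with index $n$. 1. If $g$ is continuous at $t_+$, then the $\alpha$-signature of $g$ exists, is uniquely determined, and $\boldsymbol\sigma_\alpha(g)=g(t_+)$. 2. If $g$ is continuous at $t_-$, then the $\alpha$-signature of $g$ exists, is uniquely determined, and $\boldsymbol\sigma_\alpha(g)=g(t_-)(-1)^n$. -/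

import Mathlib

open MeasureTheory Filter
open scoped ENNReal NNReal Polynomial ComplexConjugate

noncomputable section

/-! ### The unit circle, Fourier coefficients, Hardy spaces -/

instance : MeasurableSpace Circle := borel Circle

instance : BorelSpace Circle := ⟨rfl⟩

instance : Fact (0 < 2 * Real.pi) := ⟨Real.two_pi_pos⟩

/-- Normalized arc length `|dt| / (2π)` on the unit circle: the image of the normalized Lebesgue
measure on `ℝ / 2πℤ` under `θ ↦ exp (iθ)`. -/
def circleMeasure : Measure Circle :=
  (AddCircle.haarAddCircle (T := 2 * Real.pi)).map AddCircle.toCircle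

instance : IsProbabilityMeasure circleMeasure :=
  Measure.isProbabilityMeasure_map AddCircle.continuous_toCircle.measurable.aemeasurable

/-- The `n`-th Fourier coefficient `(1/2π) ∫ f(e^{iθ}) e^{-inθ} dθ`. -/
def coef (f : Circle → ℂ) (n : ℤ) : ℂ := ∫ t, (t : ℂ) ^ (-n) * f t ∂circleMeasure

/-- Membership of (the class of) a function in the Hardy space `H^p`. -/
def MemHardy (p : ℝ≥0∞) (f : Circle → ℂ) : Prop :=
  MemLp f p circleMeasure ∧ ∀ n : ℤ, n < 0 → coef f n = 0

/-- Membership of (the class of) a function in the conjugate Hardy space `\overline{H^p}`. -/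
def MemHardyConj (p : ℝ≥0∞) (f : Circle → ℂ) : Prop :=
  MemLp f p circleMeasure ∧ ∀ n : ℤ, 0 < n → coef f n = 0

theorem coef_congr {f h : Circle → ℂ} (hfh : f =ᵐ[circleMeasure] h) (n : ℤ) :
    coef f n = coef h n :=
  integral_congr_ae (hfh.mono fun t ht => by simp only [ht])

theorem integrable_zpow_mul {f : Circle → ℂ} (hf : Integrable f circleMeasure) (n : ℤ) :
    Integrable (fun t : Circle => (t : ℂ) ^ n * f t) circleMeasure := by
  have hc : Continuous fun t : Circle => (t : ℂ) ^ n :=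
    Continuous.zpow₀ continuous_subtype_val n fun t => Or.inl (Circle.coe_ne_zero t)
  refine hf.bdd_mul (c := 1) hc.aestronglyMeasurable (ae_of_all _ fun t => ?_)
  rw [norm_zpow, Circle.norm_coe, one_zpow]

/-- The Hardy space `H^p` as a closed subspace of `L^p`, with the `L^p` norm. -/
def Hardy (p : ℝ≥0∞) [hp : Fact (1 ≤ p)] : Submodule ℂ (Lp ℂ p circleMeasure) where
  carrier := {f | MemHardy p f}
  zero_mem' := by
    refine ⟨Lp.memLp _, fun n _ => ?_⟩
    rw [coef_congr (Lp.coeFn_zero ℂ p circleMeasure)]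
    simp [coef]
  add_mem' := by
    intro f h hf hh
    refine ⟨Lp.memLp _, fun n hn => ?_⟩
    have i1 := integrable_zpow_mul (hf.1.integrable hp.out) (-n)
    have i2 := integrable_zpow_mul (hh.1.integrable hp.out) (-n)
    have e1 := hf.2 n hn
    have e2 := hh.2 n hn
    rw [coef_congr (Lp.coeFn_add f h)]
    simp only [coef, Pi.add_apply, mul_add] at *
    rw [integral_add i1 i2, e1, e2, add_zero]
  smul_mem' := by
    intro c f hf
    refine ⟨Lp.memLp _, fun n hn => ?_⟩
    have e1 := hf.2 n hn
    rw [coef_congr (Lp.coeFn_smul c f)]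
    simp only [coef, Pi.smul_apply, smul_eq_mul, mul_left_comm _ c] at *
    rw [integral_const_mul, e1, mul_zero]

/-! ### The Riesz projection and Toeplitz operators -/

/-- `h = P f`, where `P : ∑ f̂ₙ tⁿ ↦ ∑_{n ≥ 0} f̂ₙ tⁿ`. -/
def IsAnalyticPart (f h : Circle → ℂ) : Prop :=
  ∀ n : ℤ, coef h n = if 0 ≤ n then coef f n else 0

/-- The bounded operator `A` on `H^p` is the Toeplitz operator `T(g) : φ ↦ P (g φ)`.
(An integrable function is determined by its Fourier coefficients, so there is only one such `A`.) -/
def IsToeplitzOperator (p : ℝ≥0∞) [Fact (1 ≤ p)] (g : Circle → ℂ)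
    (A : Hardy p →L[ℂ] Hardy p) : Prop :=
  ∀ φ : Hardy p, IsAnalyticPart (fun t => g t * (φ : Lp ℂ p circleMeasure) t)
    (A φ : Lp ℂ p circleMeasure)

/-- The index `dim ker A - dim coker A`. -/
def fredholmIndex {E : Type*} [NormedAddCommGroup E] [NormedSpace ℂ E] (A : E →L[ℂ] E) : ℤ :=
  (Module.finrank ℂ A.ker : ℤ) - (Module.finrank ℂ (E ⧸ A.range) : ℤ)

/-- The Toeplitz operator `T(g) : H^p → H^p` is Fredholm with index `n`. -/
def ToeplitzFredholmWithIndex (p : ℝ≥0∞) [Fact (1 ≤ p)] (g : Circle → ℂ) (n : ℤ) : Prop :=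
  ∃ A : Hardy p →L[ℂ] Hardy p,
    IsToeplitzOperator p g A ∧ A.IsFredholm ∧ fredholmIndex A = n

/-! ### Wiener–Hopf factorization -/

/-- `g = g₋ tⁿ g₊` is a Wiener–Hopf factorization of `g` in `H^p`; here `q` is the exponent
conjugate to `p`. The normalization `g₋(∞) = 1` says that the zeroth Fourier coefficient of
`g₋ ∈ \overline{H^p}` is `1`. The last field says that the operator `g₊⁻¹ P g₋⁻¹ I`, defined on
the polynomials `s`, is bounded in the `L^p` norm, i.e. extends boundedly to `H^p`. For a
polynomial `s`, the function `P (g₋⁻¹ s)` is again a polynomial, denoted by `r`. -/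
structure IsWienerHopfFactorization (p : ℝ≥0∞) (g : Circle → ℂ) (n : ℤ)
    (gm gp : Circle → ℂ) : Prop where
  gm_ne_zero : ∀ᵐ t ∂circleMeasure, gm t ≠ 0
  gp_ne_zero : ∀ᵐ t ∂circleMeasure, gp t ≠ 0
  gp_mem : MemHardy (ENNReal.conjExponent p) gp
  gp_inv_mem : MemHardy p (fun t => (gp t)⁻¹)
  gm_mem : MemHardyConj p gm
  gm_inv_mem : MemHardyConj (ENNReal.conjExponent p) (fun t => (gm t)⁻¹)
  gm_infty : coef gm 0 = 1
  factorization : ∀ᵐ t ∂circleMeasure, g t = gm t * (t : ℂ) ^ n * gp t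
  bounded : ∃ C : ℝ≥0, ∀ s r : ℂ[X],
    IsAnalyticPart (fun t => (gm t)⁻¹ * s.eval (t : ℂ)) (fun t => r.eval (t : ℂ)) →
      eLpNorm (fun t : Circle => (gp t)⁻¹ * r.eval (t : ℂ)) p circleMeasure ≤
        C * eLpNorm (fun t : Circle => s.eval (t : ℂ)) p circleMeasure

/-- The value at the point `z` of the open unit disk of the analytic extension of a function
`f ∈ H^1` on the circle. -/
def diskExtension (f : Circle → ℂ) (z : ℂ) : ℂ := ∑' k : ℕ, coef f k * z ^ k

/-! ### The shift `α` -/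

theorem shift_denom_ne_zero {β : ℂ} (hβ : 1 < ‖β‖) (t : Circle) : conj β * (t : ℂ) - 1 ≠ 0 := by
  intro h
  have h1 : ‖conj β * (t : ℂ)‖ = 1 := by rw [sub_eq_zero.mp h, norm_one]
  rw [norm_mul, RCLike.norm_conj, Circle.norm_coe, mul_one] at h1
  exact hβ.ne' h1

theorem norm_shift {β : ℂ} (hβ : 1 < ‖β‖) (t : Circle) :
    ‖((t : ℂ) - β) / (conj β * (t : ℂ) - 1)‖ = 1 := by
  have h0 := shift_denom_ne_zero hβ t
  have h1 : conj β * (t : ℂ) - 1 = -((t : ℂ) * conj ((t : ℂ) - β)) := by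
    have h2 : (t : ℂ) * conj (t : ℂ) = 1 := by
      rw [Complex.mul_conj, Circle.normSq_coe, Complex.ofReal_one]
    rw [map_sub, mul_sub, h2]
    ring
  have h3 : ‖conj β * (t : ℂ) - 1‖ = ‖(t : ℂ) - β‖ := by
    rw [h1, norm_neg, norm_mul, RCLike.norm_conj, Circle.norm_coe, one_mul]
  rw [norm_div, ← h3]
  exact div_self (norm_ne_zero_iff.mpr h0)

/-- The shift `α(t) = (t - β) / (β̄ t - 1)` of the unit circle, `|β| > 1`. -/
def shift (β : ℂ) (hβ : 1 < ‖β‖) (t : Circle) : Circle :=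
  ⟨((t : ℂ) - β) / (conj β * (t : ℂ) - 1), mem_sphere_zero_iff_norm.mpr (norm_shift hβ t)⟩

/-- `λ = i √(|β|² - 1)`. -/
def lam (β : ℂ) : ℂ := Complex.I * (Real.sqrt (‖β‖ ^ 2 - 1) : ℂ)

theorem norm_one_add_lam {β : ℂ} (hβ : 1 < ‖β‖) (ε : ℝ) (hε : ε ^ 2 = 1) :
    ‖(1 + ε * lam β) / conj β‖ = 1 := by
  have h0 : 0 ≤ ‖β‖ ^ 2 - 1 := by nlinarith
  have h1 : ‖1 + ε * lam β‖ ^ 2 = ‖β‖ ^ 2 := by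
    rw [← Complex.normSq_eq_norm_sq, Complex.normSq_apply]
    simp only [lam, Complex.add_re, Complex.add_im, Complex.mul_re, Complex.mul_im, Complex.one_re,
      Complex.one_im, Complex.I_re, Complex.I_im, Complex.ofReal_re, Complex.ofReal_im]
    have h2 := Real.sq_sqrt h0
    linear_combination (Real.sqrt (‖β‖ ^ 2 - 1)) ^ 2 * hε + h2
  have h3 : ‖1 + ε * lam β‖ = ‖β‖ := by
    rwa [sq_eq_sq₀ (norm_nonneg _) (norm_nonneg _)] at h1
  rw [norm_div, RCLike.norm_conj, h3]
  exact div_self (by linarith)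

/-- The fixed point `t₊ = (1 + λ) / β̄` of `α`. -/
def tPlus (β : ℂ) (hβ : 1 < ‖β‖) : Circle :=
  ⟨(1 + lam β) / conj β, mem_sphere_zero_iff_norm.mpr
    (by simpa using norm_one_add_lam hβ 1 (by norm_num))⟩

/-- The fixed point `t₋ = (1 - λ) / β̄` of `α`. -/
def tMinus (β : ℂ) (hβ : 1 < ‖β‖) : Circle :=
  ⟨(1 - lam β) / conj β, mem_sphere_zero_iff_norm.mpr
    (by simpa [sub_eq_add_neg] using norm_one_add_lam hβ (-1) (by norm_num))⟩

/-- `g` is an `α`-matching function: `g · (g ∘ α) = 1` in `L^∞`. -/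
def IsAlphaMatching (β : ℂ) (hβ : 1 < ‖β‖) (g : Circle → ℂ) : Prop :=
  ∀ᵐ t ∂circleMeasure, g t * g (shift β hβ t) = 1

/-- `ξ` is the `α`-factorization signature of `g`: the function `g` has a Wiener–Hopf factorization
`g = g₋ t⁻ⁿ g₊` in `H^p`, and `ξ = (λ / β̄)ⁿ g₊⁻¹(1 / β̄)`. -/
def IsAlphaSignature (β : ℂ) (p : ℝ≥0∞) (g : Circle → ℂ) (ξ : ℂ) : Prop :=
  ∃ (n : ℤ) (gm gp : Circle → ℂ), IsWienerHopfFactorization p g (-n) gm gp ∧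
    ξ = (lam β / conj β) ^ n * diskExtension (fun t => (gp t)⁻¹) (1 / conj β)

end

/-! ### Integration on the circle and trigonometric polynomials -/

open scoped Topology

/-! The index condition makes `T(tⁿ g)` Fredholm of index zero, hence invertible by Coburn's theorem
(`toeplitz_bijective`). Its inverse produces a factorization `g = g₋ t⁻ⁿ g₊` with `g₊⁻¹ = T(tⁿ g)⁻¹
1` (`exists_factorization_of_bijective`), and a Liouville argument makes the exponent and `g₊`
unique. So the signature exists, is unique, and only its value is at stake.

The shift `α` exchanges the disk with its exterior, and composition with it exchanges analytic and
antianalytic functions. Since `t α(t) = (t - β) / (β̄ - t⁻¹)`, the relation `g · (g ∘ α) = 1` can be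
rearranged into an equality between an analytic and an antianalytic function, so both are a constant
`c`. Evaluation at `1/β̄ = α⁻¹(∞)`, together with `c² λ²ⁿ = 1`, shows that the signature is `c λⁿ`;
moreover `g g₊⁻¹ = c ((α(t) - β)/t)ⁿ (g₊⁻¹ ∘ α)`
(`IsWienerHopfFactorization.exists_matching_const`).

Suppose first that `g` equals a constant `ε` near a fixed point `τ`. For `n ≥ 0` the last relation
says that `u = g₊⁻¹` agrees near `τ` with an antianalytic function, so `u` is Lipschitz there.
Comparing `u` with `u ∘ α` near `τ`, either `c μⁿ = ε` with `μ = (τ - β)/τ`, or `|u(t)| = O(|t -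
τ|)`. The latter is impossible because `1/u = g₊` is integrable
(`MemHardy.reflection_coeff_eq_one`). For `n < 0` the roles of `g₊` and its inverse are exchanged.
Hence the signature is `ε (λ/μ)ⁿ`, and `μ = ±λ` at `t±`.

A `g` that is merely continuous at `τ` is a uniform limit of matching functions equal to `g(τ)` near
`τ`. The signature is a continuous function of the operator `T(tⁿ g)`, through inversion and point
evaluation in the disk, so the formula survives the limit (`isAlphaSignature_iff`).

The supporting analysis is Poisson summability, the M. Riesz theorem, the representation of
functionals on `L^p`, and products of Hardy functions with conjugate exponents. -/

theorem surjective_toCircle : Function.Surjective (AddCircle.toCircle (T := 2 * Real.pi)) := by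
  intro t
  obtain ⟨x, rfl⟩ := Circle.exp_surjective t
  exact ⟨(x : AddCircle (2 * Real.pi)), by simp [AddCircle.toCircle_apply_mk]⟩

instance : circleMeasure.IsMulLeftInvariant := by
  refine ⟨fun c => ?_⟩
  obtain ⟨x, rfl⟩ := surjective_toCircle c
  have hm : Measurable (AddCircle.toCircle (T := 2 * Real.pi)) :=
    AddCircle.continuous_toCircle.measurable
  have h1 : (fun t : Circle => AddCircle.toCircle x * t) ∘
      (AddCircle.toCircle (T := 2 * Real.pi)) = AddCircle.toCircle ∘ fun y => x + y := by
    ext y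
    simp [AddCircle.toCircle_add]
  rw [circleMeasure, Measure.map_map (measurable_const_mul _) hm, h1,
    ← Measure.map_map hm (measurable_const_add x), map_add_left_eq_self]

instance : circleMeasure.IsInvInvariant := by
  constructor
  have hm : Measurable (AddCircle.toCircle (T := 2 * Real.pi)) :=
    AddCircle.continuous_toCircle.measurable
  have h1 : (Inv.inv : Circle → Circle) ∘
      (AddCircle.toCircle (T := 2 * Real.pi)) = AddCircle.toCircle ∘ fun y => -y := by
    ext y
    simp [AddCircle.toCircle_neg]
  rw [circleMeasure, Measure.inv_def, Measure.map_map measurable_inv hm, h1,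
    ← Measure.map_map hm measurable_neg, Measure.map_neg_eq_self]

/-- Gives access to the mean value property of holomorphic functions, which is available for circle
averages. -/
theorem integral_circle_eq_circleAverage (F : ℂ → ℂ) (hF : AEStronglyMeasurable (fun t : Circle => F t) circleMeasure) :
    ∫ t : Circle, F t ∂circleMeasure = Real.circleAverage F 0 1 := by
  have hm : Measurable (AddCircle.toCircle (T := 2 * Real.pi)) :=
    AddCircle.continuous_toCircle.measurable
  rw [circleMeasure, integral_map hm.aemeasurable hF, AddCircle.integral_haarAddCircle,
    ← AddCircle.intervalIntegral_preimage (2 * Real.pi) 0, Real.circleAverage]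
  simp [circleMap, AddCircle.toCircle_apply_mk, Circle.coe_exp]

theorem continuous_coe_zpow (n : ℤ) : Continuous fun t : Circle => (t : ℂ) ^ n :=
  Continuous.zpow₀ continuous_subtype_val n fun t => Or.inl (Circle.coe_ne_zero t)

theorem integral_coe_zpow (n : ℤ) :
    ∫ t : Circle, (t : ℂ) ^ n ∂circleMeasure = if n = 0 then 1 else 0 := by
  have hm : Measurable (AddCircle.toCircle (T := 2 * Real.pi)) :=
    AddCircle.continuous_toCircle.measurable
  rw [circleMeasure, integral_map hm.aemeasurable (continuous_coe_zpow n).aestronglyMeasurable]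
  have h := congrFun (fourierCoeff_fourier (T := 2 * Real.pi) n) 0
  rw [fourierCoeff] at h
  have h2 : ∀ x : AddCircle (2 * Real.pi), fourier (-0) x • fourier n x =
      ((AddCircle.toCircle x : Circle) : ℂ) ^ n := fun x => by
    rw [neg_zero, fourier_zero, one_smul, fourier_apply, AddCircle.toCircle_zsmul, Circle.coe_zpow]
  rw [← integral_congr_ae (ae_of_all _ h2), h, Pi.single_apply]
  simp [eq_comm]

theorem norm_coe_zpow (t : Circle) (n : ℤ) : ‖(t : ℂ) ^ n‖ = 1 := by
  rw [norm_zpow, Circle.norm_coe, one_zpow]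

theorem coe_zpow_add (t : Circle) (m n : ℤ) : (t : ℂ) ^ (m + n) = (t : ℂ) ^ m * (t : ℂ) ^ n :=
  zpow_add₀ (Circle.coe_ne_zero t) m n

theorem conj_coe_zpow (t : Circle) (n : ℤ) : conj ((t : ℂ) ^ n) = (t : ℂ) ^ (-n) := by
  rw [zpow_neg, map_zpow₀, ← Circle.coe_inv_eq_conj, Circle.coe_inv, inv_zpow]

theorem Continuous.integrable_circle {E : Type*} [NormedAddCommGroup E] {f : Circle → E} (hf : Continuous f) :
    Integrable f circleMeasure :=
  hf.integrable_of_hasCompactSupport (HasCompactSupport.of_compactSpace f)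

theorem Continuous.memLp_circle {E : Type*} [NormedAddCommGroup E] {f : Circle → E} (hf : Continuous f) (p : ℝ≥0∞) :
    MemLp f p circleMeasure :=
  hf.memLp_of_hasCompactSupport (HasCompactSupport.of_compactSpace f)

theorem coef_add {f g : Circle → ℂ} (hf : Integrable f circleMeasure)
    (hg : Integrable g circleMeasure) (n : ℤ) :
    coef (fun t => f t + g t) n = coef f n + coef g n := by
  simp only [coef, mul_add]
  exact integral_add (integrable_zpow_mul hf _) (integrable_zpow_mul hg _)

theorem coef_sub {f g : Circle → ℂ} (hf : Integrable f circleMeasure)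
    (hg : Integrable g circleMeasure) (n : ℤ) :
    coef (fun t => f t - g t) n = coef f n - coef g n := by
  simp only [coef, mul_sub]
  exact integral_sub (integrable_zpow_mul hf _) (integrable_zpow_mul hg _)

theorem coef_const_mul (c : ℂ) (f : Circle → ℂ) (n : ℤ) :
    coef (fun t => c * f t) n = c * coef f n := by
  simp only [coef, mul_left_comm _ c, integral_const_mul]

theorem coef_zpow (m n : ℤ) : coef (fun t => (t : ℂ) ^ m) n = if n = m then 1 else 0 := by
  simp only [coef, ← coe_zpow_add, integral_coe_zpow, neg_add_eq_zero]

theorem coef_zpow_mul (m : ℤ) (f : Circle → ℂ) (n : ℤ) :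
    coef (fun t => (t : ℂ) ^ m * f t) n = coef f (n - m) := by
  simp only [coef, ← mul_assoc, ← coe_zpow_add]
  congr 2 with t
  congr 2
  ring

theorem coef_const (c : ℂ) (n : ℤ) : coef (fun _ => c) n = if n = 0 then c else 0 := by
  have h := coef_const_mul c (fun t => (t : ℂ) ^ (0 : ℤ)) n
  rw [coef_zpow] at h
  simpa using h

theorem coef_conj (f : Circle → ℂ) (n : ℤ) :
    coef (fun t => conj (f t)) n = conj (coef f (-n)) := by
  rw [coef, coef, ← integral_conj]
  congr 1 with t
  rw [map_mul, conj_coe_zpow, neg_neg]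

theorem coef_inv (f : Circle → ℂ) (n : ℤ) : coef (fun t => f t⁻¹) n = coef f (-n) := by
  rw [coef, coef, ← integral_inv_eq_self (fun t : Circle => (t : ℂ) ^ (- -n) * f t) circleMeasure]
  congr 1 with t
  rw [Circle.coe_inv, inv_zpow, ← zpow_neg, neg_neg]

theorem coef_zero (f : Circle → ℂ) : coef f 0 = ∫ t, f t ∂circleMeasure := by
  simp [coef]

theorem norm_coef_le (f : Circle → ℂ) (n : ℤ) : ‖coef f n‖ ≤ ∫ t, ‖f t‖ ∂circleMeasure := by
  refine (norm_integral_le_integral_norm _).trans (le_of_eq ?_)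
  simp only [norm_mul, norm_coe_zpow, one_mul]

/-- The trigonometric polynomial with the given coefficients. -/
noncomputable def trigPoly (a : ℤ →₀ ℂ) (t : Circle) : ℂ := a.sum fun k c => c * (t : ℂ) ^ k

theorem continuous_trigPoly (a : ℤ →₀ ℂ) : Continuous (trigPoly a) := by
  unfold trigPoly Finsupp.sum
  exact continuous_finsetSum _ fun k _ => continuous_const.mul (continuous_coe_zpow k)

theorem integral_mul_trigPoly {f : Circle → ℂ} (hf : Integrable f circleMeasure) (a : ℤ →₀ ℂ) :
    ∫ t, f t * trigPoly a t ∂circleMeasure = a.sum fun k c => c * coef f (-k) := by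
  simp only [trigPoly, Finsupp.sum, Finset.mul_sum]
  rw [integral_finsetSum]
  · refine Finset.sum_congr rfl fun k _ => ?_
    rw [coef, ← integral_const_mul]
    congr 1 with t
    rw [neg_neg]
    ring
  · intro k _
    refine ((integrable_zpow_mul hf k).const_mul (a k)).congr (ae_of_all _ fun t => ?_)
    simp only
    ring

theorem coef_trigPoly (a : ℤ →₀ ℂ) (n : ℤ) : coef (trigPoly a) n = a n := by
  rw [coef, integral_mul_trigPoly (continuous_coe_zpow _).integrable_circle]
  simp only [coef_zpow, neg_inj]
  simp [Finsupp.sum, eq_comm]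

/-- Transported from the density of the Fourier monomials in the continuous functions on `ℝ / 2πℤ`.
-/
theorem exists_trigPoly_norm_sub_le {f : Circle → ℂ} (hf : Continuous f) {ε : ℝ} (hε : 0 < ε) :
    ∃ a : ℤ →₀ ℂ, ∀ t, ‖f t - trigPoly a t‖ ≤ ε := by
  let F : C(AddCircle (2 * Real.pi), ℂ) := ⟨fun x => f x.toCircle, hf.comp AddCircle.continuous_toCircle⟩
  have hF : F ∈ (Submodule.span ℂ (Set.range (fourier (T := 2 * Real.pi)))).topologicalClosure := by
    rw [span_fourier_closure_eq_top]; trivial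
  obtain ⟨G, hG, hd⟩ := Metric.mem_closure_iff.1 hF ε hε
  obtain ⟨a, ha⟩ := (Finsupp.mem_span_range_iff_exists_finsupp).1 hG
  refine ⟨a, fun t => ?_⟩
  obtain ⟨x, rfl⟩ := surjective_toCircle t
  have h1 : ‖(F - G) x‖ ≤ ε := (ContinuousMap.norm_coe_le_norm _ x).trans (by rw [← dist_eq_norm]; exact hd.le)
  have h2 : G x = trigPoly a x.toCircle := by
    rw [← ha, trigPoly, Finsupp.sum, Finsupp.sum, ContinuousMap.sum_apply]
    refine Finset.sum_congr rfl fun k _ => ?_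
    rw [ContinuousMap.smul_apply, fourier_apply, AddCircle.toCircle_zsmul, Circle.coe_zpow,
      smul_eq_mul]
  rwa [ContinuousMap.sub_apply, h2] at h1

theorem exists_trigPoly_eLpNorm_sub_le {p : ℝ≥0∞} (hp : p ≠ ∞) {f : Circle → ℂ}
    (hf : MemLp f p circleMeasure) {ε : ℝ≥0∞} (hε : ε ≠ 0) (h1 : 1 ≤ p) :
    ∃ a : ℤ →₀ ℂ, eLpNorm (fun t => f t - trigPoly a t) p circleMeasure ≤ ε := by
  rcases eq_or_ne ε ∞ with rfl | hε'
  · exact ⟨0, le_top⟩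
  obtain ⟨g, hg, hgm⟩ := hf.exists_boundedContinuous_eLpNorm_sub_le hp (ENNReal.half_pos hε).ne'
  have he : 0 < (ε / 2).toReal := ENNReal.toReal_pos (ENNReal.half_pos hε).ne' (by finiteness)
  obtain ⟨a, ha⟩ := exists_trigPoly_norm_sub_le g.continuous he
  refine ⟨a, ?_⟩
  have h2 : eLpNorm (fun t => g t - trigPoly a t) p circleMeasure ≤ ε / 2 := by
    refine (eLpNorm_le_of_ae_bound (ae_of_all _ ha)).trans ?_
    rw [measure_univ, ENNReal.one_rpow, one_mul, ENNReal.ofReal_toReal (by finiteness)]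
  have h3 : (fun t => f t - trigPoly a t) = (f - g) + fun t => g t - trigPoly a t := by
    ext t; simp
  rw [h3, ← ENNReal.add_halves ε]
  refine (eLpNorm_add_le (hf.1.sub hgm.1) ?_ h1).trans (add_le_add hg h2)
  exact (g.continuous.sub (continuous_trigPoly a)).aestronglyMeasurable

/-! ### Cauchy and Poisson integrals -/

theorem summable_coef_mul_pow {f : Circle → ℂ} {z : ℂ} (hz : ‖z‖ < 1) :
    Summable fun k : ℕ => coef f k * z ^ k := by
  refine Summable.of_norm_bounded ((summable_geometric_of_lt_one (norm_nonneg z) hz).mul_left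
    (∫ t, ‖f t‖ ∂circleMeasure)) fun k => ?_
  rw [norm_mul, norm_pow]
  exact mul_le_mul_of_nonneg_right (norm_coef_le f k) (by positivity)

theorem one_sub_mul_coe_ne_zero {z : ℂ} (hz : ‖z‖ < 1) (s : Circle) :
    1 - z * (s : ℂ) ≠ 0 := by
  intro h
  have h1 : ‖z * (s : ℂ)‖ = 1 := by rw [← sub_eq_zero.mp h, norm_one]
  rw [norm_mul, Circle.norm_coe, mul_one] at h1
  exact hz.ne h1

theorem continuous_circle_coe : Continuous fun t : Circle => (t : ℂ) := continuous_subtype_val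

theorem continuous_circle_coe_inv : Continuous fun t : Circle => ((t⁻¹ : Circle) : ℂ) :=
  continuous_circle_coe.comp continuous_inv

theorem continuous_cauchy {z : ℂ} (hz : ‖z‖ < 1) :
    Continuous fun s : Circle => (1 - z * ((s⁻¹ : Circle) : ℂ))⁻¹ :=
  (continuous_const.sub (continuous_const.mul continuous_circle_coe_inv)).inv₀ fun s => one_sub_mul_coe_ne_zero hz s⁻¹

theorem integrable_cauchy_mul {f : Circle → ℂ} (hf : Integrable f circleMeasure) {z : ℂ}
    (hz : ‖z‖ < 1) :
    Integrable (fun s : Circle => (1 - z * ((s⁻¹ : Circle) : ℂ))⁻¹ * f s) circleMeasure := by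
  obtain ⟨C, hC⟩ := isCompact_univ.exists_bound_of_continuousOn (continuous_cauchy hz).continuousOn
  exact hf.bdd_mul (c := C) (continuous_cauchy hz).aestronglyMeasurable
    (ae_of_all _ fun t => hC t trivial)

/-- Cauchy's formula for the analytic extension. -/
theorem integral_cauchy_mul {f : Circle → ℂ} (hf : Integrable f circleMeasure) {z : ℂ}
    (hz : ‖z‖ < 1) :
    ∫ s : Circle, (1 - z * ((s⁻¹ : Circle) : ℂ))⁻¹ * f s ∂circleMeasure = diskExtension f z := by
  have h1 : ∀ s : Circle, HasSum (fun k : ℕ => z ^ k * ((s : ℂ) ^ (-(k : ℤ)) * f s))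
      ((1 - z * ((s⁻¹ : Circle) : ℂ))⁻¹ * f s) := fun s => by
    have h2 : ‖z * ((s⁻¹ : Circle) : ℂ)‖ < 1 := by rwa [norm_mul, Circle.norm_coe, mul_one]
    refine ((hasSum_geometric_of_norm_lt_one h2).mul_right (f s)).congr_fun fun k => ?_
    rw [mul_pow, Circle.coe_inv, inv_pow, zpow_neg, zpow_natCast, mul_assoc]
  have h3 := hasSum_integral_of_summable_integral_norm
    (F := fun (k : ℕ) (s : Circle) => z ^ k * ((s : ℂ) ^ (-(k : ℤ)) * f s)) (μ := circleMeasure)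
    (fun k => (integrable_zpow_mul hf _).const_mul _) ?_
  · rw [integral_congr_ae (ae_of_all _ fun s => (h1 s).tsum_eq.symm), ← h3.tsum_eq, diskExtension]
    refine tsum_congr fun k => ?_
    rw [integral_const_mul, coef, mul_comm]
  · simp only [norm_mul, norm_coe_zpow, one_mul, norm_pow, integral_const_mul]
    exact (summable_geometric_of_lt_one (norm_nonneg z) hz).mul_right _

theorem diskExtension_congr {f h : Circle → ℂ} (hfh : f =ᵐ[circleMeasure] h) (z : ℂ) :
    diskExtension f z = diskExtension h z :=
  tsum_congr fun k => by rw [coef_congr hfh]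

theorem diskExtension_zpow (m : ℤ) (z : ℂ) :
    diskExtension (fun t => (t : ℂ) ^ m) z = if 0 ≤ m then z ^ m else 0 := by
  simp only [diskExtension, coef_zpow]
  split_ifs with h
  · lift m to ℕ using h
    rw [tsum_eq_single m]
    · simp
    · intro k hk
      simp [hk]
  · convert tsum_zero with k
    rw [if_neg (by lia), zero_mul]

/-- The Poisson kernel as a function of `w = z s⁻¹`. -/
noncomputable def poissonKer (w : ℂ) : ℝ := ((1 - w)⁻¹ + conj (1 - w)⁻¹ - 1).re

theorem ofReal_poissonKer (w : ℂ) : (poissonKer w : ℂ) = (1 - w)⁻¹ + conj (1 - w)⁻¹ - 1 := by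
  rw [poissonKer, Complex.add_conj]
  norm_cast

/-- In closed form the kernel is `(1 - |w|²) / |1 - w|²`. -/
theorem poissonKer_nonneg {w : ℂ} (hw : ‖w‖ < 1) : 0 ≤ poissonKer w := by
  have h0 : 1 - w ≠ 0 := by
    intro h
    rw [← sub_eq_zero.mp h, norm_one] at hw
    exact lt_irrefl _ hw
  have h1 : poissonKer w = (1 - ‖w‖ ^ 2) / Complex.normSq (1 - w) := by
    have h2 := Complex.normSq_pos.2 h0
    have h3 : poissonKer w = 2 * (1 - w.re) / Complex.normSq (1 - w) - 1 := by
      simp only [poissonKer, Complex.sub_re, Complex.add_re, Complex.conj_re, Complex.inv_re,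
        Complex.one_re]
      ring
    rw [h3, div_sub_one h2.ne', ← Complex.normSq_eq_norm_sq]
    congr 1
    simp only [Complex.normSq_apply, Complex.sub_re, Complex.sub_im, Complex.one_re, Complex.one_im]
    ring
  rw [h1]
  have h4 := Complex.normSq_nonneg (1 - w)
  have h5 : 0 ≤ 1 - ‖w‖ ^ 2 := by nlinarith [norm_nonneg w]
  positivity

theorem poissonKer_conj (w : ℂ) : poissonKer (conj w) = poissonKer w := by
  have h : conj (1 - conj w)⁻¹ = (1 - w)⁻¹ := by simp
  have h' : (1 - conj w)⁻¹ = conj (1 - w)⁻¹ := by simp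
  rw [poissonKer, poissonKer, h, h', add_comm (conj (1 - w)⁻¹)]

/-- The Poisson integral of `f` at the point `r t`. -/
noncomputable def poissonInt (r : ℝ) (f : Circle → ℂ) (t : Circle) : ℂ :=
  ∫ s : Circle, (poissonKer (r * t * ((s⁻¹ : Circle) : ℂ)) : ℂ) * f s ∂circleMeasure

theorem norm_ofReal_mul_coe_lt {r : ℝ} (h0 : 0 ≤ r) (h1 : r < 1) (t : Circle) : ‖(r : ℂ) * t‖ < 1 := by
  rwa [norm_mul, Circle.norm_coe, mul_one, Complex.norm_real, Real.norm_of_nonneg h0]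

/-- The kernel is a Cauchy kernel plus its conjugate minus one. For real data this exhibits the real
part of a holomorphic function; for analytic data only the first term and a cancelling constant
remain. -/
theorem poissonInt_eq {r : ℝ} (h0 : 0 ≤ r) (h1 : r < 1) {f : Circle → ℂ}
    (hf : Integrable f circleMeasure) (t : Circle) :
    poissonInt r f t = diskExtension f ((r : ℂ) * t) +
      conj (diskExtension (fun s => conj (f s)) ((r : ℂ) * t)) - coef f 0 := by
  have hz := norm_ofReal_mul_coe_lt h0 h1 t
  have hf' : Integrable (fun s => conj (f s)) circleMeasure :=
    (LinearIsometryEquiv.integrable_comp_iff Complex.conjLIE).2 hf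
  have i1 := integrable_cauchy_mul hf hz
  have i2 := (LinearIsometryEquiv.integrable_comp_iff Complex.conjLIE).2 (integrable_cauchy_mul hf' hz)
  have e2 : ∀ s : Circle, Complex.conjLIE ((1 - (r : ℂ) * t * ((s⁻¹ : Circle) : ℂ))⁻¹ * conj (f s)) =
      conj (1 - (r : ℂ) * t * ((s⁻¹ : Circle) : ℂ))⁻¹ * f s := fun s => by
    rw [Complex.conjLIE_apply, map_mul, Complex.conj_conj]
  simp only [e2] at i2
  rw [← integral_cauchy_mul hf hz, ← integral_cauchy_mul hf' hz, ← integral_conj, coef_zero]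
  simp only [map_mul, Complex.conj_conj]
  rw [← integral_add i1 i2]
  refine Eq.trans ?_ (integral_sub (i1.add i2) hf)
  rw [poissonInt]
  congr 1 with s
  rw [ofReal_poissonKer]
  ring

theorem integral_poissonKer {r : ℝ} (h0 : 0 ≤ r) (h1 : r < 1) (t : Circle) :
    ∫ s : Circle, poissonKer (r * t * ((s⁻¹ : Circle) : ℂ)) ∂circleMeasure = 1 := by
  have h2 := poissonInt_eq h0 h1 (integrable_const (1 : ℂ)) t
  have h3 : diskExtension (fun _ => 1) (r * t) = 1 := by
    simpa using diskExtension_zpow 0 (r * t)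
  simp only [map_one, h3, coef_const, poissonInt, mul_one, if_true] at h2
  have h4 := (integral_ofReal (𝕜 := ℂ) (μ := circleMeasure)
    (f := fun s : Circle => poissonKer (r * t * ((s⁻¹ : Circle) : ℂ)))).symm.trans h2
  simpa using h4

theorem Continuous.poissonKer {X : Type*} [TopologicalSpace X] {w : X → ℂ} (hw : Continuous w)
    (h : ∀ x, ‖w x‖ < 1) : Continuous fun x => poissonKer (w x) := by
  have h2 : Continuous fun x => (1 - w x)⁻¹ := by
    refine (continuous_const.sub hw).inv₀ fun x => ?_
    simpa using one_sub_mul_coe_ne_zero (h x) 1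
  exact Complex.continuous_re.comp
    ((h2.add (Complex.continuous_conj.comp h2)).sub continuous_const)

theorem norm_ofReal_mul_coe_mul_coe_lt {r : ℝ} (h0 : 0 ≤ r) (h1 : r < 1) (t s : Circle) :
    ‖(r : ℂ) * t * s‖ < 1 := by
  rw [norm_mul, Circle.norm_coe, mul_one]
  exact norm_ofReal_mul_coe_lt h0 h1 t

theorem continuous_poissonKer {r : ℝ} (h0 : 0 ≤ r) (h1 : r < 1) :
    Continuous fun x : Circle × Circle => poissonKer (r * x.1 * ((x.2⁻¹ : Circle) : ℂ)) :=
  ((continuous_const.mul (continuous_circle_coe.comp continuous_fst)).mul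
    (continuous_circle_coe_inv.comp continuous_snd)).poissonKer
    fun _ => norm_ofReal_mul_coe_mul_coe_lt h0 h1 _ _

theorem continuous_poissonKer_right {r : ℝ} (h0 : 0 ≤ r) (h1 : r < 1) (t : Circle) :
    Continuous fun s : Circle => poissonKer (r * t * ((s⁻¹ : Circle) : ℂ)) :=
  (continuous_const.mul continuous_circle_coe_inv).poissonKer
    fun _ => norm_ofReal_mul_coe_mul_coe_lt h0 h1 _ _

theorem continuous_poissonKer_left {r : ℝ} (h0 : 0 ≤ r) (h1 : r < 1) (s : Circle) :
    Continuous fun t : Circle => poissonKer (r * t * ((s⁻¹ : Circle) : ℂ)) :=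
  ((continuous_const.mul continuous_circle_coe).mul continuous_const).poissonKer
    fun _ => norm_ofReal_mul_coe_mul_coe_lt h0 h1 _ _

theorem lintegral_poissonKer {r : ℝ} (h0 : 0 ≤ r) (h1 : r < 1) (t : Circle) :
    ∫⁻ s : Circle, ENNReal.ofReal (poissonKer (r * t * ((s⁻¹ : Circle) : ℂ))) ∂circleMeasure = 1 := by
  rw [← ofReal_integral_eq_lintegral_ofReal, integral_poissonKer h0 h1, ENNReal.ofReal_one]
  · exact (continuous_poissonKer_right h0 h1 t).integrable_circle
  · refine ae_of_all _ fun s => poissonKer_nonneg ?_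
    rw [norm_mul, Circle.norm_coe, mul_one]
    exact norm_ofReal_mul_coe_lt h0 h1 t

/-- Exchanging `t` and `s` conjugates the argument of the kernel, which does not change its value.
-/
theorem lintegral_poissonKer' {r : ℝ} (h0 : 0 ≤ r) (h1 : r < 1) (s : Circle) :
    ∫⁻ t : Circle, ENNReal.ofReal (poissonKer (r * t * ((s⁻¹ : Circle) : ℂ))) ∂circleMeasure = 1 := by
  rw [← lintegral_poissonKer h0 h1 s]
  congr 1 with t
  rw [← poissonKer_conj]
  congr 2
  simp only [map_mul, Complex.conj_ofReal, ← Circle.coe_inv_eq_conj, inv_inv]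
  ring

/-- Jensen's inequality for `x ↦ xᵖ`, obtained from Hölder's inequality against the constant `1`. -/
theorem lintegral_rpow_le_lintegral_rpow {α : Type*} [MeasurableSpace α] (ν : Measure α)
    [IsProbabilityMeasure ν] {F : α → ℝ≥0∞} (hF : AEMeasurable F ν) {p : ℝ} (hp : 1 ≤ p) :
    (∫⁻ s, F s ∂ν) ^ p ≤ ∫⁻ s, F s ^ p ∂ν := by
  have hp0 : 0 < p := by linarith
  rcases hp.eq_or_lt with rfl | hp1
  · simp
  have hc := Real.HolderConjugate.conjExponent hp1
  have h := ENNReal.lintegral_mul_le_Lp_mul_Lq ν hc hF (aemeasurable_const (b := (1 : ℝ≥0∞)))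
  simp only [Pi.mul_apply, mul_one, ENNReal.one_rpow, lintegral_const, measure_univ] at h
  calc (∫⁻ s, F s ∂ν) ^ p ≤ ((∫⁻ s, F s ^ p ∂ν) ^ (1 / p)) ^ p := by gcongr
    _ = _ := by rw [← ENNReal.rpow_mul, one_div_mul_cancel hp0.ne', ENNReal.rpow_one]

theorem enorm_poissonInt_rpow_le {r : ℝ} (h0 : 0 ≤ r) (h1 : r < 1) {f : Circle → ℂ}
    (hf : AEStronglyMeasurable f circleMeasure) {p : ℝ} (hp : 1 ≤ p) (t : Circle) :
    ‖poissonInt r f t‖ₑ ^ p ≤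
      ∫⁻ s, ENNReal.ofReal (poissonKer (r * t * ((s⁻¹ : Circle) : ℂ))) * ‖f s‖ₑ ^ p ∂circleMeasure := by
  have hK : Measurable fun s : Circle =>
      ENNReal.ofReal (poissonKer (r * t * ((s⁻¹ : Circle) : ℂ))) :=
    (continuous_poissonKer_right h0 h1 t).measurable.ennreal_ofReal
  set ν := circleMeasure.withDensity fun s : Circle =>
      ENNReal.ofReal (poissonKer (r * t * ((s⁻¹ : Circle) : ℂ))) with hν
  have : IsProbabilityMeasure ν :=
    ⟨by rw [hν, withDensity_apply _ MeasurableSet.univ, Measure.restrict_univ, lintegral_poissonKer h0 h1]⟩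
  have hF : AEMeasurable (fun s => ‖f s‖ₑ) ν :=
    hf.enorm.mono_ac (withDensity_absolutelyContinuous _ _)
  have h2 : ‖poissonInt r f t‖ₑ ≤ ∫⁻ s, ‖f s‖ₑ ∂ν := by
    rw [hν, lintegral_withDensity_eq_lintegral_mul₀ hK.aemeasurable hf.enorm]
    refine (enorm_integral_le_lintegral_enorm _).trans (le_of_eq ?_)
    congr 1 with s
    rw [enorm_mul, Pi.mul_apply]
    congr 1
    have h3 : 0 ≤ poissonKer (r * t * ((s⁻¹ : Circle) : ℂ)) := by
      refine poissonKer_nonneg ?_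
      rw [norm_mul, Circle.norm_coe, mul_one]
      exact norm_ofReal_mul_coe_lt h0 h1 t
    rw [← ofReal_norm, Complex.norm_real, Real.norm_of_nonneg h3]
  calc ‖poissonInt r f t‖ₑ ^ p ≤ (∫⁻ s, ‖f s‖ₑ ∂ν) ^ p := by gcongr
    _ ≤ ∫⁻ s, ‖f s‖ₑ ^ p ∂ν := lintegral_rpow_le_lintegral_rpow ν hF hp
    _ = _ := by
      rw [hν, lintegral_withDensity_eq_lintegral_mul₀ hK.aemeasurable (hf.enorm.pow_const p)]
      rfl

/-- Jensen's inequality for the Poisson density gives a pointwise bound; integrating it in `t` and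
exchanging the integrals uses that the kernel has total mass one in `t` as well as in `s`. -/
theorem eLpNorm_poissonInt_le {r : ℝ} (h0 : 0 ≤ r) (h1 : r < 1) {f : Circle → ℂ}
    (hf : AEStronglyMeasurable f circleMeasure) {p : ℝ≥0∞} (hp : 1 ≤ p) (hp' : p ≠ ∞) :
    eLpNorm (poissonInt r f) p circleMeasure ≤ eLpNorm f p circleMeasure := by
  have hp0 : p ≠ 0 := by rintro rfl; simp at hp
  have hp1 : 1 ≤ p.toReal := by
    rw [← ENNReal.toReal_one]; exact ENNReal.toReal_mono hp' hp
  rw [eLpNorm_eq_lintegral_rpow_enorm_toReal hp0 hp', eLpNorm_eq_lintegral_rpow_enorm_toReal hp0 hp']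
  refine ENNReal.rpow_le_rpow ?_ (by positivity)
  have hm : AEMeasurable (fun x : Circle × Circle =>
      ENNReal.ofReal (poissonKer (r * x.1 * ((x.2⁻¹ : Circle) : ℂ))) * ‖f x.2‖ₑ ^ p.toReal)
      (circleMeasure.prod circleMeasure) := by
    have hm1 := (continuous_poissonKer h0 h1).measurable
    have hm2 := hm1.ennreal_ofReal.aemeasurable (μ := circleMeasure.prod circleMeasure)
    have hm3 : AEMeasurable (fun s => ‖f s‖ₑ ^ p.toReal) circleMeasure := hf.enorm.pow_const _
    have hm4 := hm3.comp_snd (μ := circleMeasure)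
    exact AEMeasurable.mul hm2 hm4
  calc _ ≤ ∫⁻ t, ∫⁻ s, ENNReal.ofReal (poissonKer (r * t * ((s⁻¹ : Circle) : ℂ))) *
        ‖f s‖ₑ ^ p.toReal ∂circleMeasure ∂circleMeasure :=
        lintegral_mono fun t => enorm_poissonInt_rpow_le h0 h1 hf hp1 t
    _ = ∫⁻ s, ∫⁻ t, ENNReal.ofReal (poissonKer (r * t * ((s⁻¹ : Circle) : ℂ))) *
        ‖f s‖ₑ ^ p.toReal ∂circleMeasure ∂circleMeasure := by
        exact lintegral_lintegral_swap (f := fun t s : Circle =>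
          ENNReal.ofReal (poissonKer (r * t * ((s⁻¹ : Circle) : ℂ))) * ‖f s‖ₑ ^ p.toReal) hm
    _ = _ := by
      congr 1 with s
      rw [lintegral_mul_const, lintegral_poissonKer' h0 h1, one_mul]
      exact (continuous_poissonKer_left h0 h1 s).measurable.ennreal_ofReal

theorem integrable_poissonKer_mul {r : ℝ} (h0 : 0 ≤ r) (h1 : r < 1) {f : Circle → ℂ}
    (hf : Integrable f circleMeasure) (t : Circle) :
    Integrable (fun s : Circle => (poissonKer (r * t * ((s⁻¹ : Circle) : ℂ)) : ℂ) * f s)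
      circleMeasure := by
  have hc : Continuous fun s : Circle => (poissonKer (r * t * ((s⁻¹ : Circle) : ℂ)) : ℂ) :=
    Complex.continuous_ofReal.comp (continuous_poissonKer_right h0 h1 t)
  obtain ⟨C, hC⟩ := isCompact_univ.exists_bound_of_continuousOn hc.continuousOn
  exact hf.bdd_mul (c := C) hc.aestronglyMeasurable (ae_of_all _ fun t => hC t trivial)

theorem poissonInt_sub {r : ℝ} (h0 : 0 ≤ r) (h1 : r < 1) {f g : Circle → ℂ}
    (hf : Integrable f circleMeasure) (hg : Integrable g circleMeasure) (t : Circle) :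
    poissonInt r (fun s => f s - g s) t = poissonInt r f t - poissonInt r g t := by
  simp only [poissonInt, mul_sub]
  exact integral_sub (integrable_poissonKer_mul h0 h1 hf t) (integrable_poissonKer_mul h0 h1 hg t)

theorem poissonInt_zpow {r : ℝ} (h0 : 0 < r) (h1 : r < 1) (m : ℤ) (t : Circle) :
    poissonInt r (fun s => (s : ℂ) ^ m) t = (r : ℂ) ^ |m| * (t : ℂ) ^ m := by
  rw [poissonInt_eq h0.le h1 (continuous_coe_zpow m).integrable_circle]
  simp only [conj_coe_zpow, diskExtension_zpow, coef_zpow]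
  rcases lt_trichotomy m 0 with h | rfl | h
  · rw [if_neg (by lia), if_pos (by lia), if_neg (by lia), abs_of_neg h, mul_zpow, map_mul, conj_coe_zpow,
      neg_neg, map_zpow₀, Complex.conj_ofReal]
    ring
  · simp
  · rw [if_pos (by lia), if_neg (by lia), if_neg (by lia), abs_of_pos h, mul_zpow, map_zero]
    ring

theorem poissonInt_trigPoly {r : ℝ} (h0 : 0 < r) (h1 : r < 1) (a : ℤ →₀ ℂ) (t : Circle) :
    poissonInt r (trigPoly a) t = a.sum fun k c => c * ((r : ℂ) ^ |k| * (t : ℂ) ^ k) := by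
  simp only [poissonInt, trigPoly, Finsupp.sum, Finset.mul_sum]
  rw [integral_finsetSum]
  · refine Finset.sum_congr rfl fun k _ => ?_
    rw [← poissonInt_zpow h0 h1, poissonInt, ← integral_const_mul]
    congr 1 with s
    ring
  · intro k _
    exact integrable_poissonKer_mul h0.le h1
      ((continuous_coe_zpow k).integrable_circle.const_mul (a k)) t

theorem tendsto_eLpNorm_poissonInt_trigPoly (a : ℤ →₀ ℂ) (p : ℝ≥0∞) :
    Tendsto (fun r : ℝ => eLpNorm (fun t => poissonInt r (trigPoly a) t - trigPoly a t) p
      circleMeasure) (𝓝[<] 1) (𝓝 0) := by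
  have h1 : Tendsto (fun r : ℝ => ENNReal.ofReal
      (a.sum fun k c => ‖c‖ * ‖(r : ℂ) ^ |k| - 1‖)) (𝓝[<] 1) (𝓝 0) := by
    have h2 : Tendsto (fun r : ℝ => a.sum fun k c => ‖c‖ * ‖(r : ℂ) ^ |k| - 1‖) (𝓝[<] 1)
        (𝓝 (a.sum fun k c => ‖c‖ * ‖((1 : ℝ) : ℂ) ^ |k| - 1‖)) := by
      refine Tendsto.mono_left ?_ nhdsWithin_le_nhds
      refine tendsto_finsetSum _ fun k _ => ?_
      refine Tendsto.const_mul _ (Tendsto.norm (Tendsto.sub_const ?_ _))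
      exact (Complex.continuous_ofReal.tendsto 1).zpow₀ _ (Or.inl (by simp))
    have h3 := ENNReal.tendsto_ofReal h2
    simpa [Finsupp.sum] using h3
  refine tendsto_of_tendsto_of_tendsto_of_le_of_le' tendsto_const_nhds h1
    (Eventually.of_forall fun _ => zero_le) ?_
  filter_upwards [self_mem_nhdsWithin, Ioo_mem_nhdsLT one_pos] with r hr1 hr0
  refine (eLpNorm_le_of_ae_bound (C := a.sum fun k c => ‖c‖ * ‖(r : ℂ) ^ |k| - 1‖)
    (ae_of_all _ fun t => ?_)).trans (by simp)
  rw [poissonInt_trigPoly hr0.1 hr1, trigPoly, Finsupp.sum, Finsupp.sum, ← Finset.sum_sub_distrib]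
  refine (norm_sum_le _ _).trans (le_of_eq (Finset.sum_congr rfl fun k _ => ?_))
  rw [← mul_sub, ← sub_one_mul, norm_mul, norm_mul, norm_coe_zpow, mul_one]

theorem continuous_poissonInt {r : ℝ} (h0 : 0 ≤ r) (h1 : r < 1) {f : Circle → ℂ}
    (hf : Integrable f circleMeasure) : Continuous (poissonInt r f) := by
  obtain ⟨C, hC⟩ := isCompact_univ.exists_bound_of_continuousOn
    (continuous_poissonKer h0 h1).continuousOn
  refine continuous_of_dominated (bound := fun s => C * ‖f s‖)
    (fun t => (integrable_poissonKer_mul h0 h1 hf t).aestronglyMeasurable) (fun t => ?_)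
    (hf.norm.const_mul C) (ae_of_all _ fun s => ?_)
  · refine ae_of_all _ fun s => ?_
    rw [norm_mul, Complex.norm_real]
    exact mul_le_mul_of_nonneg_right (hC (t, s) trivial) (norm_nonneg _)
  · exact (Complex.continuous_ofReal.comp
      (continuous_poissonKer_left h0 h1 s)).mul continuous_const

/-- The Poisson integrals of an `L^p` function converge to it in `L^p`, `1 ≤ p < ∞`. -/
theorem tendsto_eLpNorm_poissonInt {p : ℝ≥0∞} (hp : 1 ≤ p) (hp' : p ≠ ∞) {f : Circle → ℂ}
    (hf : MemLp f p circleMeasure) :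
    Tendsto (fun r : ℝ => eLpNorm (fun t => poissonInt r f t - f t) p circleMeasure)
      (𝓝[<] 1) (𝓝 0) := by
  rw [ENNReal.tendsto_nhds_zero]
  intro ε hε
  have hε3 : ε / 3 ≠ 0 := (ENNReal.div_pos hε.ne' (by finiteness)).ne'
  obtain ⟨a, ha⟩ := exists_trigPoly_eLpNorm_sub_le hp' hf hε3 hp
  have h1 := (ENNReal.tendsto_nhds_zero.1 (tendsto_eLpNorm_poissonInt_trigPoly a p)) (ε / 3)
    (pos_iff_ne_zero.2 hε3)
  filter_upwards [h1, Ioo_mem_nhdsLT one_pos] with r hr hr0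
  have hfi := hf.integrable hp
  have hai := (continuous_trigPoly a).integrable_circle
  have e1 : (fun t => poissonInt r f t - f t) =
      (poissonInt r (fun s => f s - trigPoly a s) +
        (fun t => poissonInt r (trigPoly a) t - trigPoly a t)) - fun t => f t - trigPoly a t := by
    ext t
    simp only [Pi.add_apply, Pi.sub_apply, poissonInt_sub hr0.1.le hr0.2 hfi hai]
    ring
  have m1 := (continuous_poissonInt hr0.1.le hr0.2 (hfi.sub hai)).aestronglyMeasurable
    (μ := circleMeasure)
  have m2 := ((continuous_poissonInt hr0.1.le hr0.2 hai).sub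
    (continuous_trigPoly a)).aestronglyMeasurable (μ := circleMeasure)
  have m3 : AEStronglyMeasurable (fun t => f t - trigPoly a t) circleMeasure := (hfi.sub hai).1
  rw [e1]
  calc _ ≤ ε / 3 + ε / 3 + ε / 3 := by
        refine (eLpNorm_sub_le (m1.add m2) m3 hp).trans (add_le_add ?_ ha)
        refine (eLpNorm_add_le m1 m2 hp).trans (add_le_add ?_ hr)
        exact (eLpNorm_poissonInt_le hr0.1.le hr0.2 m3 hp hp').trans ha
    _ = ε := ENNReal.add_thirds ε

/-- All Poisson integrals of such a function vanish, and they converge to it in `L¹`. -/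
theorem ae_eq_zero_of_coef_eq_zero {f : Circle → ℂ} (hf : Integrable f circleMeasure)
    (h : ∀ n, coef f n = 0) : f =ᵐ[circleMeasure] 0 := by
  have h1 := tendsto_eLpNorm_poissonInt le_rfl ENNReal.one_ne_top (memLp_one_iff_integrable.2 hf)
  have h2 : ∀ᶠ r in 𝓝[<] (1 : ℝ), eLpNorm (fun t => poissonInt r f t - f t) 1 circleMeasure =
      eLpNorm f 1 circleMeasure := by
    filter_upwards [Ioo_mem_nhdsLT one_pos] with r hr
    rw [← eLpNorm_neg]
    congr 1 with t
    rw [Pi.neg_apply, poissonInt_eq hr.1.le hr.2 hf]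
    simp [diskExtension, coef_conj, h]
  have h3 := tendsto_nhds_unique (tendsto_const_nhds.congr' (h2.mono fun _ h => h.symm)) h1
  exact (eLpNorm_eq_zero_iff hf.1 one_ne_zero).1 h3

theorem ae_eq_of_coef_eq {f g : Circle → ℂ} (hf : Integrable f circleMeasure)
    (hg : Integrable g circleMeasure) (h : ∀ n, coef f n = coef g n) : f =ᵐ[circleMeasure] g := by
  have h1 := ae_eq_zero_of_coef_eq_zero (hf.sub hg) fun n => by
    rw [show f - g = fun t => f t - g t from rfl, coef_sub hf hg, h, sub_self]
  exact h1.mono fun t ht => sub_eq_zero.1 ht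

/-! ### The theorem of M. Riesz -/

/-- The inequality behind the M. Riesz theorem. Away from the imaginary axis `Re w` is comparable to
`|w|`. Near it, `p |arg w|` lies strictly beyond `π/2`, so `Re (wᵖ)` is negative and comparable to
`-|w|ᵖ`; the restriction `p ≤ 2` keeps `p |arg w|` below `π`. -/
theorem exists_norm_rpow_le_of_re_pos {p : ℝ} (hp : 1 < p) (hp2 : p ≤ 2) :
    ∃ A B : ℝ, 0 ≤ A ∧ 0 ≤ B ∧ ∀ w : ℂ, 0 < w.re →
      ‖w‖ ^ p ≤ A * w.re ^ p - B * (w ^ (p : ℂ)).re := by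
  have hpi := Real.pi_pos
  -- The midpoint between `π / (2p)`, where `cos (p θ)` changes sign, and `π / 2`.
  set θ₀ : ℝ := Real.pi / 4 * (1 + 1 / p) with hθ₀
  have hpθ : p * θ₀ = Real.pi / 4 * (p + 1) := by rw [hθ₀]; field_simp
  have hinv : 1 / p < 1 := by rw [div_lt_one (by linarith)]; exact hp
  have hinv0 : 0 < 1 / p := by positivity
  have hθ1 : θ₀ < Real.pi / 2 := by rw [hθ₀]; nlinarith
  have hθ2 : 0 < θ₀ := by rw [hθ₀]; positivity
  set δ : ℝ := -Real.cos (p * θ₀) with hδ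
  have hδ0 : 0 < δ := by
    rw [hδ, neg_pos]
    exact Real.cos_neg_of_pi_div_two_lt_of_lt (by rw [hpθ]; nlinarith) (by rw [hpθ]; nlinarith)
  have hc0 : 0 < Real.cos θ₀ := Real.cos_pos_of_mem_Ioo ⟨by linarith, hθ1⟩
  have hcp : 0 < Real.cos θ₀ ^ p := Real.rpow_pos_of_pos hc0 p
  refine ⟨(1 + δ⁻¹) / Real.cos θ₀ ^ p, δ⁻¹, by positivity, by positivity, fun w hw => ?_⟩
  have hw0 : w ≠ 0 := by rintro rfl; simp at hw
  have hn : 0 < ‖w‖ := norm_pos_iff.2 hw0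
  set θ := Complex.arg w with hθ
  have harg : |θ| < Real.pi / 2 := Complex.abs_arg_lt_pi_div_two_iff.2 (Or.inl hw)
  have hre : w.re = ‖w‖ * Real.cos |θ| := by
    rw [Real.cos_abs, Complex.norm_mul_cos_arg]
  have hcos : 0 < Real.cos |θ| := Real.cos_pos_of_mem_Ioo ⟨by linarith [abs_nonneg θ], harg⟩
  have hpow : (w ^ (p : ℂ)).re = ‖w‖ ^ p * Real.cos (p * |θ|) := by
    rw [Complex.cpow_ofReal_re, ← Real.cos_abs (_ * p), abs_mul, abs_of_pos (by linarith : 0 < p),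
      mul_comm p]
  rw [hpow, hre, Real.mul_rpow hn.le hcos.le]
  have hnp : 0 < ‖w‖ ^ p := Real.rpow_pos_of_pos hn p
  suffices h : 1 ≤ (1 + δ⁻¹) / Real.cos θ₀ ^ p * Real.cos |θ| ^ p - δ⁻¹ * Real.cos (p * |θ|) by
    nlinarith
  have hcosp : 0 ≤ Real.cos |θ| ^ p := by positivity
  rcases le_total |θ| θ₀ with h | h
  · have h1 : Real.cos θ₀ ^ p ≤ Real.cos |θ| ^ p := by
      gcongr
      exact Real.cos_le_cos_of_nonneg_of_le_pi (abs_nonneg _) (by linarith) h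
    have h2 : 1 + δ⁻¹ ≤ (1 + δ⁻¹) / Real.cos θ₀ ^ p * Real.cos |θ| ^ p := by
      rw [div_mul_eq_mul_div, le_div_iff₀ hcp]
      gcongr
    have h3 := Real.cos_le_one (p * |θ|)
    have h4 : δ⁻¹ * Real.cos (p * |θ|) ≤ δ⁻¹ * 1 := by gcongr
    linarith
  · have h1 : Real.cos (p * |θ|) ≤ -δ := by
      rw [hδ, neg_neg]
      refine Real.cos_le_cos_of_nonneg_of_le_pi (by positivity) ?_ (by gcongr)
      nlinarith [abs_nonneg θ]
    have h2 : δ⁻¹ * Real.cos (p * |θ|) ≤ δ⁻¹ * -δ := by gcongr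
    rw [mul_neg, inv_mul_cancel₀ hδ0.ne'] at h2
    have h3 : 0 ≤ (1 + δ⁻¹) / Real.cos θ₀ ^ p * Real.cos |θ| ^ p := by positivity
    linarith

theorem differentiableOn_diskExtension (f : Circle → ℂ) :
    DifferentiableOn ℂ (diskExtension f) (Metric.ball 0 1) := by
  intro z hz
  rw [mem_ball_zero_iff] at hz
  obtain ⟨ρ, hzρ, hρ⟩ := exists_between hz
  have h1 : DifferentiableOn ℂ (diskExtension f) (Metric.ball 0 ρ) := by
    refine Complex.differentiableOn_tsum_of_summable_norm
      (u := fun k : ℕ => (∫ t, ‖f t‖ ∂circleMeasure) * ρ ^ k) ?_ (fun k => by fun_prop)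
      Metric.isOpen_ball fun k w hw => ?_
    · exact (summable_geometric_of_lt_one ((norm_nonneg z).trans hzρ.le) hρ).mul_left _
    · rw [mem_ball_zero_iff] at hw
      rw [norm_mul, norm_pow]
      gcongr
      exact norm_coef_le f k
  exact ((h1 z (mem_ball_zero_iff.2 hzρ)).differentiableAt
    (Metric.isOpen_ball.mem_nhds (mem_ball_zero_iff.2 hzρ))).differentiableWithinAt

theorem diskExtension_zero (f : Circle → ℂ) : diskExtension f 0 = coef f 0 := by
  rw [diskExtension, tsum_eq_single 0]
  · simp
  · intro k hk
    simp [hk]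

theorem diskExtension_add {f g : Circle → ℂ} (hf : Integrable f circleMeasure)
    (hg : Integrable g circleMeasure) {z : ℂ} (hz : ‖z‖ < 1) :
    diskExtension (fun t => f t + g t) z = diskExtension f z + diskExtension g z := by
  simp only [diskExtension, coef_add hf hg, add_mul]
  exact (summable_coef_mul_pow hz).tsum_add (summable_coef_mul_pow hz)

theorem diskExtension_sub {f g : Circle → ℂ} (hf : Integrable f circleMeasure)
    (hg : Integrable g circleMeasure) {z : ℂ} (hz : ‖z‖ < 1) :
    diskExtension (fun t => f t - g t) z = diskExtension f z - diskExtension g z := by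
  simp only [diskExtension, coef_sub hf hg, sub_mul]
  exact (summable_coef_mul_pow hz).tsum_sub (summable_coef_mul_pow hz)

theorem diskExtension_const_mul (c : ℂ) (f : Circle → ℂ) (z : ℂ) :
    diskExtension (fun t => c * f t) z = c * diskExtension f z := by
  simp only [diskExtension, coef_const_mul, mul_assoc, tsum_mul_left]

theorem coe_norm_mul_exists (z : ℂ) : ∃ t : Circle, z = (‖z‖ : ℂ) * t := by
  refine ⟨Circle.exp (Complex.arg z), ?_⟩
  rw [Circle.coe_exp, Complex.norm_mul_exp_arg_mul_I]

/-! ### Herglotz functions of positive continuous data -/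

section Herglotz

variable {u : Circle → ℝ}

theorem re_herglotz_eq (hu : Continuous u) {r : ℝ} (h0 : 0 ≤ r) (h1 : r < 1) (t : Circle) :
    poissonInt r (fun s => (u s : ℂ)) t =
      ((2 * diskExtension (fun s => (u s : ℂ)) ((r : ℂ) * t) - coef (fun s => (u s : ℂ)) 0).re : ℂ) := by
  have hi : Integrable (fun s => (u s : ℂ)) circleMeasure :=
    (Complex.continuous_ofReal.comp hu).integrable_circle
  have hc : coef (fun s => (u s : ℂ)) 0 = ((∫ s, u s ∂circleMeasure : ℝ) : ℂ) := by
    rw [coef_zero]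
    exact integral_ofReal
  rw [poissonInt_eq h0 h1 hi]
  simp only [Complex.conj_ofReal]
  rw [Complex.add_conj, hc]
  simp

theorem re_poissonInt_ge (hu : Continuous u) {c : ℝ} (hc : ∀ t, c ≤ u t)
    {r : ℝ} (h0 : 0 ≤ r) (h1 : r < 1) (t : Circle) :
    c ≤ (poissonInt r (fun s => (u s : ℂ)) t).re := by
  have e1 : poissonInt r (fun s => (u s : ℂ)) t =
      ((∫ s : Circle, poissonKer (r * t * ((s⁻¹ : Circle) : ℂ)) * u s ∂circleMeasure : ℝ) : ℂ) := by
    rw [poissonInt]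
    simp only [← Complex.ofReal_mul]
    exact integral_ofReal
  rw [e1, Complex.ofReal_re]
  calc c = ∫ s : Circle, poissonKer (r * t * ((s⁻¹ : Circle) : ℂ)) * c ∂circleMeasure := by
        rw [integral_mul_const, integral_poissonKer h0 h1, one_mul]
    _ ≤ _ := by
      have hk := continuous_poissonKer_right h0 h1 t
      refine integral_mono (hk.mul continuous_const).integrable_circle
        (hk.mul hu).integrable_circle fun s => ?_
      exact mul_le_mul_of_nonneg_left (hc s)
        (poissonKer_nonneg (norm_ofReal_mul_coe_mul_coe_lt h0 h1 _ _))

theorem eLpNorm_eq_ofReal {f : Circle → ℂ} (hf : Continuous f) {p : ℝ} (hp : 0 < p) :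
    eLpNorm f (ENNReal.ofReal p) circleMeasure =
      ENNReal.ofReal ((∫ t, ‖f t‖ ^ p ∂circleMeasure) ^ p⁻¹) := by
  rw [(hf.memLp_circle _).eLpNorm_eq_integral_rpow_norm (by simpa using hp) (by finiteness),
    ENNReal.toReal_ofReal hp.le]

/-- The Herglotz function `F` of positive data has positive real part, so `Fᵖ` is holomorphic and
the mean of `Re F(r t)ᵖ` is `F(0)ᵖ ≥ 0`. Integrating the pointwise inequality of
`exists_norm_rpow_le_of_re_pos`, the subtracted term can be dropped. What remains is the norm of `Re
F`, a Poisson integral of the data. The constant depends neither on `r` nor on the lower bound `c`.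
-/
theorem exists_eLpNorm_herglotz_le {p : ℝ} (hp : 1 < p) (hp2 : p ≤ 2) :
    ∃ C : ℝ≥0, ∀ u : Circle → ℝ, Continuous u → ∀ c > 0, (∀ t, c ≤ u t) → ∀ r : ℝ, 0 ≤ r → r < 1 →
      eLpNorm (fun t : Circle => 2 * diskExtension (fun s => (u s : ℂ)) ((r : ℂ) * t) -
        coef (fun s => (u s : ℂ)) 0) (ENNReal.ofReal p) circleMeasure ≤
      C * eLpNorm (fun s => (u s : ℂ)) (ENNReal.ofReal p) circleMeasure := by
  obtain ⟨A, B, hA, hB, hAB⟩ := exists_norm_rpow_le_of_re_pos hp hp2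
  have hp0 : 0 < p := by linarith
  refine ⟨⟨A ^ p⁻¹, by positivity⟩, fun u hu c hc hcu r h0 h1 => ?_⟩
  set U : Circle → ℂ := fun s => (u s : ℂ) with hU
  have hUc : Continuous U := Complex.continuous_ofReal.comp hu
  set F : ℂ → ℂ := fun z => 2 * diskExtension U z - coef U 0 with hF
  have hFd : DifferentiableOn ℂ F (Metric.ball 0 1) :=
    ((differentiableOn_diskExtension U).const_mul 2).sub_const _
  have hFre : ∀ z : ℂ, ‖z‖ < 1 → 0 < (F z).re := fun z hz => by
    obtain ⟨t, ht⟩ := coe_norm_mul_exists z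
    have h2 := re_poissonInt_ge hu hcu (norm_nonneg z) hz t
    rw [re_herglotz_eq hu (norm_nonneg z) hz, Complex.ofReal_re, ← ht] at h2
    exact hc.trans_le h2
  have hr : ∀ z : ℂ, ‖z‖ ≤ 1 → ‖(r : ℂ) * z‖ < 1 := fun z hz => by
    rw [norm_mul, Complex.norm_real, Real.norm_of_nonneg h0]
    nlinarith [norm_nonneg z]
  have hr' : ∀ t : Circle, ‖(r : ℂ) * t‖ < 1 := fun t => hr t (Circle.norm_coe t).le
  have hFc : Continuous fun t : Circle => F (r * t) := by
    refine hFd.continuousOn.comp_continuous (continuous_const.mul continuous_circle_coe) fun t => ?_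
    exact mem_ball_zero_iff.2 (hr' t)
  have hGd : DiffContOnCl ℂ (fun z => F (r * z) ^ (p : ℂ)) (Metric.ball 0 |1|) := by
    have h2 : DifferentiableOn ℂ (fun z => F (r * z) ^ (p : ℂ)) (Metric.closedBall 0 1) := by
      refine DifferentiableOn.cpow ?_ (differentiableOn_const _) fun z hz => ?_
      · refine hFd.comp (by fun_prop) fun z hz => ?_
        exact mem_ball_zero_iff.2 (hr z (mem_closedBall_zero_iff.1 hz))
      · exact Or.inl (hFre _ (hr z (mem_closedBall_zero_iff.1 hz)))
    rw [abs_one]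
    refine DifferentiableOn.diffContOnCl (h2.mono ?_)
    exact Metric.closure_ball_subset_closedBall
  have hPc : Continuous fun t : Circle => F (r * t) ^ (p : ℂ) :=
    hFc.cpow continuous_const fun t => Or.inl (hFre _ (hr' t))
  have hmean : ∫ t : Circle, F (r * t) ^ (p : ℂ) ∂circleMeasure = F 0 ^ (p : ℂ) := by
    rw [integral_circle_eq_circleAverage (fun z => F (r * z) ^ (p : ℂ)) hPc.aestronglyMeasurable,
      hGd.circleAverage, mul_zero]
  have hF0 : 0 ≤ (F 0 ^ (p : ℂ)).re := by
    have h2 : F 0 = ((∫ s, u s ∂circleMeasure : ℝ) : ℂ) := by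
      have h3 : coef U 0 = ((∫ s, u s ∂circleMeasure : ℝ) : ℂ) := by
        rw [coef_zero]
        exact integral_ofReal
      rw [hF]
      simp only [diskExtension_zero, h3]
      ring
    have h3 : 0 ≤ ∫ s, u s ∂circleMeasure := integral_nonneg fun s => hc.le.trans (hcu s)
    rw [h2, ← Complex.ofReal_cpow h3, Complex.ofReal_re]
    positivity
  have hmean' : ∫ t : Circle, (F (r * t) ^ (p : ℂ)).re ∂circleMeasure = (F 0 ^ (p : ℂ)).re := by
    rw [← hmean]
    exact integral_re hPc.integrable_circle
  have hRec : Continuous fun t : Circle => (F (r * t)).re := Complex.continuous_re.comp hFc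
  have hPre : Continuous fun t : Circle => (F (r * t) ^ (p : ℂ)).re :=
    Complex.continuous_re.comp hPc
  have hRep : Continuous fun t : Circle => (F (r * t)).re ^ p :=
    hRec.rpow_const fun t => Or.inr hp0.le
  have hint : ∫ t : Circle, ‖F (r * t)‖ ^ p ∂circleMeasure ≤
      A * ∫ t : Circle, (F (r * t)).re ^ p ∂circleMeasure := by
    calc _ ≤ ∫ t : Circle, (A * (F (r * t)).re ^ p - B * (F (r * t) ^ (p : ℂ)).re) ∂circleMeasure := by
          refine integral_mono (hFc.norm.rpow_const fun t => Or.inr hp0.le).integrable_circle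
            ((hRep.const_mul A).sub (hPre.const_mul B)).integrable_circle
            fun t => hAB _ (hFre _ (hr' t))
      _ = A * (∫ t : Circle, (F (r * t)).re ^ p ∂circleMeasure) - B * (F 0 ^ (p : ℂ)).re := by
          rw [integral_sub (hRep.const_mul A).integrable_circle
            (hPre.const_mul B).integrable_circle,
            integral_const_mul, integral_const_mul, hmean']
      _ ≤ _ := by
          have := mul_nonneg hB hF0
          linarith
  have hP : ∀ t : Circle, poissonInt r U t = ((F (r * t)).re : ℂ) := re_herglotz_eq hu h0 h1
  have hPn : ∀ t : Circle, ‖poissonInt r U t‖ = (F (r * t)).re := fun t => by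
    rw [hP, Complex.norm_real, Real.norm_of_nonneg (hFre _ (hr' t)).le]
  have hle := eLpNorm_poissonInt_le h0 h1 hUc.aestronglyMeasurable
    (p := ENNReal.ofReal p) (by simpa using hp.le) (by finiteness) (f := U)
  rw [eLpNorm_eq_ofReal (continuous_poissonInt h0 h1 hUc.integrable_circle) hp0] at hle
  simp only [hPn] at hle
  rw [eLpNorm_eq_ofReal hFc hp0]
  have hI : 0 ≤ ∫ t : Circle, (F (r * t)).re ^ p ∂circleMeasure :=
    integral_nonneg fun t => Real.rpow_nonneg (hFre _ (hr' t)).le p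
  calc ENNReal.ofReal ((∫ t : Circle, ‖F (r * t)‖ ^ p ∂circleMeasure) ^ p⁻¹)
      ≤ ENNReal.ofReal ((A * ∫ t : Circle, (F (r * t)).re ^ p ∂circleMeasure) ^ p⁻¹) := by
        gcongr
    _ = ENNReal.ofReal (A ^ p⁻¹) *
        ENNReal.ofReal ((∫ t : Circle, (F (r * t)).re ^ p ∂circleMeasure) ^ p⁻¹) := by
        rw [Real.mul_rpow hA hI, ENNReal.ofReal_mul (by positivity)]
    _ ≤ _ := by
        gcongr
        exact (ENNReal.ofReal_eq_coe_nnreal _).le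

end Herglotz

theorem continuous_diskExtension_mul (f : Circle → ℂ) {r : ℝ} (h0 : 0 ≤ r) (h1 : r < 1) :
    Continuous fun t : Circle => diskExtension f ((r : ℂ) * t) :=
  (differentiableOn_diskExtension f).continuousOn.comp_continuous
    (continuous_const.mul continuous_circle_coe)
    fun t => mem_ball_zero_iff.2 (norm_ofReal_mul_coe_lt h0 h1 t)

theorem enorm_coef_le {f : Circle → ℂ} (hf : AEStronglyMeasurable f circleMeasure) {p : ℝ≥0∞}
    (hp : 1 ≤ p) (n : ℤ) : ‖coef f n‖ₑ ≤ eLpNorm f p circleMeasure := by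
  refine le_trans ?_ (eLpNorm_le_eLpNorm_of_exponent_le hp hf)
  rw [eLpNorm_one_eq_lintegral_enorm]
  refine (enorm_integral_le_lintegral_enorm _).trans (le_of_eq ?_)
  congr 1 with t
  rw [enorm_mul, ← ofReal_norm, norm_coe_zpow, ENNReal.ofReal_one, one_mul]

theorem exists_eLpNorm_diskExtension_pos_le {p : ℝ} (hp : 1 < p) (hp2 : p ≤ 2) :
    ∃ C : ℝ≥0, ∀ u : Circle → ℝ, Continuous u → ∀ c > 0, (∀ t, c ≤ u t) → ∀ r : ℝ, 0 ≤ r → r < 1 →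
      eLpNorm (fun t : Circle => diskExtension (fun s => (u s : ℂ)) ((r : ℂ) * t))
        (ENNReal.ofReal p) circleMeasure ≤
      C * eLpNorm (fun s => (u s : ℂ)) (ENNReal.ofReal p) circleMeasure := by
  obtain ⟨C, hC⟩ := exists_eLpNorm_herglotz_le hp hp2
  refine ⟨C + 1, fun u hu c hc hcu r h0 h1 => ?_⟩
  have hp1 : 1 ≤ ENNReal.ofReal p := by simpa using hp.le
  set U : Circle → ℂ := fun s => (u s : ℂ) with hU
  have hUc : Continuous U := Complex.continuous_ofReal.comp hu
  have hDc := continuous_diskExtension_mul U h0 h1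
  have h2 := hC u hu c hc hcu r h0 h1
  have hc2 : Continuous fun t : Circle => 2 * diskExtension U ((r : ℂ) * t) - coef U 0 :=
    (hDc.const_mul 2).sub continuous_const
  have e1 : (fun t : Circle => diskExtension U ((r : ℂ) * t)) = (2⁻¹ : ℂ) •
      ((fun t : Circle => 2 * diskExtension U ((r : ℂ) * t) - coef U 0) + fun _ => coef U 0) := by
    ext t
    simp
  rw [e1, eLpNorm_const_smul]
  have h3 : ‖(2⁻¹ : ℂ)‖ₑ ≤ 1 := by
    rw [← ofReal_norm, ENNReal.ofReal_le_one]
    norm_num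
  calc _ ≤ 1 * (C * eLpNorm U (ENNReal.ofReal p) circleMeasure +
        eLpNorm U (ENNReal.ofReal p) circleMeasure) := by
        gcongr
        refine (eLpNorm_add_le hc2.aestronglyMeasurable aestronglyMeasurable_const hp1).trans ?_
        gcongr
        · rw [eLpNorm_const _ (by positivity) (IsProbabilityMeasure.ne_zero _), measure_univ, ENNReal.one_rpow, mul_one]
          exact enorm_coef_le hUc.aestronglyMeasurable hp1 0
    _ = _ := by push_cast; ring

/-- Real data are the difference of their positive and negative parts, each raised by the same
constant to make it strictly positive. -/
theorem exists_eLpNorm_diskExtension_real_le {p : ℝ} (hp : 1 < p) (hp2 : p ≤ 2) :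
    ∃ C : ℝ≥0, ∀ u : Circle → ℝ, Continuous u → ∀ r : ℝ, 0 ≤ r → r < 1 →
      eLpNorm (fun t : Circle => diskExtension (fun s => (u s : ℂ)) ((r : ℂ) * t))
        (ENNReal.ofReal p) circleMeasure ≤
      C * eLpNorm (fun s => (u s : ℂ)) (ENNReal.ofReal p) circleMeasure := by
  obtain ⟨C, hC⟩ := exists_eLpNorm_diskExtension_pos_le hp hp2
  have hp1 : 1 ≤ ENNReal.ofReal p := by simpa using hp.le
  refine ⟨4 * C, fun u hu r h0 h1 => ?_⟩
  have hUc : Continuous fun s => (u s : ℂ) := Complex.continuous_ofReal.comp hu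
  set N := eLpNorm (fun s => (u s : ℂ)) (ENNReal.ofReal p) circleMeasure with hN
  have hNtop : N ≠ ∞ := (hUc.memLp_circle _).2.ne
  rcases eq_or_ne N 0 with hN0 | hN0
  · have h2 : (fun s => (u s : ℂ)) =ᵐ[circleMeasure] 0 :=
      (eLpNorm_eq_zero_iff hUc.aestronglyMeasurable (by positivity)).1 hN0
    have h3 : (fun t : Circle => diskExtension (fun s => (u s : ℂ)) ((r : ℂ) * t)) = 0 := by
      ext t
      rw [diskExtension_congr h2]
      simp [diskExtension, coef]
    rw [h3, eLpNorm_zero]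
    exact zero_le
  have hc : 0 < N.toReal := ENNReal.toReal_pos hN0 hNtop
  -- Raising by the norm of `u` itself makes each raised part have norm at most `2N`; the case of
  -- norm zero, where this would not be positive, has been treated separately.
  set c := N.toReal with hcN
  have key : ∀ v : Circle → ℝ, Continuous v → (∀ t, |v t| = |u t|) →
      eLpNorm (fun t : Circle => diskExtension (fun s => ((max (v s) 0 + c : ℝ) : ℂ)) ((r : ℂ) * t))
        (ENNReal.ofReal p) circleMeasure ≤ C * (2 * N) := by
    intro v hv hvu
    have hw : Continuous fun s => max (v s) 0 + c := (hv.max continuous_const).add continuous_const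
    refine (hC _ hw c hc (fun t => by simp) r h0 h1).trans ?_
    gcongr
    have hm : Continuous fun s => ((max (v s) 0 : ℝ) : ℂ) :=
      Complex.continuous_ofReal.comp (hv.max continuous_const)
    have e1 : (fun s => ((max (v s) 0 + c : ℝ) : ℂ)) =
        (fun s => ((max (v s) 0 : ℝ) : ℂ)) + fun _ => (c : ℂ) := by
      ext s; simp
    rw [e1, two_mul]
    refine (eLpNorm_add_le hm.aestronglyMeasurable aestronglyMeasurable_const hp1).trans
      (add_le_add ?_ ?_)
    · refine eLpNorm_mono fun s => ?_
      rw [Complex.norm_real, Complex.norm_real, Real.norm_eq_abs, Real.norm_eq_abs, ← hvu,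
        abs_of_nonneg (le_max_right _ _)]
      exact max_le (le_abs_self _) (abs_nonneg _)
    · rw [eLpNorm_const _ (by positivity) (IsProbabilityMeasure.ne_zero _), measure_univ, ENNReal.one_rpow, mul_one,
        ← ofReal_norm, Complex.norm_real, Real.norm_of_nonneg hc.le, hcN,
        ENNReal.ofReal_toReal hNtop]
  have k1 := key u hu fun _ => rfl
  have k2 := key (fun s => -u s) hu.neg fun _ => abs_neg _
  have c1 : Continuous fun s => ((max (u s) 0 + c : ℝ) : ℂ) :=
    Complex.continuous_ofReal.comp ((hu.max continuous_const).add continuous_const)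
  have c2 : Continuous fun s => ((max (-u s) 0 + c : ℝ) : ℂ) :=
    Complex.continuous_ofReal.comp ((hu.neg.max continuous_const).add continuous_const)
  have e2 : (fun s => (u s : ℂ)) = fun s => ((max (u s) 0 + c : ℝ) : ℂ) -
      ((max (-u s) 0 + c : ℝ) : ℂ) := by
    ext s
    rw [← Complex.ofReal_sub]
    congr 1
    rcases le_total 0 (u s) with h | h
    · rw [max_eq_left h, max_eq_right (by linarith)]; ring
    · rw [max_eq_right h, max_eq_left (by linarith)]; ring
  have e3 : (fun t : Circle => diskExtension (fun s => (u s : ℂ)) ((r : ℂ) * t)) =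
      (fun t : Circle => diskExtension (fun s => ((max (u s) 0 + c : ℝ) : ℂ)) ((r : ℂ) * t)) -
      fun t : Circle => diskExtension (fun s => ((max (-u s) 0 + c : ℝ) : ℂ)) ((r : ℂ) * t) := by
    ext t
    rw [e2, diskExtension_sub c1.integrable_circle c2.integrable_circle
      (norm_ofReal_mul_coe_lt h0 h1 t)]
    rfl
  rw [e3]
  refine (eLpNorm_sub_le (continuous_diskExtension_mul _ h0 h1).aestronglyMeasurable
    (continuous_diskExtension_mul _ h0 h1).aestronglyMeasurable hp1).trans
    ((add_le_add k1 k2).trans (le_of_eq ?_))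
  push_cast
  ring

theorem exists_eLpNorm_diskExtension_le {p : ℝ} (hp : 1 < p) (hp2 : p ≤ 2) :
    ∃ C : ℝ≥0, ∀ f : Circle → ℂ, Continuous f → ∀ r : ℝ, 0 ≤ r → r < 1 →
      eLpNorm (fun t : Circle => diskExtension f ((r : ℂ) * t)) (ENNReal.ofReal p) circleMeasure ≤
      C * eLpNorm f (ENNReal.ofReal p) circleMeasure := by
  obtain ⟨C, hC⟩ := exists_eLpNorm_diskExtension_real_le hp hp2
  have hp1 : 1 ≤ ENNReal.ofReal p := by simpa using hp.le
  refine ⟨2 * C, fun f hf r h0 h1 => ?_⟩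
  have c1 : Continuous fun s => (f s).re := Complex.continuous_re.comp hf
  have c2 : Continuous fun s => (f s).im := Complex.continuous_im.comp hf
  have d1 : Continuous fun s => ((f s).re : ℂ) := Complex.continuous_ofReal.comp c1
  have d2 : Continuous fun s => ((f s).im : ℂ) := Complex.continuous_ofReal.comp c2
  have e3 : (fun t : Circle => diskExtension f ((r : ℂ) * t)) =
      (fun t : Circle => diskExtension (fun s => ((f s).re : ℂ)) ((r : ℂ) * t)) +
      Complex.I • fun t : Circle => diskExtension (fun s => ((f s).im : ℂ)) ((r : ℂ) * t) := by
    ext t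
    have e2 : f = fun s => ((f s).re : ℂ) + Complex.I * ((f s).im : ℂ) := by
      ext s
      rw [mul_comm, Complex.re_add_im]
    conv_lhs => rw [e2]
    rw [diskExtension_add d1.integrable_circle (d2.integrable_circle.const_mul _)
      (norm_ofReal_mul_coe_lt h0 h1 t), diskExtension_const_mul]
    rfl
  rw [e3]
  refine (eLpNorm_add_le (continuous_diskExtension_mul _ h0 h1).aestronglyMeasurable
    ((continuous_diskExtension_mul _ h0 h1).const_smul _).aestronglyMeasurable hp1).trans ?_
  rw [eLpNorm_const_smul, ← ofReal_norm, Complex.norm_I, ENNReal.ofReal_one, one_mul]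
  calc _ ≤ C * eLpNorm f (ENNReal.ofReal p) circleMeasure +
        C * eLpNorm f (ENNReal.ofReal p) circleMeasure := by
        refine add_le_add ((hC _ c1 r h0 h1).trans ?_) ((hC _ c2 r h0 h1).trans ?_)
        · gcongr
          refine eLpNorm_mono fun s => ?_
          rw [Complex.norm_real]
          exact Complex.abs_re_le_norm _
        · gcongr
          refine eLpNorm_mono fun s => ?_
          rw [Complex.norm_real]
          exact Complex.abs_im_le_norm _
    _ = _ := by push_cast; ring

/-- The nonnegative part of a finitely supported family of coefficients. -/
noncomputable def nonnegPart (a : ℤ →₀ ℂ) : ℤ →₀ ℂ := a.filter (0 ≤ ·)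

theorem nonnegPart_apply (a : ℤ →₀ ℂ) (n : ℤ) : nonnegPart a n = if 0 ≤ n then a n else 0 := by
  rw [nonnegPart, Finsupp.filter_apply]

theorem poissonInt_of_analytic {r : ℝ} (h0 : 0 ≤ r) (h1 : r < 1) {f : Circle → ℂ}
    (hf : Integrable f circleMeasure) (hfn : ∀ n : ℤ, n < 0 → coef f n = 0) (t : Circle) :
    poissonInt r f t = diskExtension f ((r : ℂ) * t) := by
  have h2 : diskExtension (fun s => conj (f s)) ((r : ℂ) * t) = conj (coef f 0) := by
    rw [diskExtension, tsum_eq_single 0]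
    · simp [coef_conj]
    · intro k hk
      rw [coef_conj, hfn _ (by lia), map_zero, zero_mul]
  rw [poissonInt_eq h0 h1 hf, h2, Complex.conj_conj, add_sub_cancel_right]

/-- The Poisson integrals converge in `L^p`, so a bound uniform in the radius passes to the limit.
-/
theorem eLpNorm_le_of_forall_poissonInt_le {p : ℝ≥0∞} (hp : 1 ≤ p) (hp' : p ≠ ∞) {f : Circle → ℂ}
    (hf : MemLp f p circleMeasure) {M : ℝ≥0∞}
    (hM : ∀ r : ℝ, 0 ≤ r → r < 1 → eLpNorm (poissonInt r f) p circleMeasure ≤ M) :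
    eLpNorm f p circleMeasure ≤ M := by
  have h1 := (tendsto_eLpNorm_poissonInt hp hp' hf).add_const M
  rw [zero_add] at h1
  refine ge_of_tendsto h1 ?_
  filter_upwards [Ioo_mem_nhdsLT one_pos] with r hr
  have hc := (continuous_poissonInt hr.1.le hr.2 (hf.integrable hp)).aestronglyMeasurable
    (μ := circleMeasure)
  have e1 : f = poissonInt r f - fun t => poissonInt r f t - f t := by
    ext t
    simp
  calc eLpNorm f p circleMeasure ≤ eLpNorm (poissonInt r f) p circleMeasure +
        eLpNorm (fun t => poissonInt r f t - f t) p circleMeasure := by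
        conv_lhs => rw [e1]
        exact eLpNorm_sub_le hc (hc.sub hf.1) hp
    _ ≤ _ := by
        rw [add_comm]
        gcongr
        exact hM r hr.1.le hr.2

/-- The analytic extension of a trigonometric polynomial, restricted to the circle of radius `r`, is
the Poisson integral of its analytic part. -/
theorem exists_eLpNorm_nonnegPart_le_of_le_two {p : ℝ} (hp : 1 < p) (hp2 : p ≤ 2) :
    ∃ C : ℝ≥0, ∀ a : ℤ →₀ ℂ,
      eLpNorm (trigPoly (nonnegPart a)) (ENNReal.ofReal p) circleMeasure ≤
      C * eLpNorm (trigPoly a) (ENNReal.ofReal p) circleMeasure := by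
  obtain ⟨C, hC⟩ := exists_eLpNorm_diskExtension_le hp hp2
  refine ⟨C, fun a => ?_⟩
  refine eLpNorm_le_of_forall_poissonInt_le (by simpa using hp.le) (by finiteness)
    ((continuous_trigPoly _).memLp_circle _) fun r h0 h1 => ?_
  refine le_trans (le_of_eq ?_) (hC _ (continuous_trigPoly a) r h0 h1)
  congr 1 with t
  rw [poissonInt_of_analytic h0 h1 (continuous_trigPoly _).integrable_circle fun n hn => by
    rw [coef_trigPoly, nonnegPart_apply, if_neg (by lia)]]
  simp [diskExtension, coef_trigPoly, nonnegPart_apply]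

/-! ### Duality between `L^p` and `L^q` -/

section Duality

variable {α : Type*} [MeasurableSpace α] {μ : Measure α} {p q : ℝ≥0∞}

theorem enorm_integral_mul_le [p.HolderConjugate q] {f g : α → ℂ} (hf : AEStronglyMeasurable f μ)
    (hg : AEStronglyMeasurable g μ) :
    ‖∫ x, f x * g x ∂μ‖ₑ ≤ eLpNorm f p μ * eLpNorm g q μ := by
  refine (enorm_integral_le_lintegral_enorm _).trans ?_
  rw [← eLpNorm_one_eq_lintegral_enorm]
  have h := eLpNorm_smul_le_mul_eLpNorm (p := p) (q := q) (r := 1) hg hf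
  simpa only [smul_eq_mul, Pi.mul_def] using h

/-- The test function is the extremal one in Hölder's inequality, `|h|^(q-2) h̄`, cut off to `{|h| ≤
N}` so that it is bounded and all integrals are finite without knowing that `h ∈ L^q`. It yields `X
≤ M X^(1/p)` for the truncated integral `X` of `|h|^q`. Dividing gives `X^(1/q) ≤ M`, and then `N →
∞`. -/
theorem eLpNorm_le_of_forall_integral_mul_le_aux [IsFiniteMeasure μ] [p.HolderConjugate q]
    (hp : p ≠ ∞) (hq : q ≠ ∞) {h : α → ℂ} (hh : StronglyMeasurable h) {M : ℝ≥0∞}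
    (H : ∀ f : α → ℂ, AEStronglyMeasurable f μ → (∃ K : ℝ, ∀ x, ‖f x‖ ≤ K) →
      ‖∫ x, h x * f x ∂μ‖ₑ ≤ M * eLpNorm f p μ) :
    eLpNorm h q μ ≤ M := by
  have hp1 : 1 < p := (ENNReal.HolderConjugate.lt_top_iff_one_lt q p).1 hq.lt_top
  have hq1 : 1 < q := (ENNReal.HolderConjugate.lt_top_iff_one_lt p q).1 hp.lt_top
  have hP1 : 1 < p.toReal := by
    rw [← ENNReal.toReal_one]; exact (ENNReal.toReal_lt_toReal ENNReal.one_ne_top hp).2 hp1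
  have hPQ := ENNReal.HolderConjugate.toReal hP1 (q := q)
  set P := p.toReal
  set Q := q.toReal with hQ
  have hQ1 : 1 < Q := hPQ.symm.lt
  have hQ0 : 0 < Q := by linarith
  have hP0 : 0 < P := by linarith
  have hnm : Measurable fun x => ‖h x‖ := hh.norm.measurable
  set S : ℕ → Set α := fun N => {x | ‖h x‖ ≤ N} with hS
  have hSm : ∀ N, MeasurableSet (S N) := fun N => measurableSet_le hnm measurable_const
  set f₀ : α → ℂ := fun x => ((‖h x‖ ^ (Q - 2) : ℝ) : ℂ) * conj (h x) with hf₀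
  have hf₀m : StronglyMeasurable f₀ :=
    (Complex.continuous_ofReal.comp_stronglyMeasurable (hnm.pow_const _).stronglyMeasurable).mul
      (Complex.continuous_conj.comp_stronglyMeasurable hh)
  have hf₀n : ∀ x, ‖f₀ x‖ = ‖h x‖ ^ (Q - 1) := fun x => by
    rw [hf₀, norm_mul, Complex.norm_real, Real.norm_of_nonneg (by positivity), RCLike.norm_conj]
    rcases (norm_nonneg (h x)).eq_or_lt with h0 | h0
    · rw [← h0, mul_zero, Real.zero_rpow (by linarith)]
    · rw [← Real.rpow_add_one h0.ne']
      congr 1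
      ring
  have hmul : ∀ x, h x * f₀ x = ((‖h x‖ ^ Q : ℝ) : ℂ) := fun x => by
    rw [hf₀]
    simp only
    rw [mul_left_comm, Complex.mul_conj, Complex.normSq_eq_norm_sq, ← Complex.ofReal_mul]
    congr 1
    rcases (norm_nonneg (h x)).eq_or_lt with h0 | h0
    · rw [← h0, Real.zero_rpow (by linarith : Q ≠ 0)]
      simp
    · rw [← Real.rpow_natCast, ← Real.rpow_add h0]
      congr 1
      push_cast
      ring
  set X : ℕ → ℝ≥0∞ := fun N => ∫⁻ x in S N, ‖h x‖ₑ ^ Q ∂μ with hX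
  have henorm : ∀ x, ‖h x‖ₑ ^ Q = ENNReal.ofReal (‖h x‖ ^ Q) := fun x => by
    rw [← ofReal_norm, ENNReal.ofReal_rpow_of_nonneg (norm_nonneg _) hQ0.le]
  have hXtop : ∀ N, X N ≠ ∞ := fun N => by
    refine ((setLIntegral_mono_ae (g := fun _ => (N : ℝ≥0∞) ^ Q) (by fun_prop)
      (ae_of_all _ fun x hx => ?_)).trans_lt ?_).ne
    · gcongr
      rw [← ofReal_norm, ← ENNReal.ofReal_natCast]
      exact ENNReal.ofReal_le_ofReal hx
    · rw [setLIntegral_const]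
      finiteness
  have hXle : ∀ N, X N ^ (1 / Q) ≤ M := fun N => by
    have h1 := H ((S N).indicator f₀) (hf₀m.indicator (hSm N)).aestronglyMeasurable
      ⟨(N : ℝ) ^ (Q - 1), fun x => by
        by_cases hx : x ∈ S N
        · rw [Set.indicator_of_mem hx, hf₀n]
          exact Real.rpow_le_rpow (norm_nonneg _) hx (by linarith)
        · rw [Set.indicator_of_notMem hx, norm_zero]
          positivity⟩
    have e1 : ‖∫ x, h x * (S N).indicator f₀ x ∂μ‖ₑ = X N := by
      have e2 : ∀ x, h x * (S N).indicator f₀ x =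
          (S N).indicator (fun x => ((‖h x‖ ^ Q : ℝ) : ℂ)) x := fun x => by
        by_cases hx : x ∈ S N
        · rw [Set.indicator_of_mem hx, Set.indicator_of_mem hx, hmul]
        · rw [Set.indicator_of_notMem hx, Set.indicator_of_notMem hx, mul_zero]
      simp only [e2]
      rw [integral_indicator (hSm N)]
      have e3 : ∫ x in S N, ((‖h x‖ ^ Q : ℝ) : ℂ) ∂μ =
        ((∫ x in S N, ‖h x‖ ^ Q ∂μ : ℝ) : ℂ) := integral_ofReal
      have e4 : 0 ≤ ∫ x in S N, ‖h x‖ ^ Q ∂μ := integral_nonneg fun x => by positivity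
      rw [e3, ← ofReal_norm, Complex.norm_real, Real.norm_of_nonneg e4,
        integral_eq_lintegral_of_nonneg_ae (ae_of_all _ fun x => by positivity)
        (hnm.pow_const _).aestronglyMeasurable]
      simp only [← henorm]
      exact ENNReal.ofReal_toReal (hXtop N)
    have e2 : eLpNorm ((S N).indicator f₀) p μ = X N ^ (1 / P) := by
      rw [eLpNorm_indicator_eq_eLpNorm_restrict (hSm N),
        eLpNorm_eq_lintegral_rpow_enorm_toReal (ENNReal.HolderConjugate.ne_zero p q) hp]
      congr 2 with x
      rw [← ofReal_norm, hf₀n, ENNReal.ofReal_rpow_of_nonneg (by positivity) hP0.le,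
        ← Real.rpow_mul (norm_nonneg _), henorm]
      congr 2
      rw [sub_mul, one_mul]
      have := hPQ.mul_eq_add
      linarith
    rw [e1, e2] at h1
    rcases eq_or_ne (X N) 0 with h0 | h0
    · rw [h0, ENNReal.zero_rpow_of_pos (by positivity)]
      exact zero_le
    · have h2 : X N ^ (1 / P) ≠ 0 := by
        simp [h0, hXtop N]
      have h3 : X N ^ (1 / P) ≠ ∞ := ENNReal.rpow_ne_top_of_nonneg (by positivity) (hXtop N)
      have h4 : X N ^ (1 / Q) * X N ^ (1 / P) = X N := by
        rw [← ENNReal.rpow_add _ _ h0 (hXtop N)]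
        have : 1 / Q + 1 / P = 1 := by
          have := hPQ.inv_add_inv_eq_one
          simp only [one_div]
          linarith
        rw [this, ENNReal.rpow_one]
      rw [← ENNReal.mul_le_mul_iff_left h2 h3, h4]
      exact h1
  rw [eLpNorm_eq_lintegral_rpow_enorm_toReal (ENNReal.HolderConjugate.ne_zero q p) hq, ← hQ]
  have hmono : Monotone S := fun a b hab x (hx : ‖h x‖ ≤ a) =>
    show ‖h x‖ ≤ b from hx.trans (Nat.cast_le.2 hab)
  have hU : ⋃ N, S N = Set.univ := Set.eq_univ_of_forall fun x => by
    obtain ⟨N, hN⟩ := exists_nat_ge ‖h x‖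
    exact Set.mem_iUnion.2 ⟨N, hN⟩
  have h5 : ∫⁻ x, ‖h x‖ₑ ^ Q ∂μ = ⨆ N, X N := by
    rw [← setLIntegral_univ, ← hU, setLIntegral_iUnion_of_directed _ hmono.directed_le]
  rw [h5]
  have h6 : ⨆ N, X N ≤ M ^ Q := iSup_le fun N => by
    have := ENNReal.rpow_le_rpow (hXle N) hQ0.le
    rwa [← ENNReal.rpow_mul, one_div_mul_cancel hQ0.ne', ENNReal.rpow_one] at this
  calc _ ≤ (M ^ Q) ^ (1 / Q) := by gcongr
    _ = M := by rw [← ENNReal.rpow_mul, mul_one_div_cancel hQ0.ne', ENNReal.rpow_one]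

/-- The converse of Hölder's inequality. -/
theorem eLpNorm_le_of_forall_integral_mul_le [IsFiniteMeasure μ] [p.HolderConjugate q]
    (hp : p ≠ ∞) (hq : q ≠ ∞) {h : α → ℂ} (hh : AEStronglyMeasurable h μ) {M : ℝ≥0∞}
    (H : ∀ f : α → ℂ, AEStronglyMeasurable f μ → (∃ K : ℝ, ∀ x, ‖f x‖ ≤ K) →
      ‖∫ x, h x * f x ∂μ‖ₑ ≤ M * eLpNorm f p μ) :
    eLpNorm h q μ ≤ M := by
  rw [eLpNorm_congr_ae hh.ae_eq_mk]
  refine eLpNorm_le_of_forall_integral_mul_le_aux hp hq hh.stronglyMeasurable_mk fun f hf hK => ?_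
  refine le_trans (le_of_eq ?_) (H f hf hK)
  congr 1
  exact integral_congr_ae (hh.ae_eq_mk.mono fun x hx => by simp only [hx])

end Duality

/-! ### The Riesz projection for the conjugate exponent -/

theorem integral_mul_conj_trigPoly {f : Circle → ℂ} (hf : Integrable f circleMeasure) (c : ℤ →₀ ℂ) :
    ∫ t, f t * conj (trigPoly c t) ∂circleMeasure = c.sum fun k d => conj d * coef f k := by
  simp only [trigPoly, Finsupp.sum, map_sum, Finset.mul_sum]
  rw [integral_finsetSum]
  · refine Finset.sum_congr rfl fun k _ => ?_
    rw [coef, ← integral_const_mul]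
    congr 1 with t
    rw [map_mul, conj_coe_zpow]
    ring
  · intro k _
    refine ((integrable_zpow_mul hf (-k)).const_mul (conj (c k))).congr (ae_of_all _ fun t => ?_)
    simp only [map_mul, conj_coe_zpow]
    ring

theorem integral_nonnegPart_mul_conj (a c : ℤ →₀ ℂ) :
    ∫ t, trigPoly (nonnegPart a) t * conj (trigPoly c t) ∂circleMeasure =
      ∫ t, trigPoly a t * conj (trigPoly (nonnegPart c) t) ∂circleMeasure := by
  rw [integral_mul_conj_trigPoly (continuous_trigPoly _).integrable_circle,
    integral_mul_conj_trigPoly (continuous_trigPoly _).integrable_circle]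
  simp only [coef_trigPoly, nonnegPart_apply]
  rw [Finsupp.sum, Finsupp.sum, ← Finset.sum_subset (s₁ := (nonnegPart c).support) (s₂ := c.support)]
  · refine Finset.sum_congr rfl fun k hk => ?_
    rw [Finsupp.mem_support_iff, nonnegPart_apply] at hk
    have h0 : 0 ≤ k := by by_contra h; simp [h] at hk
    rw [nonnegPart_apply, if_pos h0, if_pos h0]
  · intro k hk
    simp only [nonnegPart, Finsupp.support_filter] at hk
    exact Finset.mem_of_mem_filter k hk
  · intro k hk hk'
    rw [Finsupp.mem_support_iff, not_not, nonnegPart_apply] at hk'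
    split_ifs at hk' ⊢ with h0
    · rw [hk', map_zero, zero_mul]
    · rw [mul_zero]

theorem eLpNorm_conj_comp (f : Circle → ℂ) (p : ℝ≥0∞) :
    eLpNorm (fun t => conj (f t)) p circleMeasure = eLpNorm f p circleMeasure :=
  eLpNorm_congr_norm_ae (ae_of_all _ fun _ => RCLike.norm_conj _)

/-- The projection is symmetric for the `L²` pairing, so its `L^p` bound transfers to `L^q` by the
converse of Hölder's inequality. The symmetry is known for trigonometric polynomials only, hence a
test function is first approximated by one. -/
theorem eLpNorm_nonnegPart_le_of_conj {p q : ℝ≥0∞} [p.HolderConjugate q] (hp : p ≠ ∞) (hq : q ≠ ∞)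
    {C : ℝ≥0} (hC : ∀ a : ℤ →₀ ℂ, eLpNorm (trigPoly (nonnegPart a)) p circleMeasure ≤
      C * eLpNorm (trigPoly a) p circleMeasure) (a : ℤ →₀ ℂ) :
    eLpNorm (trigPoly (nonnegPart a)) q circleMeasure ≤ C * eLpNorm (trigPoly a) q circleMeasure := by
  have hp1 : 1 ≤ p := ENNReal.HolderConjugate.one_le p q
  have ha := (continuous_trigPoly a).aestronglyMeasurable (μ := circleMeasure)
  set h := trigPoly (nonnegPart a) with hh
  have hhm := (continuous_trigPoly (nonnegPart a)).aestronglyMeasurable (μ := circleMeasure)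
  have hhq : eLpNorm h q circleMeasure ≠ ∞ := ((continuous_trigPoly _).memLp_circle _).2.ne
  have haq : eLpNorm (trigPoly a) q circleMeasure ≠ ∞ := ((continuous_trigPoly _).memLp_circle _).2.ne
  refine eLpNorm_le_of_forall_integral_mul_le hp hq hhm fun f hf ⟨K, hK⟩ => ?_
  have hfp : MemLp f p circleMeasure := MemLp.of_bound hf K (ae_of_all _ hK)
  -- The factor of the approximation error; it need only be finite, since the error tends to zero.
  set D := eLpNorm h q circleMeasure + C * eLpNorm (trigPoly a) q circleMeasure with hD
  have hDtop : D ≠ ∞ := by finiteness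
  have key : ∀ ε : ℝ≥0, 0 < ε → ‖∫ t, h t * f t ∂circleMeasure‖ₑ ≤
      C * eLpNorm (trigPoly a) q circleMeasure * eLpNorm f p circleMeasure + D * ε := fun ε hε => by
    have hfc : MemLp (fun t => conj (f t)) p circleMeasure := by
      refine ⟨Complex.continuous_conj.comp_aestronglyMeasurable hf, ?_⟩
      rw [eLpNorm_conj_comp]
      exact hfp.2
    obtain ⟨c, hc⟩ := exists_trigPoly_eLpNorm_sub_le hp hfc (ENNReal.coe_ne_zero.2 hε.ne') hp1
    have hcm := (continuous_trigPoly c).aestronglyMeasurable (μ := circleMeasure)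
    have hcc : Continuous fun t => conj (trigPoly c t) :=
      Complex.continuous_conj.comp (continuous_trigPoly c)
    have hc' : eLpNorm (fun t => f t - conj (trigPoly c t)) p circleMeasure ≤ ε := by
      rw [← eLpNorm_conj_comp]
      simpa using hc
    have i1 : Integrable (fun t => h t * (f t - conj (trigPoly c t))) circleMeasure :=
      MemLp.integrable_mul (p := q) (q := p) ((continuous_trigPoly _).memLp_circle q)
        (hfp.sub (hcc.memLp_circle p))
    have i2 : Integrable (fun t => h t * conj (trigPoly c t)) circleMeasure :=
      ((continuous_trigPoly _).mul hcc).integrable_circle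
    have e1 : ∫ t, h t * f t ∂circleMeasure =
        ∫ t, h t * (f t - conj (trigPoly c t)) ∂circleMeasure +
        ∫ t, trigPoly a t * conj (trigPoly (nonnegPart c) t) ∂circleMeasure := by
      rw [← integral_nonnegPart_mul_conj, ← integral_add i1 i2]
      congr 1 with t
      ring
    have h2 : eLpNorm (trigPoly c) p circleMeasure ≤ eLpNorm f p circleMeasure + ε := by
      have e2 : trigPoly c = (fun t => conj (f t)) - fun t => conj (f t) - trigPoly c t := by
        ext t; simp
      rw [e2]
      refine (eLpNorm_sub_le hfc.1 (hfc.1.sub hcm) hp1).trans ?_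
      rw [eLpNorm_conj_comp]
      exact add_le_add le_rfl hc
    rw [e1]
    calc _ ≤ eLpNorm h q circleMeasure * ε +
          eLpNorm (trigPoly a) q circleMeasure * (C * (eLpNorm f p circleMeasure + ε)) := by
          refine (enorm_add_le _ _).trans (add_le_add ?_ ?_)
          · refine (enorm_integral_mul_le (p := q) (q := p) hhm (hf.sub hcc.aestronglyMeasurable)).trans ?_
            exact mul_le_mul_right hc' _
          · refine (enorm_integral_mul_le (p := q) (q := p) ha
              (Complex.continuous_conj.comp (continuous_trigPoly _)).aestronglyMeasurable).trans ?_
            gcongr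
            refine (eLpNorm_conj_comp _ _).le.trans ((hC c).trans ?_)
            gcongr
      _ = _ := by rw [hD]; ring
  have h3 : Tendsto (fun ε : ℝ≥0 => C * eLpNorm (trigPoly a) q circleMeasure *
      eLpNorm f p circleMeasure + D * ε) (𝓝[>] 0)
      (𝓝 (C * eLpNorm (trigPoly a) q circleMeasure * eLpNorm f p circleMeasure + D * (0 : ℝ≥0))) := by
    refine Tendsto.const_add _ (ENNReal.Tendsto.const_mul ?_ (Or.inr hDtop))
    exact (ENNReal.tendsto_coe.2 tendsto_id).mono_left nhdsWithin_le_nhds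
  rw [ENNReal.coe_zero, mul_zero, add_zero] at h3
  exact ge_of_tendsto h3 (eventually_mem_nhdsWithin.mono fun ε hε => key ε hε)

/-- **M. Riesz**: the projection onto the nonnegative frequencies is bounded in `L^p`. -/
theorem exists_eLpNorm_nonnegPart_le {p : ℝ≥0∞} (hp1 : 1 < p) (hp : p ≠ ∞) :
    ∃ C : ℝ≥0, ∀ a : ℤ →₀ ℂ,
      eLpNorm (trigPoly (nonnegPart a)) p circleMeasure ≤ C * eLpNorm (trigPoly a) p circleMeasure := by
  have hP1 : 1 < p.toReal := by
    rw [← ENNReal.toReal_one]; exact (ENNReal.toReal_lt_toReal ENNReal.one_ne_top hp).2 hp1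
  rcases le_total p.toReal 2 with h | h
  · have := exists_eLpNorm_nonnegPart_le_of_le_two hP1 h
    rwa [ENNReal.ofReal_toReal hp] at this
  -- For `p ≥ 2` the conjugate exponent is at most `2`, and duality applies.
  · have := ENNReal.HolderConjugate.conjExponent hp1.le
    set q := p.conjExponent
    have hq1 : 1 < q := (ENNReal.HolderConjugate.lt_top_iff_one_lt p q).1 hp.lt_top
    have hq : q ≠ ∞ := ((ENNReal.HolderConjugate.lt_top_iff_one_lt q p).2 hp1).ne
    have hPQ := ENNReal.HolderConjugate.toReal hP1 (q := q)
    have hQ2 : q.toReal ≤ 2 := by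
      have := hPQ.mul_eq_add
      by_contra! hlt
      nlinarith
    obtain ⟨C, hC⟩ := exists_eLpNorm_nonnegPart_le_of_le_two hPQ.symm.lt hQ2
    rw [ENNReal.ofReal_toReal hq] at hC
    exact ⟨C, eLpNorm_nonnegPart_le_of_conj hq hp hC⟩

/-! ### Continuous functionals on `L^p` -/

section LpDual

variable {α : Type*} [MeasurableSpace α] {μ : Measure α} {p q : ℝ≥0∞}

open Classical in
/-- The signed measure `E ↦ L 1_E` of a continuous real functional on `L^p`. -/
noncomputable def signedMeasureOfFunctional [IsFiniteMeasure μ] [Fact (1 ≤ p)] (hp : p ≠ ∞)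
    (L : Lp ℂ p μ →L[ℝ] ℝ) : SignedMeasure α where
  measureOf' E := if hE : MeasurableSet E then L (indicatorConstLp p hE (measure_ne_top μ E) 1) else 0
  empty' := by simp
  not_measurable' E hE := dif_neg hE
  m_iUnion' := by
    intro f hf hd
    simp only [hf, MeasurableSet.iUnion hf, dif_pos]
    have hs : ∀ s : Finset ℕ, MeasurableSet (⋃ i ∈ s, f i) := fun s =>
      s.measurableSet_biUnion fun i _ => hf i
    have hsum : ∀ s : Finset ℕ, ∑ i ∈ s, L (indicatorConstLp p (hf i) (measure_ne_top μ _) 1) =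
        L (indicatorConstLp p (hs s) (measure_ne_top μ _) 1) := by
      intro s
      induction s using Finset.induction_on with
      | empty => simp
      | insert a s ha ih =>
        have hdis : Disjoint (f a) (⋃ i ∈ s, f i) := by
          simp only [Set.disjoint_iUnion_right]
          intro i hi
          exact hd (by rintro rfl; exact ha hi)
        rw [Finset.sum_insert ha, ih, ← map_add, ← indicatorConstLp_disjoint_union _ _ _ _ hdis]
        congr 2
        simp
    rw [HasSum]
    simp only [hsum]
    -- Countable additivity is continuity of `L` along the indicators of finite unions, which
    -- converge in `L^p` because `p < ∞` and the measures of the symmetric differences tend to zero.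
    refine (L.continuous.tendsto _).comp (tendsto_indicatorConstLp_set hp ?_)
    have h1 : ∀ s : Finset ℕ, μ (symmDiff (⋃ i ∈ s, f i) (⋃ i, f i)) =
        μ (⋃ i, f i) - μ (⋃ i ∈ s, f i) := fun s => by
      have hsub : (⋃ i ∈ s, f i) ⊆ ⋃ i, f i := Set.iUnion₂_subset fun i _ => Set.subset_iUnion f i
      rw [symmDiff_of_le hsub, measure_sdiff hsub (hs s).nullMeasurableSet (measure_ne_top _ _)]
    have hU : ⋃ s : Finset ℕ, ⋃ i ∈ s, f i = ⋃ i, f i := by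
      rw [Set.iUnion_eq_iUnion_finset f]
    have h2 : Tendsto (fun s : Finset ℕ => μ (⋃ i ∈ s, f i)) atTop (𝓝 (μ (⋃ i, f i))) := by
      rw [← hU]
      exact tendsto_measure_iUnion_atTop fun s t hst => Set.biUnion_subset_biUnion_left hst
    have h3 := ENNReal.Tendsto.sub (tendsto_const_nhds (x := μ (⋃ i, f i))) h2
      (Or.inl (measure_ne_top _ _))
    rw [tsub_self] at h3
    simpa only [h1, SummationFilter.unconditional_filter] using h3

theorem signedMeasureOfFunctional_apply [IsFiniteMeasure μ] [Fact (1 ≤ p)] (hp : p ≠ ∞)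
    (L : Lp ℂ p μ →L[ℝ] ℝ) {E : Set α} (hE : MeasurableSet E) :
    signedMeasureOfFunctional hp L E = L (indicatorConstLp p hE (measure_ne_top μ E) 1) :=
  dif_pos hE

/-- Radon–Nikodym: the indicator of a null set is zero in `L^p`, so the signed measure of the
functional is absolutely continuous. -/
theorem exists_integrable_setIntegral_eq [IsFiniteMeasure μ] [Fact (1 ≤ p)] (hp : p ≠ ∞)
    (L : Lp ℂ p μ →L[ℝ] ℝ) : ∃ g : α → ℝ, Integrable g μ ∧ ∀ (E : Set α) (hE : MeasurableSet E),
      ∫ x in E, g x ∂μ = L (indicatorConstLp p hE (measure_ne_top μ E) 1) := by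
  set s := signedMeasureOfFunctional hp L with hs
  have hac : s ≪ᵥ μ.toENNRealVectorMeasure := by
    refine VectorMeasure.AbsolutelyContinuous.mk fun E hE h0 => ?_
    rw [Measure.toENNRealVectorMeasure_apply_measurable hE] at h0
    have h1 : indicatorConstLp p hE (measure_ne_top μ E) (1 : ℂ) = 0 := by
      rw [← norm_le_zero_iff]
      refine norm_indicatorConstLp_le.trans (le_of_eq ?_)
      have hp0 : 0 < p.toReal :=
        ENNReal.toReal_pos (zero_lt_one.trans_le (Fact.out : 1 ≤ p)).ne' hp
      rw [measureReal_def, h0, ENNReal.toReal_zero, Real.zero_rpow (by positivity), mul_zero]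
    rw [hs, signedMeasureOfFunctional_apply hp L hE, h1, map_zero]
  refine ⟨s.rnDeriv μ, SignedMeasure.integrable_rnDeriv s μ, fun E hE => ?_⟩
  rw [← withDensityᵥ_apply (SignedMeasure.integrable_rnDeriv s μ) hE,
    SignedMeasure.withDensityᵥ_rnDeriv_eq s μ hac, hs, signedMeasureOfFunctional_apply hp L hE]

theorem exists_integrable_setIntegral_eq_complex [IsFiniteMeasure μ] [Fact (1 ≤ p)] (hp : p ≠ ∞)
    (L : Lp ℂ p μ →L[ℂ] ℂ) : ∃ g : α → ℂ, Integrable g μ ∧ ∀ (E : Set α) (hE : MeasurableSet E),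
      ∫ x in E, g x ∂μ = L (indicatorConstLp p hE (measure_ne_top μ E) 1) := by
  obtain ⟨g₁, i₁, h₁⟩ := exists_integrable_setIntegral_eq hp
    (Complex.reCLM.comp (L.restrictScalars ℝ))
  obtain ⟨g₂, i₂, h₂⟩ := exists_integrable_setIntegral_eq hp
    (Complex.imCLM.comp (L.restrictScalars ℝ))
  have j₁ : Integrable (fun x => (g₁ x : ℂ)) μ := i₁.ofReal
  have j₂ : Integrable (fun x => (g₂ x : ℂ) * Complex.I) μ := i₂.ofReal.mul_const _
  refine ⟨fun x => g₁ x + g₂ x * Complex.I, j₁.add j₂, fun E hE => ?_⟩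
  have e₁ : ∫ x in E, (g₁ x : ℂ) ∂μ = ((∫ x in E, g₁ x ∂μ : ℝ) : ℂ) := integral_ofReal
  have e₂ : ∫ x in E, (g₂ x : ℂ) ∂μ = ((∫ x in E, g₂ x ∂μ : ℝ) : ℂ) := integral_ofReal
  rw [integral_add j₁.integrableOn j₂.integrableOn, integral_mul_const, e₁, e₂, h₁ E hE, h₂ E hE]
  exact Complex.re_add_im _

theorem integral_mul_simpleFunc_eq [IsFiniteMeasure μ] [Fact (1 ≤ p)] {L : Lp ℂ p μ →L[ℂ] ℂ}
    {g : α → ℂ} (hg : Integrable g μ) (h : ∀ (E : Set α) (hE : MeasurableSet E),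
      ∫ x in E, g x ∂μ = L (indicatorConstLp p hE (measure_ne_top μ E) 1)) (f : SimpleFunc α ℂ) :
    ∀ hf : MemLp f p μ, ∫ x, g x * f x ∂μ = L (hf.toLp f) := by
  have hbdd : ∀ f : SimpleFunc α ℂ, Integrable (fun x => g x * f x) μ := fun f => by
    obtain ⟨C, hC⟩ := f.exists_forall_norm_le
    exact hg.mul_bdd (c := C) f.aestronglyMeasurable (ae_of_all _ hC)
  induction f using SimpleFunc.induction with
  | const c hs =>
    rename_i s
    intro hf
    have e1 : hf.toLp _ = c • indicatorConstLp p hs (measure_ne_top μ s) (1 : ℂ) := by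
      refine Lp.ext ?_
      filter_upwards [hf.coeFn_toLp, Lp.coeFn_smul c (indicatorConstLp p hs (measure_ne_top μ s) (1 : ℂ)),
        indicatorConstLp_coeFn (p := p) (hs := hs) (hμs := measure_ne_top μ s) (c := (1 : ℂ))]
        with x h1 h2 h3
      rw [h1, h2, Pi.smul_apply, h3]
      by_cases hx : x ∈ s <;> simp [hx]
    rw [e1, map_smul, ← h s hs, smul_eq_mul, ← integral_const_mul, ← integral_indicator hs]
    congr 1 with x
    by_cases hx : x ∈ s <;> simp [hx, mul_comm]
  | add hd h1 h2 =>
    rename_i f₁ f₂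
    intro hf
    have m1 : MemLp f₁ p μ := f₁.memLp_of_isFiniteMeasure p μ
    have m2 : MemLp f₂ p μ := f₂.memLp_of_isFiniteMeasure p μ
    have e1 : hf.toLp _ = m1.toLp _ + m2.toLp _ := rfl
    rw [e1, map_add, ← h1 m1, ← h2 m2, ← integral_add (hbdd f₁) (hbdd f₂)]
    congr 1 with x
    rw [SimpleFunc.coe_add, Pi.add_apply, mul_add]

/-- The density `g` is so far only integrable; this bound is what places it in `L^q`. Approximation
by simple functions dominated by `2 |f|` costs the factor `2`, which is harmless. -/
theorem enorm_integral_mul_le_of_functional [IsFiniteMeasure μ] [Fact (1 ≤ p)]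
    {L : Lp ℂ p μ →L[ℂ] ℂ} {g : α → ℂ} (hg : Integrable g μ)
    (h : ∀ (E : Set α) (hE : MeasurableSet E),
      ∫ x in E, g x ∂μ = L (indicatorConstLp p hE (measure_ne_top μ E) 1))
    {f : α → ℂ} (hf : AEStronglyMeasurable f μ) {K : ℝ} (hK : ∀ x, ‖f x‖ ≤ K) :
    ‖∫ x, g x * f x ∂μ‖ₑ ≤ (2 * ‖L‖₊ : ℝ≥0) * eLpNorm f p μ := by
  set F := hf.mk f with hF
  have hFm : Measurable F := hf.stronglyMeasurable_mk.measurable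
  have hfF : f =ᵐ[μ] F := hf.ae_eq_mk
  set s : ℕ → SimpleFunc α ℂ := SimpleFunc.approxOn F hFm Set.univ 0 (Set.mem_univ 0) with hs
  have hsn : ∀ n x, ‖s n x‖ ≤ 2 * ‖F x‖ := fun n x => by
    rw [two_mul]
    exact SimpleFunc.norm_approxOn_zero_le hFm (Set.mem_univ 0) x n
  have hlim : Tendsto (fun n => ∫ x, g x * s n x ∂μ) atTop (𝓝 (∫ x, g x * f x ∂μ)) := by
    refine tendsto_integral_of_dominated_convergence (fun x => ‖g x‖ * (2 * K))
      (fun n => hg.1.mul (s n).aestronglyMeasurable) (hg.norm.mul_const _) (fun n => ?_) ?_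
    · filter_upwards [hfF] with x hx
      rw [norm_mul]
      gcongr
      refine (hsn n x).trans ?_
      rw [← hx]
      linarith [hK x]
    · filter_upwards [hfF] with x hx
      rw [hx]
      exact (SimpleFunc.tendsto_approxOn hFm (Set.mem_univ 0) (by simp)).const_mul _
  refine le_of_tendsto (hlim.enorm) (Eventually.of_forall fun n => ?_)
  have hm : MemLp (s n) p μ := (s n).memLp_of_isFiniteMeasure p μ
  rw [integral_mul_simpleFunc_eq hg h (s n) hm]
  refine (L.le_opENorm _).trans ?_
  rw [Lp.enorm_toLp, ENNReal.coe_mul, mul_comm _ (‖L‖₊ : ℝ≥0∞), mul_assoc, enorm_eq_nnnorm]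
  gcongr
  rw [eLpNorm_congr_ae hfF]
  have h3 : eLpNorm ((2 : ℂ) • F) p μ = 2 * eLpNorm F p μ := by
    rw [eLpNorm_const_smul]
    congr 1
    rw [← ofReal_norm, Complex.norm_two]
    norm_num
  rw [ENNReal.coe_ofNat, ← h3]
  refine eLpNorm_mono fun x => ?_
  rw [Pi.smul_apply, norm_smul, Complex.norm_two]
  exact hsn n x

/-- The Riesz representation of functionals on `L^p`, `1 < p < ∞`. -/
theorem exists_memLp_forall_eq_integral_mul [IsFiniteMeasure μ] [Fact (1 ≤ p)] [p.HolderConjugate q]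
    (hp : p ≠ ∞) (hq : q ≠ ∞) (L : Lp ℂ p μ →L[ℂ] ℂ) :
    ∃ g : α → ℂ, MemLp g q μ ∧ ∀ f : Lp ℂ p μ, L f = ∫ x, g x * f x ∂μ := by
  obtain ⟨g, hg, h⟩ := exists_integrable_setIntegral_eq_complex hp L
  have hgq : MemLp g q μ := ⟨hg.1, (eLpNorm_le_of_forall_integral_mul_le hp hq hg.1
    fun f hf ⟨K, hK⟩ => enorm_integral_mul_le_of_functional hg h hf hK).trans_lt ENNReal.coe_lt_top⟩
  refine ⟨g, hgq, ?_⟩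
  have : Fact (1 ≤ q) := ⟨ENNReal.HolderConjugate.one_le q p⟩
  set G := (ContinuousLinearMap.mul ℂ ℂ).lpPairing μ q p (hgq.toLp g) with hG
  have hGf : ∀ f : Lp ℂ p μ, G f = ∫ x, g x * f x ∂μ := fun f => by
    rw [hG, ContinuousLinearMap.lpPairing_eq_integral]
    exact integral_congr_ae (hgq.coeFn_toLp.mono fun x hx => by simp [hx])
  intro f
  rw [← hGf]
  induction f using Lp.induction hp with
  | indicatorConst c hs hμs =>
    rename_i s
    have hm := (SimpleFunc.piecewise s hs (SimpleFunc.const α c)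
      (SimpleFunc.const α 0)).memLp_of_isFiniteMeasure p μ
    have e1 : (Lp.simpleFunc.indicatorConst p hs hμs.ne c : Lp ℂ p μ) = hm.toLp _ := by
      rw [Lp.simpleFunc.coe_indicatorConst]
      refine Lp.ext ?_
      filter_upwards [hm.coeFn_toLp,
        indicatorConstLp_coeFn (p := p) (hs := hs) (hμs := hμs.ne) (c := c)] with x h1 h2
      rw [h1, h2]
      by_cases hx : x ∈ s <;> simp [hx]
    rw [e1, ← integral_mul_simpleFunc_eq hg h _ hm, hGf]
    exact integral_congr_ae (hm.coeFn_toLp.mono fun x hx => by simp only [hx])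
  | add hf hg hd h1 h2 => rw [map_add, map_add, h1, h2]
  | isClosed => exact isClosed_eq L.continuous G.continuous

end LpDual

/-! ### The Riesz projection on `L^p` and products of Hardy functions -/

section RieszProj

variable {p q : ℝ≥0∞}

theorem trigPoly_add (a b : ℤ →₀ ℂ) : trigPoly (a + b) = trigPoly a + trigPoly b := by
  ext t
  exact Finsupp.sum_add_index' (fun k => by simp) fun k x y => by ring

theorem trigPoly_smul (c : ℂ) (a : ℤ →₀ ℂ) : trigPoly (c • a) = c • trigPoly a := by
  ext t
  rw [trigPoly, Finsupp.sum_smul_index fun k => by simp, Pi.smul_apply, trigPoly, Finsupp.smul_sum]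
  simp only [smul_eq_mul, mul_assoc]

theorem trigPoly_single (k : ℤ) (c : ℂ) : trigPoly (Finsupp.single k c) = fun t : Circle => c * (t : ℂ) ^ k := by
  ext t
  rw [trigPoly, Finsupp.sum_single_index (by simp)]

theorem memLp_trigPoly (p : ℝ≥0∞) (a : ℤ →₀ ℂ) : MemLp (trigPoly a) p circleMeasure :=
  (continuous_trigPoly a).memLp_circle p

theorem memLp_coe_zpow (p : ℝ≥0∞) (k : ℤ) : MemLp (fun t : Circle => (t : ℂ) ^ k) p circleMeasure :=
  (continuous_coe_zpow k).memLp_circle p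

/-- Trigonometric polynomials as elements of `L^p`. -/
noncomputable def trigPolyLp (p : ℝ≥0∞) : (ℤ →₀ ℂ) →ₗ[ℂ] Lp ℂ p circleMeasure where
  toFun a := (memLp_trigPoly p a).toLp
  map_add' a b := by
    rw [← MemLp.toLp_add]
    simp only [trigPoly_add]
  map_smul' c a := by
    rw [RingHom.id_apply, ← MemLp.toLp_const_smul]
    simp only [trigPoly_smul]

theorem coeFn_trigPolyLp (p : ℝ≥0∞) (a : ℤ →₀ ℂ) : trigPolyLp p a =ᵐ[circleMeasure] trigPoly a :=
  (memLp_trigPoly p a).coeFn_toLp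

theorem enorm_sub_trigPolyLp [Fact (1 ≤ p)] (f : Lp ℂ p circleMeasure) (a : ℤ →₀ ℂ) :
    ‖f - trigPolyLp p a‖ₑ = eLpNorm (fun t => f t - trigPoly a t) p circleMeasure := by
  rw [Lp.enorm_def]
  refine eLpNorm_congr_ae ?_
  filter_upwards [Lp.coeFn_sub f (trigPolyLp p a), coeFn_trigPolyLp p a] with t h1 h2
  rw [h1, Pi.sub_apply, h2]

theorem denseRange_trigPolyLp [Fact (1 ≤ p)] (hp : p ≠ ∞) : DenseRange (trigPolyLp p) := by
  intro f
  refine Metric.mem_closure_iff.2 fun ε hε => ?_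
  obtain ⟨a, ha⟩ := exists_trigPoly_eLpNorm_sub_le hp (Lp.memLp f)
    (ENNReal.ofReal_pos.2 (half_pos hε)).ne' Fact.out
  refine ⟨_, ⟨a, rfl⟩, ?_⟩
  rw [← enorm_sub_trigPolyLp, ← ofReal_norm, ENNReal.ofReal_le_ofReal_iff (half_pos hε).le] at ha
  rw [dist_eq_norm]
  linarith

/-- The functional `f ↦ ∫ w f`. -/
theorem exists_clm_integral_mul [Fact (1 ≤ p)] [q.HolderConjugate p] {w : Circle → ℂ}
    (hw : MemLp w q circleMeasure) :
    ∃ L : Lp ℂ p circleMeasure →L[ℂ] ℂ, ∀ f : Circle → ℂ, ∀ hf : MemLp f p circleMeasure,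
      L (hf.toLp f) = ∫ t, w t * f t ∂circleMeasure := by
  have : Fact (1 ≤ q) := ⟨ENNReal.HolderConjugate.one_le q p⟩
  refine ⟨(ContinuousLinearMap.mul ℂ ℂ).lpPairing circleMeasure q p (hw.toLp w), fun f hf => ?_⟩
  rw [ContinuousLinearMap.lpPairing_eq_integral]
  refine integral_congr_ae ?_
  filter_upwards [hw.coeFn_toLp, hf.coeFn_toLp] with t h1 h2
  simp [h1, h2]

theorem exists_clm_coef [Fact (1 ≤ p)] (n : ℤ) : ∃ L : Lp ℂ p circleMeasure →L[ℂ] ℂ,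
    ∀ f : Lp ℂ p circleMeasure, L f = coef f n := by
  have := ENNReal.HolderConjugate.conjExponent (Fact.out : 1 ≤ p)
  obtain ⟨L, hL⟩ := exists_clm_integral_mul (p := p) (memLp_coe_zpow p.conjExponent (-n))
  refine ⟨L, fun f => ?_⟩
  have h := hL f (Lp.memLp f)
  rwa [Lp.toLp_coeFn] at h

theorem continuous_coef [Fact (1 ≤ p)] (n : ℤ) :
    Continuous fun f : Lp ℂ p circleMeasure => coef f n := by
  obtain ⟨L, hL⟩ := exists_clm_coef (p := p) n
  simpa only [← hL] using L.continuous

theorem coef_trigPolyLp (a : ℤ →₀ ℂ) (n : ℤ) : coef (trigPolyLp p a) n = a n := by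
  rw [coef_congr (coeFn_trigPolyLp p a), coef_trigPoly]

/-- The M. Riesz bound extends the projection from the dense trigonometric polynomials; its effect
on coefficients extends because these are continuous on `L^p`. -/
theorem exists_rieszProj [Fact (1 ≤ p)] (hp1 : 1 < p) (hp : p ≠ ∞) :
    ∃ P : Lp ℂ p circleMeasure →L[ℂ] Lp ℂ p circleMeasure,
      (∀ a, P (trigPolyLp p a) = trigPolyLp p (nonnegPart a)) ∧ ∀ f : Lp ℂ p circleMeasure, IsAnalyticPart f (P f) := by
  obtain ⟨C, hC⟩ := exists_eLpNorm_nonnegPart_le hp1 hp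
  let φ : (ℤ →₀ ℂ) →ₗ[ℂ] Lp ℂ p circleMeasure :=
    { toFun := fun a => trigPolyLp p (nonnegPart a)
      map_add' := fun a b => by rw [nonnegPart, Finsupp.filter_add, map_add]; rfl
      map_smul' := fun c a => by rw [nonnegPart, Finsupp.filter_smul, map_smul]; rfl }
  have hd := denseRange_trigPolyLp (p := p) hp
  have hbound : ∃ C : ℝ, ∀ a, ‖φ a‖ ≤ C * ‖trigPolyLp p a‖ := by
    refine ⟨C, fun a => ?_⟩
    have h1 : ∀ a, ‖trigPolyLp p a‖ₑ = eLpNorm (trigPoly a) p circleMeasure := fun a =>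
      (Lp.enorm_def _).trans (eLpNorm_congr_ae (coeFn_trigPolyLp p a))
    have h2 := hC a
    rw [← h1, ← h1, enorm_eq_nnnorm, enorm_eq_nnnorm, ← ENNReal.coe_mul, ENNReal.coe_le_coe] at h2
    exact_mod_cast h2
  have hP : ∀ a, φ.extendOfNorm (trigPolyLp p) (trigPolyLp p a) = trigPolyLp p (nonnegPart a) :=
    LinearMap.extendOfNorm_eq hd hbound
  refine ⟨φ.extendOfNorm (trigPolyLp p), hP, fun f n => ?_⟩
  have hc : Continuous fun f : Lp ℂ p circleMeasure => if 0 ≤ n then coef f n else 0 := by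
    split_ifs
    · exact continuous_coef n
    · exact continuous_const
  refine congrFun (hd.equalizer ((continuous_coef n).comp
    (φ.extendOfNorm (trigPolyLp p)).continuous) hc ?_) f
  ext a
  simp only [Function.comp_apply]
  rw [hP, coef_trigPolyLp, coef_trigPolyLp, nonnegPart_apply]

theorem integrable_of_memLp [Fact (1 ≤ p)] (f : Lp ℂ p circleMeasure) : Integrable f circleMeasure :=
  (Lp.memLp f).integrable Fact.out

theorem Lp_ext_coef [Fact (1 ≤ p)] {f g : Lp ℂ p circleMeasure} (h : ∀ n, coef f n = coef g n) :
    f = g :=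
  Lp.ext (ae_eq_of_coef_eq (integrable_of_memLp f) (integrable_of_memLp g) h)

/-- Functionals agreeing on all `tᵏ`, `k ≥ 0`, agree on `H^p`. -/
theorem hardy_functional_ext [Fact (1 ≤ p)] (hp1 : 1 < p) (hp : p ≠ ∞)
    {φ ψ : Lp ℂ p circleMeasure →L[ℂ] ℂ}
    (h : ∀ k : ℕ, φ ((memLp_coe_zpow p k).toLp) = ψ ((memLp_coe_zpow p k).toLp))
    {f : Lp ℂ p circleMeasure} (hf : f ∈ Hardy p) : φ f = ψ f := by
  obtain ⟨P, hP, hPc⟩ := exists_rieszProj hp1 hp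
  have hPf : P f = f := Lp_ext_coef fun n => by
    rw [hPc f n]
    split_ifs with hn
    · rfl
    · exact (hf.2 n (by lia)).symm
  have hd := denseRange_trigPolyLp (p := p) hp
  -- Composing with the projection replaces `H^p` by the whole of `L^p`, where trigonometric
  -- polynomials are known to be dense.
  have key : (fun f => φ (P f)) = fun f => ψ (P f) := by
    refine hd.equalizer (φ.continuous.comp P.continuous) (ψ.continuous.comp P.continuous) ?_
    ext a
    simp only [Function.comp_apply, hP]
    have hsum : trigPolyLp p (nonnegPart a) =
        (nonnegPart a).sum fun k c => c • (memLp_coe_zpow p k).toLp := by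
      conv_lhs => rw [← Finsupp.sum_single (nonnegPart a)]
      rw [Finsupp.sum, map_sum]
      refine Finset.sum_congr rfl fun k _ => ?_
      refine Lp.ext ?_
      filter_upwards [coeFn_trigPolyLp p (Finsupp.single k (nonnegPart a k)),
        Lp.coeFn_smul (nonnegPart a k) (memLp_coe_zpow p k).toLp, (memLp_coe_zpow p k).coeFn_toLp]
        with t h1 h2 h3
      rw [h1, trigPoly_single, h2, Pi.smul_apply, h3, smul_eq_mul]
    rw [hsum, Finsupp.sum, map_sum, map_sum]
    refine Finset.sum_congr rfl fun k hk => ?_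
    rw [Finsupp.mem_support_iff, nonnegPart_apply] at hk
    have h0 : 0 ≤ k := by by_contra h0; simp [h0] at hk
    lift k to ℕ using h0
    rw [map_smul, map_smul, h]
  have := congrFun key f
  simpa only [hPf] using this

/-- The conjugate of a conjugate Hardy function. -/
theorem MemHardyConj.conj {f : Circle → ℂ} (hf : MemHardyConj p f) :
    MemHardy p fun t => conj (f t) := by
  refine ⟨⟨Complex.continuous_conj.comp_aestronglyMeasurable hf.1.1, ?_⟩, fun n hn => ?_⟩
  · rw [eLpNorm_conj_comp]
    exact hf.1.2
  · rw [coef_conj, hf.2 _ (by lia), map_zero]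

theorem MemHardy.conj {f : Circle → ℂ} (hf : MemHardy p f) :
    MemHardyConj p fun t => conj (f t) := by
  refine ⟨⟨Complex.continuous_conj.comp_aestronglyMeasurable hf.1.1, ?_⟩, fun n hn => ?_⟩
  · rw [eLpNorm_conj_comp]
    exact hf.1.2
  · rw [coef_conj, hf.2 _ (by lia), map_zero]

theorem MemHardy.congr {f g : Circle → ℂ} (hf : MemHardy p f) (h : f =ᵐ[circleMeasure] g) :
    MemHardy p g :=
  ⟨(memLp_congr_ae h).1 hf.1, fun n hn => by rw [← coef_congr h, hf.2 n hn]⟩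

theorem MemHardyConj.congr {f g : Circle → ℂ} (hf : MemHardyConj p f) (h : f =ᵐ[circleMeasure] g) :
    MemHardyConj p g :=
  ⟨(memLp_congr_ae h).1 hf.1, fun n hn => by rw [← coef_congr h, hf.2 n hn]⟩

variable [p.HolderConjugate q]

/-- Both sides are continuous functionals of `v ∈ H^q`, so it suffices to take `v = tᵏ`. For `k > 0`
both vanish, because `n - k < 0`. -/
theorem MemHardy.coef_mul_aux (hp : p ≠ ∞) (hq : q ≠ ∞) {u v : Circle → ℂ} (hu : MemHardy p u)
    (hv : MemHardy q v) {n : ℤ} (hn : n ≤ 0) :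
    coef (fun t => u t * v t) n = coef u n * coef v 0 := by
  have hq1 : 1 < q := (ENNReal.HolderConjugate.lt_top_iff_one_lt p q).1 hp.lt_top
  have : Fact (1 ≤ q) := ⟨hq1.le⟩
  have hw : MemLp (fun t : Circle => (t : ℂ) ^ (-n) * u t) p circleMeasure := by
    refine hu.1.of_le ((continuous_coe_zpow _).aestronglyMeasurable.mul hu.1.1)
      (ae_of_all _ fun t => ?_)
    rw [norm_mul, norm_coe_zpow, one_mul]
  obtain ⟨φ, hφ⟩ := exists_clm_integral_mul (p := q) (q := p) hw
  obtain ⟨ψ, hψ⟩ := exists_clm_coef (p := q) 0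
  have hmem : hv.1.toLp v ∈ Hardy q := hv.congr hv.1.coeFn_toLp.symm
  have key := hardy_functional_ext hq1 hq (φ := φ) (ψ := coef u n • ψ) (fun k => ?_) hmem
  · rw [hφ] at key
    rw [coef]
    simp only [mul_assoc] at key
    rw [key, _root_.smul_apply, hψ, coef_congr hv.1.coeFn_toLp, smul_eq_mul]
  · rw [hφ, _root_.smul_apply, hψ, coef_congr (MemLp.coeFn_toLp _), coef_zpow, smul_eq_mul]
    have e1 : ∫ t : Circle, (t : ℂ) ^ (-n) * u t * (t : ℂ) ^ (k : ℤ) ∂circleMeasure =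
        coef u (n - k) := by
      rw [← coef_zpow_mul, coef]
      congr 1 with t
      ring
    rw [e1]
    rcases eq_or_ne k 0 with rfl | hk
    · simp
    · rw [if_neg (by lia), mul_zero, hu.2 _ (by lia)]

theorem MemHardy.mul (hp : p ≠ ∞) (hq : q ≠ ∞) {u v : Circle → ℂ} (hu : MemHardy p u)
    (hv : MemHardy q v) : MemHardy 1 fun t => u t * v t :=
  ⟨memLp_one_iff_integrable.2 (hu.1.integrable_mul hv.1), fun n hn => by
    rw [hu.coef_mul_aux hp hq hv hn.le, hu.2 n hn, zero_mul]⟩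

theorem MemHardy.coef_zero_mul (hp : p ≠ ∞) (hq : q ≠ ∞) {u v : Circle → ℂ} (hu : MemHardy p u)
    (hv : MemHardy q v) : coef (fun t => u t * v t) 0 = coef u 0 * coef v 0 :=
  hu.coef_mul_aux hp hq hv le_rfl

theorem MemHardyConj.coef_mul_eq {u v : Circle → ℂ} (n : ℤ) :
    coef (fun t => u t * v t) n =
      (starRingEnd ℂ) (coef (fun t => (starRingEnd ℂ) (u t) * (starRingEnd ℂ) (v t)) (-n)) := by
  rw [← coef_conj]
  simp

theorem MemHardyConj.mul (hp : p ≠ ∞) (hq : q ≠ ∞) {u v : Circle → ℂ} (hu : MemHardyConj p u)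
    (hv : MemHardyConj q v) : MemHardyConj 1 fun t => u t * v t :=
  ⟨memLp_one_iff_integrable.2 (hu.1.integrable_mul hv.1), fun n hn => by
    rw [MemHardyConj.coef_mul_eq, (hu.conj.mul hp hq hv.conj).2 _ (by lia), map_zero]⟩

theorem MemHardyConj.coef_zero_mul (hp : p ≠ ∞) (hq : q ≠ ∞) {u v : Circle → ℂ}
    (hu : MemHardyConj p u) (hv : MemHardyConj q v) :
    coef (fun t => u t * v t) 0 = coef u 0 * coef v 0 := by
  rw [MemHardyConj.coef_mul_eq, neg_zero, hu.conj.coef_zero_mul hp hq hv.conj, coef_conj, coef_conj]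
  simp

/-- A product of Hardy functions vanishes only if one of the factors does. -/
theorem MemHardy.ae_eq_zero_or_of_mul (hp : p ≠ ∞) (hq : q ≠ ∞) {u v : Circle → ℂ}
    (hu : MemHardy p u) (hv : MemHardy q v) (h : ∀ᵐ t ∂circleMeasure, u t * v t = 0) :
    u =ᵐ[circleMeasure] 0 ∨ v =ᵐ[circleMeasure] 0 := by
  -- Dividing a nonzero Hardy function by its lowest power of `t` leaves a nonzero constant
  -- coefficient; those of two factors multiply, so the product cannot vanish.
  have key : ∀ {p : ℝ≥0∞} {f : Circle → ℂ}, MemHardy p f → 1 ≤ p → ¬ f =ᵐ[circleMeasure] 0 →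
      ∃ k : ℕ, coef f k ≠ 0 ∧ MemHardy p fun t => (t : ℂ) ^ (-(k : ℤ)) * f t := by
    intro p f hf hp1 hf0
    classical
    have hex : ∃ k : ℕ, coef f k ≠ 0 := by
      by_contra! hall
      refine hf0 (ae_eq_zero_of_coef_eq_zero (hf.1.integrable hp1) fun n => ?_)
      rcases lt_or_ge n 0 with hn | hn
      · exact hf.2 n hn
      · lift n to ℕ using hn
        exact hall n
    refine ⟨Nat.find hex, Nat.find_spec hex, hf.1.of_le
      ((continuous_coe_zpow _).aestronglyMeasurable.mul hf.1.1) (ae_of_all _ fun t => ?_), fun n hn => ?_⟩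
    · rw [norm_mul, norm_coe_zpow, one_mul]
    · rw [coef_zpow_mul]
      rcases lt_or_ge (n - -(Nat.find hex : ℤ)) 0 with h1 | h1
      · exact hf.2 _ h1
      · obtain ⟨m, hm⟩ := Int.eq_ofNat_of_zero_le h1
        rw [hm]
        by_contra h2
        exact Nat.find_min hex (m := m) (by lia) h2
  by_contra! hcon
  obtain ⟨k, hk, hk'⟩ := key hu (ENNReal.HolderConjugate.one_le p q) hcon.1
  obtain ⟨l, hl, hl'⟩ := key hv (ENNReal.HolderConjugate.one_le q p) hcon.2
  have h1 := hk'.coef_zero_mul hp hq hl'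
  rw [coef_zpow_mul, coef_zpow_mul] at h1
  have h2 : (fun t : Circle => (t : ℂ) ^ (-(k : ℤ)) * u t * ((t : ℂ) ^ (-(l : ℤ)) * v t))
      =ᵐ[circleMeasure] fun _ => 0 := h.mono fun t ht => by
    simp only
    rw [mul_mul_mul_comm, ht, mul_zero]
  rw [coef_congr h2, coef_const] at h1
  simp [hk, hl] at h1

end RieszProj

/-! ### Toeplitz operators -/

section Toeplitz

variable {p : ℝ≥0∞} [Fact (1 ≤ p)]

theorem isClosed_hardy : IsClosed (Hardy p : Set (Lp ℂ p circleMeasure)) := by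
  have h : (Hardy p : Set (Lp ℂ p circleMeasure)) =
      ⋂ n : ℤ, ⋂ _ : n < 0, {f : Lp ℂ p circleMeasure | coef f n = 0} := by
    ext f
    simp only [Set.mem_iInter, Set.mem_ofPred_eq]
    exact ⟨fun hf => hf.2, fun hf => ⟨Lp.memLp f, hf⟩⟩
  rw [h]
  exact isClosed_iInter fun n => isClosed_iInter fun _ => isClosed_eq (continuous_coef n) continuous_const

instance : CompleteSpace (Hardy p) := isClosed_hardy.completeSpace_coe

theorem hardy_ext_coef {f g : Hardy p} (h : ∀ n : ℤ, 0 ≤ n →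
    coef (f : Lp ℂ p circleMeasure) n = coef (g : Lp ℂ p circleMeasure) n) : f = g := by
  refine Subtype.ext (Lp_ext_coef fun n => ?_)
  rcases lt_or_ge n 0 with hn | hn
  · rw [f.2.2 n hn, g.2.2 n hn]
  · exact h n hn

theorem MemHardy.toLp_mem {f : Circle → ℂ} (hf : MemHardy p f) : hf.1.toLp f ∈ Hardy p :=
  hf.congr hf.1.coeFn_toLp.symm

/-- A Hardy function as an element of the Hardy space. -/
noncomputable def MemHardy.toHardy {f : Circle → ℂ} (hf : MemHardy p f) : Hardy p :=
  ⟨hf.1.toLp f, hf.toLp_mem⟩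

theorem MemHardy.coeFn_toHardy {f : Circle → ℂ} (hf : MemHardy p f) :
    (hf.toHardy : Lp ℂ p circleMeasure) =ᵐ[circleMeasure] f :=
  hf.1.coeFn_toLp

theorem memLp_bdd_mul {q : ℝ≥0∞} {G f : Circle → ℂ} (hG : AEStronglyMeasurable G circleMeasure) {K : ℝ}
    (hK : ∀ᵐ t ∂circleMeasure, ‖G t‖ ≤ K) (hf : MemLp f q circleMeasure) :
    MemLp (fun t => G t * f t) q circleMeasure :=
  hf.of_le_mul (c := K) (hG.mul hf.1) (hK.mono fun t ht => by
    rw [norm_mul]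
    exact mul_le_mul_of_nonneg_right ht (norm_nonneg _))

/-- The constant does not depend on the symbol: uniformly close symbols therefore give operators
close in norm, which is how the approximation of `g` is used. -/
theorem exists_toeplitz (hp1 : 1 < p) (hp : p ≠ ∞) : ∃ C : ℝ, 0 ≤ C ∧ ∀ G : Circle → ℂ,
    AEStronglyMeasurable G circleMeasure → ∀ K : ℝ, 0 ≤ K → (∀ᵐ t ∂circleMeasure, ‖G t‖ ≤ K) →
      ∃ A : Hardy p →L[ℂ] Hardy p, IsToeplitzOperator p G A ∧ ‖A‖ ≤ C * K := by
  obtain ⟨P, -, hP⟩ := exists_rieszProj hp1 hp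
  refine ⟨‖P‖, norm_nonneg _, fun G hG K hK0 hK => ?_⟩
  have hm : ∀ f : Lp ℂ p circleMeasure, MemLp (fun t => G t * f t) p circleMeasure := fun f =>
    memLp_bdd_mul hG hK (Lp.memLp f)
  let M : Lp ℂ p circleMeasure →ₗ[ℂ] Lp ℂ p circleMeasure :=
    { toFun := fun f => (hm f).toLp
      map_add' := fun f g => Lp.ext (by
        filter_upwards [(hm (f + g)).coeFn_toLp, (hm f).coeFn_toLp, (hm g).coeFn_toLp,
          Lp.coeFn_add (hm f).toLp (hm g).toLp, Lp.coeFn_add f g] with t h1 h2 h3 h4 h5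
        rw [h1, h4, Pi.add_apply, h2, h3, h5, Pi.add_apply, mul_add])
      map_smul' := fun c f => Lp.ext (by
        filter_upwards [(hm (c • f)).coeFn_toLp, (hm f).coeFn_toLp,
          Lp.coeFn_smul c (hm f).toLp, Lp.coeFn_smul c f] with t h1 h2 h3 h4
        rw [h1, RingHom.id_apply, h3, Pi.smul_apply, h2, h4, Pi.smul_apply, smul_eq_mul, smul_eq_mul,
          mul_left_comm]) }
  have hMn : ∀ f, ‖M f‖ ≤ K * ‖f‖ := fun f => by
    refine Lp.norm_le_mul_norm_of_ae_le_mul ?_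
    filter_upwards [(hm f).coeFn_toLp, hK] with t h1 h2
    change ‖(hm f).toLp _ t‖ ≤ _
    rw [h1, norm_mul]
    gcongr
  have hmem : ∀ φ : Hardy p, (P.comp ((M.mkContinuous K hMn).comp (Hardy p).subtypeL)) φ ∈ Hardy p :=
    fun φ => ⟨Lp.memLp _, fun n hn => by
      have := hP (M φ) n
      rw [if_neg (by lia)] at this
      exact this⟩
  refine ⟨(P.comp ((M.mkContinuous K hMn).comp (Hardy p).subtypeL)).codRestrict (Hardy p) hmem,
    fun φ n => ?_, ?_⟩
  · have := hP (M φ) n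
    rw [show coef (M φ) n = coef (fun t => G t * (φ : Lp ℂ p circleMeasure) t) n from
      coef_congr (hm φ).coeFn_toLp n] at this
    exact this
  · refine ContinuousLinearMap.opNorm_le_bound _ (by positivity) fun φ => ?_
    change ‖P (M φ)‖ ≤ _
    calc ‖P (M φ)‖ ≤ ‖P‖ * ‖M φ‖ := P.le_opNorm _
      _ ≤ ‖P‖ * (K * ‖φ‖) := by
        gcongr
        exact hMn φ
      _ = _ := by ring

theorem IsToeplitzOperator.coef_eq {G : Circle → ℂ} {A : Hardy p →L[ℂ] Hardy p}
    (hA : IsToeplitzOperator p G A) (φ : Hardy p) {n : ℤ} (hn : 0 ≤ n) :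
    coef (A φ : Lp ℂ p circleMeasure) n =
      coef (fun t => G t * (φ : Lp ℂ p circleMeasure) t) n := by
  have := hA φ n
  rwa [if_pos hn] at this

theorem isToeplitzOperator_of_coef {G : Circle → ℂ} {A : Hardy p →L[ℂ] Hardy p}
    (h : ∀ (φ : Hardy p) (n : ℤ), 0 ≤ n → coef (A φ : Lp ℂ p circleMeasure) n =
      coef (fun t => G t * (φ : Lp ℂ p circleMeasure) t) n) : IsToeplitzOperator p G A := by
  intro φ n
  split_ifs with hn
  · exact h φ n hn
  · exact (A φ).2.2 n (by lia)

/-- The action of an analytic Toeplitz operator with symbol `tᵐ`. -/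
theorem IsToeplitzOperator.coeFn_zpow {m : ℤ} (hm : 0 ≤ m) {S : Hardy p →L[ℂ] Hardy p}
    (hS : IsToeplitzOperator p (fun t => (t : ℂ) ^ m) S) (φ : Hardy p) :
    (S φ : Lp ℂ p circleMeasure) =ᵐ[circleMeasure]
      fun t => (t : ℂ) ^ m * (φ : Lp ℂ p circleMeasure) t := by
  refine ae_eq_of_coef_eq (integrable_of_memLp _)
    (integrable_zpow_mul (integrable_of_memLp _) m) fun n => ?_
  rw [hS φ n]
  split_ifs with hn
  · rfl
  · rw [coef_zpow_mul, φ.2.2 _ (by lia)]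

/-- An analytic power on the right acts as plain multiplication, so no projection separates the two
symbols. -/
theorem IsToeplitzOperator.comp_zpow {m : ℤ} (hm : 0 ≤ m) {G : Circle → ℂ} {A S : Hardy p →L[ℂ] Hardy p}
    (hA : IsToeplitzOperator p G A) (hS : IsToeplitzOperator p (fun t => (t : ℂ) ^ m) S) :
    IsToeplitzOperator p (fun t => (t : ℂ) ^ m * G t) (A.comp S) :=
  isToeplitzOperator_of_coef fun φ n hn => by
    rw [ContinuousLinearMap.comp_apply, hA.coef_eq _ hn]
    refine coef_congr ((hS.coeFn_zpow hm φ).mono fun t ht => ?_) n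
    simp only [ht]
    ring

/-- A nonpositive power on the left reads, at frequency `n ≥ 0`, the coefficient at `n - m ≥ 0`,
which the inner projection leaves unchanged. -/
theorem IsToeplitzOperator.zpow_comp {m : ℤ} (hm : m ≤ 0) {G : Circle → ℂ} {A D : Hardy p →L[ℂ] Hardy p}
    (hA : IsToeplitzOperator p G A) (hD : IsToeplitzOperator p (fun t => (t : ℂ) ^ m) D) :
    IsToeplitzOperator p (fun t => (t : ℂ) ^ m * G t) (D.comp A) :=
  isToeplitzOperator_of_coef fun φ n hn => by
    rw [ContinuousLinearMap.comp_apply, hD.coef_eq _ hn, coef_zpow_mul, hA.coef_eq _ (by lia)]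
    simp only [mul_assoc]
    rw [coef_zpow_mul]

theorem exists_toeplitz_zpow (hp1 : 1 < p) (hp : p ≠ ∞) (m : ℤ) :
    ∃ S : Hardy p →L[ℂ] Hardy p, IsToeplitzOperator p (fun t => (t : ℂ) ^ m) S := by
  obtain ⟨C, -, hC⟩ := exists_toeplitz hp1 hp
  obtain ⟨S, hS, -⟩ := hC _ (continuous_coe_zpow m).aestronglyMeasurable 1 zero_le_one
    (ae_of_all _ fun t => (norm_coe_zpow t m).le)
  exact ⟨S, hS⟩

theorem toeplitz_leftInverse {m : ℕ} {S D : Hardy p →L[ℂ] Hardy p}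
    (hS : IsToeplitzOperator p (fun t => (t : ℂ) ^ (m : ℤ)) S)
    (hD : IsToeplitzOperator p (fun t => (t : ℂ) ^ (-m : ℤ)) D) (φ : Hardy p) : D (S φ) = φ :=
  hardy_ext_coef fun n hn => by
    rw [hD.coef_eq _ hn, coef_zpow_mul, coef_congr (hS.coeFn_zpow (by lia) φ), coef_zpow_mul]
    congr 1
    ring

/-- The first `m` coefficients of a Hardy function. -/
theorem exists_linearMap_coef (m : ℕ) : ∃ c : Hardy p →ₗ[ℂ] (Fin m → ℂ),
    ∀ φ i, c φ i = coef (φ : Lp ℂ p circleMeasure) (i : ℕ) := by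
  choose L hL using fun n : ℤ => exists_clm_coef (p := p) n
  exact ⟨LinearMap.pi fun i => (L ((i : ℕ) : ℤ)).toLinearMap.comp (Hardy p).subtype,
    fun φ i => hL _ _⟩

theorem memHardy_coe_pow (p : ℝ≥0∞) (k : ℕ) : MemHardy p fun t => (t : ℂ) ^ (k : ℤ) :=
  ⟨memLp_coe_zpow p k, fun n hn => by rw [coef_zpow, if_neg (by lia)]⟩

theorem toeplitz_range_eq_ker {m : ℕ} {S D : Hardy p →L[ℂ] Hardy p}
    (hS : IsToeplitzOperator p (fun t => (t : ℂ) ^ (m : ℤ)) S)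
    (hD : IsToeplitzOperator p (fun t => (t : ℂ) ^ (-m : ℤ)) D)
    {c : Hardy p →ₗ[ℂ] (Fin m → ℂ)} (hc : ∀ φ i, c φ i = coef (φ : Lp ℂ p circleMeasure) (i : ℕ)) :
    S.range = LinearMap.ker c := by
  ext φ
  rw [LinearMap.mem_ker, LinearMap.mem_range]
  constructor
  · rintro ⟨ψ, rfl⟩
    ext i
    rw [hc, Pi.zero_apply]
    change coef (S ψ : Lp ℂ p circleMeasure) _ = 0
    rw [coef_congr (hS.coeFn_zpow (by lia) ψ), coef_zpow_mul,
      ψ.2.2 _ (by have := i.2; omega)]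
  · intro h
    refine ⟨D φ, hardy_ext_coef fun n hn => ?_⟩
    change coef (S (D φ) : Lp ℂ p circleMeasure) _ = _
    rw [coef_congr (hS.coeFn_zpow (by lia) _), coef_zpow_mul]
    rcases lt_or_ge n m with h1 | h1
    · rw [(D φ).2.2 _ (by lia)]
      lift n to ℕ using hn
      have h2 := congrFun h ⟨n, by lia⟩
      rw [hc, Pi.zero_apply] at h2
      exact h2.symm
    · rw [hD.coef_eq _ (by lia), coef_zpow_mul]
      congr 1
      ring

theorem surjective_coef {m : ℕ} {c : Hardy p →ₗ[ℂ] (Fin m → ℂ)}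
    (hc : ∀ φ i, c φ i = coef (φ : Lp ℂ p circleMeasure) (i : ℕ)) : Function.Surjective c := by
  intro x
  refine ⟨∑ i : Fin m, x i • (memHardy_coe_pow p i).toHardy, ?_⟩
  have h1 : ∀ i : Fin m, c (memHardy_coe_pow p i).toHardy = Pi.single i 1 := fun i => by
    ext j
    rw [hc, coef_congr (memHardy_coe_pow p i).coeFn_toHardy, coef_zpow, Pi.single_apply]
    simp [Fin.ext_iff]
  rw [map_sum]
  simp only [map_smul, h1]
  ext j
  simp [Pi.single_apply]

/-- `S` is injective and its range is cut out by the first `m` coefficients; `D` is a left inverse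
of `S`, so its index follows from additivity. -/
theorem toeplitz_pow_fredholm {m : ℕ} {S D : Hardy p →L[ℂ] Hardy p}
    (hS : IsToeplitzOperator p (fun t => (t : ℂ) ^ (m : ℤ)) S)
    (hD : IsToeplitzOperator p (fun t => (t : ℂ) ^ (-m : ℤ)) D) :
    S.IsFredholm ∧ D.IsFredholm ∧ fredholmIndex S = -m ∧ fredholmIndex D = m := by
  obtain ⟨c, hc⟩ := exists_linearMap_coef (p := p) m
  have hr := toeplitz_range_eq_ker hS hD hc
  have e := (Submodule.quotEquivOfEq _ _ hr).trans
    (c.quotKerEquivOfSurjective (surjective_coef hc))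
  have hfin : FiniteDimensional ℂ (Hardy p ⧸ S.range) := e.symm.finiteDimensional
  have hrank : Module.finrank ℂ (Hardy p ⧸ S.range) = m := by rw [e.finrank_eq]; simp
  have hDS : D.toLinearMap ∘ₗ S.toLinearMap = LinearMap.id :=
    LinearMap.ext fun φ => toeplitz_leftInverse hS hD φ
  have hq : D.toLinearMap.IsQuasiInverse S.toLinearMap := by
    open scoped LinearMap.FiniteRangeSetoid in
    refine ⟨?_, ?_⟩
    · rw [LinearMap.IsLeftQuasiInverse, hDS]
    · refine LinearMap.FiniteRangeSetoid.equiv_of_eqOn_coFG (A := S.range) hfin ?_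
      rintro _ ⟨φ, rfl⟩
      change S (D (S φ)) = S φ
      rw [toeplitz_leftInverse hS hD]
  have hSF := ContinuousLinearMap.IsFredholm.of_isQuasiInverse hq
  have hDF := ContinuousLinearMap.IsFredholm.of_isQuasiInverse hq.symm
  have hSi : fredholmIndex S = -m := by
    have hker : S.ker = ⊥ := LinearMap.ker_eq_bot.2
      (Function.LeftInverse.injective (toeplitz_leftInverse hS hD))
    rw [fredholmIndex, hrank, hker]
    simp
  refine ⟨hSF, hDF, hSi, ?_⟩
  have := hSF.finite_ker
  have := hDF.finite_ker
  have : FiniteDimensional ℂ (Hardy p ⧸ D.range) := hDF.finite_coker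
  have h1 := LinearMap.index_comp (f := S.toLinearMap) D.toLinearMap
  rw [hDS, LinearMap.index_id] at h1
  have h2 : fredholmIndex S = S.toLinearMap.index := rfl
  have h3 : fredholmIndex D = D.toLinearMap.index := rfl
  lia

theorem fredholm_comp {E : Type*} [NormedAddCommGroup E] [NormedSpace ℂ E] [CompleteSpace E]
    {A B : E →L[ℂ] E} (hA : A.IsFredholm) (hB : B.IsFredholm) :
    (A.comp B).IsFredholm ∧ fredholmIndex (A.comp B) = fredholmIndex A + fredholmIndex B := by
  obtain ⟨v, hv⟩ := hA.exists_isQuasiInverse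
  obtain ⟨w, hw⟩ := hB.exists_isQuasiInverse
  refine ⟨.of_isQuasiInverse (v := w.comp v) (hw.comp hv), ?_⟩
  have := hA.finite_ker
  have := hB.finite_ker
  have : FiniteDimensional ℂ (E ⧸ A.range) := hA.finite_coker
  have : FiniteDimensional ℂ (E ⧸ B.range) := hB.finite_coker
  exact LinearMap.index_comp (f := B.toLinearMap) A.toLinearMap

/-- Multiplying the symbol by `tⁿ` reduces the index by `n`. -/
theorem exists_toeplitz_index_zero (hp1 : 1 < p) (hp : p ≠ ∞) {g : Circle → ℂ} {n : ℤ}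
    (hT : ToeplitzFredholmWithIndex p g n) : ∃ B : Hardy p →L[ℂ] Hardy p,
      IsToeplitzOperator p (fun t => (t : ℂ) ^ n * g t) B ∧ B.IsFredholm ∧ fredholmIndex B = 0 := by
  obtain ⟨A, hA, hAF, hAi⟩ := hT
  obtain ⟨m, hm⟩ := Int.eq_nat_or_neg n
  obtain ⟨S, hS⟩ := exists_toeplitz_zpow hp1 hp m
  obtain ⟨D, hD⟩ := exists_toeplitz_zpow hp1 hp (-m)
  obtain ⟨hSF, hDF, hSi, hDi⟩ := toeplitz_pow_fredholm hS hD
  rcases hm with rfl | rfl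
  · refine ⟨A.comp S, hA.comp_zpow (by lia) hS, (fredholm_comp hAF hSF).1, ?_⟩
    rw [(fredholm_comp hAF hSF).2, hAi, hSi, add_neg_cancel]
  · refine ⟨D.comp A, hA.zpow_comp (by lia) hD, (fredholm_comp hDF hAF).1, ?_⟩
    rw [(fredholm_comp hDF hAF).2, hAi, hDi, add_neg_cancel]

end Toeplitz

/-! ### Invertibility of Toeplitz operators and factorization -/

/-- Pull back a norming functional from the quotient, which is a normed space because the subspace
is closed. -/
theorem exists_dual_eq_zero_of_isClosed {E : Type*} [NormedAddCommGroup E] [NormedSpace ℂ E]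
    {S : Submodule ℂ E} (hS : IsClosed (S : Set E)) (h : S ≠ ⊤) :
    ∃ L : E →L[ℂ] ℂ, L ≠ 0 ∧ ∀ y ∈ S, L y = 0 := by
  obtain ⟨x, -, hx⟩ := SetLike.exists_of_lt (lt_top_iff_ne_top.2 h)
  have h1 : (S.mkQ x) ≠ 0 := fun h0 => hx ((Submodule.Quotient.mk_eq_zero _).1 h0)
  obtain ⟨Λ, -, hΛ⟩ := exists_dual_vector ℂ (S.mkQ x) (norm_ne_zero_iff.2 h1)
  refine ⟨Λ.comp S.mkQL, fun h0 => ?_, fun y hy => ?_⟩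
  · have h2 : Λ (S.mkQ x) = 0 := congrArg (fun L : E →L[ℂ] ℂ => L x) h0
    rw [h2] at hΛ
    exact h1 (norm_eq_zero.1 (RCLike.ofReal_eq_zero.1 hΛ.symm))
  · have : S.mkQ y = 0 := (Submodule.Quotient.mk_eq_zero _).2 hy
    change Λ (S.mkQ y) = 0
    rw [this, map_zero]

/-! ### Functionals on `H^p` and Coburn's theorem -/

section Coburn

variable {p q : ℝ≥0∞} [Fact (1 ≤ p)] [p.HolderConjugate q]

omit [Fact (1 ≤ p)] in
theorem conj_ne_top_of_one_lt (hp1 : 1 < p) : q ≠ ∞ :=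
  ((ENNReal.HolderConjugate.lt_top_iff_one_lt q p).2 hp1).ne

omit [p.HolderConjugate q] in
theorem coef_hardy_zero (n : ℤ) : coef ((0 : Hardy p) : Lp ℂ p circleMeasure) n = 0 :=
  (coef_congr (h := fun _ => 0) (Lp.coeFn_zero ℂ p circleMeasure) n).trans (by simp [coef])

omit [p.HolderConjugate q] in
theorem isAnalyticPart_self (φ : Hardy p) :
    IsAnalyticPart (φ : Lp ℂ p circleMeasure) (φ : Lp ℂ p circleMeasure) := fun n => by
  split_ifs with hn
  · rfl
  · exact φ.2.2 n (by lia)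

/-- Precomposing with the Riesz projection extends `L` to `L^p`, where it is integration against
some `h ∈ L^q`. The formula in terms of any `w` with `P w = φ` allows `L (T(G) φ)` to be computed as
the integral of `h G φ`, without the projection. -/
theorem exists_hardy_functional (hp1 : 1 < p) (hp : p ≠ ∞) (L : Hardy p →L[ℂ] ℂ) :
    ∃ h : Circle → ℂ, MemHardyConj q h ∧ ∀ w : Circle → ℂ, MemLp w p circleMeasure →
      ∀ φ : Hardy p, IsAnalyticPart w (φ : Lp ℂ p circleMeasure) →
        L φ = ∫ t, h t * w t ∂circleMeasure := by
  obtain ⟨P, -, hP⟩ := exists_rieszProj hp1 hp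
  have hmem : ∀ f, P f ∈ Hardy p := fun f => ⟨Lp.memLp _, fun n hn => by
    rw [hP f n, if_neg (by lia)]⟩
  obtain ⟨h, hh, hL⟩ := exists_memLp_forall_eq_integral_mul (q := q) hp
    (conj_ne_top_of_one_lt hp1) (L.comp (P.codRestrict (Hardy p) hmem))
  have key : ∀ w : Circle → ℂ, MemLp w p circleMeasure →
      ∀ φ : Hardy p, IsAnalyticPart w (φ : Lp ℂ p circleMeasure) →
        L φ = ∫ t, h t * w t ∂circleMeasure := fun w hw φ hφ => by
    have h1 : P.codRestrict (Hardy p) hmem hw.toLp = φ := hardy_ext_coef fun n hn => by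
      have := hP hw.toLp n
      rw [if_pos hn, coef_congr hw.coeFn_toLp] at this
      rw [hφ n, if_pos hn]
      exact this
    rw [← h1, ← ContinuousLinearMap.comp_apply, hL]
    exact integral_congr_ae (hw.coeFn_toLp.mono fun t ht => by simp only [ht])
  refine ⟨h, ⟨hh, fun n hn => ?_⟩, key⟩
  -- The projection kills negative powers, so `h` has no positive frequencies.
  have h0 := key (fun t => (t : ℂ) ^ (-n)) (memLp_coe_zpow p _) 0 fun m => by
    rw [coef_zpow, coef_hardy_zero]
    split_ifs <;> lia
  rw [map_zero] at h0
  rw [coef, h0]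
  simp only [mul_comm]

/-- Fourier coefficients of `G h`, where `h` represents the functional `L`. -/
theorem IsToeplitzOperator.coef_functional {G : Circle → ℂ} {B : Hardy p →L[ℂ] Hardy p}
    (hG : AEStronglyMeasurable G circleMeasure) {K : ℝ} (hK : ∀ᵐ t ∂circleMeasure, ‖G t‖ ≤ K)
    (hB : IsToeplitzOperator p G B) {L : Hardy p →L[ℂ] ℂ} {h : Circle → ℂ}
    (hL : ∀ w : Circle → ℂ, MemLp w p circleMeasure →
      ∀ φ : Hardy p, IsAnalyticPart w (φ : Lp ℂ p circleMeasure) →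
        L φ = ∫ t, h t * w t ∂circleMeasure) (k : ℕ) :
    coef (fun t => G t * h t) (-(k : ℤ)) = L (B (memHardy_coe_pow p k).toHardy) := by
  rw [hL _ (memLp_bdd_mul hG hK (Lp.memLp _)) _ (hB _), coef]
  refine integral_congr_ae ((memHardy_coe_pow p k).coeFn_toHardy.mono fun t ht => ?_)
  simp only [ht, neg_neg]
  ring

/-- Coburn's theorem, for Fredholm operators of index zero. -/
theorem toeplitz_bijective (hp1 : 1 < p) (hp : p ≠ ∞) {G : Circle → ℂ}
    {B : Hardy p →L[ℂ] Hardy p} (hG : AEStronglyMeasurable G circleMeasure) {K : ℝ}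
    (hK : ∀ᵐ t ∂circleMeasure, ‖G t‖ ≤ K) (hG0 : ∀ᵐ t ∂circleMeasure, G t ≠ 0)
    (hB : IsToeplitzOperator p G B) (hF : B.IsFredholm) (hi : fredholmIndex B = 0) :
    Function.Bijective B := by
  have := ENNReal.HolderConjugate.conjExponent hp1.le
  set q := p.conjExponent
  have hq : q ≠ ∞ := conj_ne_top_of_one_lt hp1
  have := hF.finite_ker
  have hfc : FiniteDimensional ℂ (Hardy p ⧸ B.range) := hF.finite_coker
  have hsurj_of : LinearMap.ker B.toLinearMap = ⊥ → Function.Surjective B := fun hk => by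
    rw [fredholmIndex] at hi
    change (Module.finrank ℂ (LinearMap.ker B.toLinearMap) : ℤ) - _ = 0 at hi
    rw [hk, finrank_bot, Nat.cast_zero, zero_sub, neg_eq_zero, Nat.cast_eq_zero,
      Module.finrank_zero_iff, Submodule.Quotient.subsingleton_iff] at hi
    exact LinearMap.range_eq_top.1 hi
  by_cases hk : LinearMap.ker B.toLinearMap = ⊥
  · exact ⟨LinearMap.ker_eq_bot.1 hk, hsurj_of hk⟩
  exfalso
  obtain ⟨φ, hφ, hφ0⟩ := Submodule.exists_mem_ne_zero_of_ne_bot hk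
  have hφ : B φ = 0 := hφ
  have hpos : Module.finrank ℂ (Hardy p ⧸ B.range) ≠ 0 := fun h0 => by
    rw [fredholmIndex, h0, Nat.cast_zero, sub_zero, Nat.cast_eq_zero] at hi
    exact hk (Submodule.finrank_eq_zero.1 hi)
  -- With index zero, a nontrivial kernel forces a nontrivial cokernel. The range is closed, so some
  -- nonzero functional `Λ`, given by `h`, annihilates it.
  have hcl : IsClosed (B.range : Set (Hardy p)) := hF.isClosed_range
  obtain ⟨Λ, hΛ, hΛ0⟩ := exists_dual_eq_zero_of_isClosed hcl fun h =>
    hpos (Module.finrank_zero_iff.2 (Submodule.Quotient.subsingleton_iff.2 h))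
  obtain ⟨h, hh, hL⟩ := exists_hardy_functional (q := q) hp1 hp Λ
  have hLB : ∀ ψ, Λ (B ψ) = 0 := fun ψ => hΛ0 _ ⟨ψ, rfl⟩
  have hGh : MemHardy q fun t => G t * h t := ⟨memLp_bdd_mul hG hK hh.1, fun n hn => by
    obtain ⟨k, rfl⟩ : ∃ k : ℕ, n = -k := ⟨n.natAbs, by lia⟩
    rw [hB.coef_functional hG hK hL, hLB]⟩
  have hGh0 : coef (fun t => G t * h t) 0 = 0 := by
    have := hB.coef_functional hG hK hL 0
    rwa [hLB, Nat.cast_zero, neg_zero] at this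
  have hGφ : MemHardyConj p fun t => G t * (φ : Lp ℂ p circleMeasure) t :=
    ⟨memLp_bdd_mul hG hK (Lp.memLp _), fun n hn => by
      rw [← hB.coef_eq φ hn.le, hφ, coef_hardy_zero]⟩
  have e : (fun t => (φ : Lp ℂ p circleMeasure) t * (G t * h t)) =
      fun t => G t * (φ : Lp ℂ p circleMeasure) t * h t := by
    ext t; ring
  -- `φ · (G h)` is analytic with mean zero, and `(G φ) · h` is antianalytic. They are the same
  -- function, which therefore has no nonzero coefficient.
  have h0 : ∀ᵐ t ∂circleMeasure, (φ : Lp ℂ p circleMeasure) t * (G t * h t) = 0 :=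
    ae_eq_zero_of_coef_eq_zero (φ.2.1.integrable_mul hGh.1) fun n => by
      rcases lt_trichotomy n 0 with hn | rfl | hn
      · exact (MemHardy.mul hp hq φ.2 hGh).2 n hn
      · rw [MemHardy.coef_zero_mul hp hq φ.2 hGh, hGh0, mul_zero]
      · rw [e]
        exact (MemHardyConj.mul hp hq hGφ hh).2 n hn
  rcases MemHardy.ae_eq_zero_or_of_mul hp hq φ.2 hGh h0 with h1 | h1
  · exact hφ0 (Subtype.ext (Lp.ext (h1.trans (Lp.coeFn_zero ℂ p circleMeasure).symm)))
  · refine hΛ (ContinuousLinearMap.ext fun y => ?_)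
    rw [hL _ (Lp.memLp _) y (isAnalyticPart_self y)]
    refine integral_eq_zero_of_ae ?_
    filter_upwards [h1, hG0] with t ht1 ht2
    rw [Pi.zero_apply, mul_eq_zero] at ht1
    rw [ht1.resolve_left ht2, zero_mul, Pi.zero_apply]

end Coburn

/-! ### Factorization from invertibility -/

section Factorization

theorem coef_polynomial_of_neg (r : ℂ[X]) {n : ℤ} (hn : n < 0) :
    coef (fun t => r.eval (t : ℂ)) n = 0 := by
  induction r using Polynomial.induction_on' with
  | add r s hr hs =>
    have hc : ∀ r : ℂ[X], Integrable (fun t : Circle => r.eval (t : ℂ)) circleMeasure := fun r =>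
      (r.continuous.comp continuous_subtype_val).integrable_circle
    have := coef_add (hc r) (hc s) n
    simp only [Polynomial.eval_add]
    rw [this, hr, hs, add_zero]
  | monomial k a =>
    simp only [Polynomial.eval_monomial]
    rw [coef_const_mul]
    have := coef_zpow k n
    simp only [zpow_natCast] at this
    rw [this, if_neg (by lia), mul_zero]

theorem continuous_polynomial_circle (r : ℂ[X]) : Continuous fun t : Circle => r.eval (t : ℂ) :=
  r.continuous.comp continuous_subtype_val

theorem memHardy_polynomial (p : ℝ≥0∞) (r : ℂ[X]) : MemHardy p fun t => r.eval (t : ℂ) :=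
  ⟨(continuous_polynomial_circle r).memLp_circle p, fun _ hn => coef_polynomial_of_neg r hn⟩

theorem exists_bound_polynomial (r : ℂ[X]) : ∃ K : ℝ, ∀ t : Circle, ‖r.eval (t : ℂ)‖ ≤ K := by
  obtain ⟨K, hK⟩ := (isCompact_range (continuous_polynomial_circle r)).isBounded.exists_norm_le
  exact ⟨K, fun t => hK _ ⟨t, rfl⟩⟩

/-- The Liouville step of Wiener–Hopf theory: being analytic and antianalytic at once leaves only
the constant coefficient. -/
theorem ae_eq_const_of_mem_conj {u v : Circle → ℂ} (hu : MemHardy 1 u) (hv : MemHardyConj 1 v)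
    (h : u =ᵐ[circleMeasure] v) : ∀ᵐ t ∂circleMeasure, u t = coef u 0 := by
  refine ae_eq_of_coef_eq (memLp_one_iff_integrable.1 hu.1) (integrable_const _) fun n => ?_
  have h0 := coef_zpow_mul 0 (fun _ => coef u 0) n
  have h1 := coef_const_mul (coef u 0) (fun t => (t : ℂ) ^ (0 : ℤ)) n
  rw [coef_zpow] at h1
  simp only [zpow_zero, mul_one] at h1
  rw [h1]
  rcases lt_trichotomy n 0 with hn | rfl | hn
  · rw [hu.2 n hn, if_neg hn.ne, mul_zero]
  · simp
  · rw [coef_congr h, hv.2 n hn, if_neg hn.ne', mul_zero]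

variable {p : ℝ≥0∞} [Fact (1 ≤ p)]

omit [Fact (1 ≤ p)] in
theorem MemHardy.mul_polynomial (hp1 : 1 < p) (hp : p ≠ ∞) {f : Circle → ℂ} (hf : MemHardy p f)
    (r : ℂ[X]) : MemHardy p fun t => f t * r.eval (t : ℂ) := by
  have := ENNReal.HolderConjugate.conjExponent hp1.le
  have hq : p.conjExponent ≠ ∞ := conj_ne_top_of_one_lt hp1
  refine ⟨?_, (hf.mul hp hq (memHardy_polynomial _ r)).2⟩
  obtain ⟨K, hK⟩ := exists_bound_polynomial r
  simp only [mul_comm (f _)]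
  exact memLp_bdd_mul (continuous_polynomial_circle r).aestronglyMeasurable (ae_of_all _ hK) hf.1

/-- An invertible Toeplitz operator `T(tⁿ g)` gives a Wiener–Hopf factorization of `g` of index
`-n`, with `g₊⁻¹ = T(tⁿ g)⁻¹ 1`. -/
theorem exists_factorization_of_bijective (hp1 : 1 < p) (hp : p ≠ ∞) {g : Circle → ℂ} {n : ℤ}
    {B : Hardy p →L[ℂ] Hardy p} (hG : AEStronglyMeasurable g circleMeasure) {K : ℝ}
    (hK : ∀ᵐ t ∂circleMeasure, ‖g t‖ ≤ K)
    (hB : IsToeplitzOperator p (fun t => (t : ℂ) ^ n * g t) B) (hbij : Function.Bijective B)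
    {φ : Hardy p} (hφ : B φ = (memHardy_coe_pow p 0).toHardy) :
    ∃ gm, IsWienerHopfFactorization p g (-n) gm (fun t => ((φ : Lp ℂ p circleMeasure) t)⁻¹) := by
  have := ENNReal.HolderConjugate.conjExponent hp1.le
  set q := p.conjExponent with hqdef
  have hq : q ≠ ∞ := conj_ne_top_of_one_lt hp1
  set G : Circle → ℂ := fun t => (t : ℂ) ^ n * g t with hGdef
  replace hG : AEStronglyMeasurable G circleMeasure :=
    (continuous_coe_zpow n).aestronglyMeasurable.mul hG
  replace hK : ∀ᵐ t ∂circleMeasure, ‖G t‖ ≤ K := hK.mono fun t ht => by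
    rwa [hGdef, norm_mul, norm_coe_zpow, one_mul]
  let e := ContinuousLinearEquiv.ofBijective B (LinearMap.ker_eq_bot.2 hbij.1)
    (LinearMap.range_eq_top.2 hbij.2)
  have he : ∀ ψ, e.symm (B ψ) = ψ := fun ψ =>
    (ContinuousLinearEquiv.ofBijective_symm_apply_apply B _ _ ψ)
  -- This is `g₋`: its projection is `T(G) φ = 1`, so it is antianalytic with value `1` at infinity.
  set ψ : Circle → ℂ := fun t => G t * (φ : Lp ℂ p circleMeasure) t with hψdef
  have hψ0 : ∀ m : ℤ, 0 ≤ m → coef ψ m = if m = 0 then 1 else 0 := fun m hm => by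
    rw [← hB.coef_eq φ hm, hφ, coef_congr (memHardy_coe_pow p 0).coeFn_toHardy, coef_zpow]
    rfl
  have hψ : MemHardyConj p ψ := ⟨memLp_bdd_mul hG hK (Lp.memLp _), fun m hm => by
    rw [hψ0 m hm.le, if_neg hm.ne']⟩
  obtain ⟨c0, hc0⟩ := exists_clm_coef (p := p) 0
  -- The function representing `x ↦ (B⁻¹ x)₀` will be a multiple of `g₋⁻¹`, and `G h` the same
  -- multiple of `g₊`.
  obtain ⟨h, hh, hL⟩ := exists_hardy_functional (q := q) hp1 hp
    ((c0.comp (Hardy p).subtypeL).comp e.symm.toContinuousLinearMap)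
  have hcoef : ∀ k : ℕ, coef (fun t => G t * h t) (-(k : ℤ)) = if k = 0 then 1 else 0 := fun k => by
    rw [hB.coef_functional hG hK hL]
    change c0 (e.symm (B _) : Hardy p) = _
    rw [he, hc0, coef_congr (memHardy_coe_pow p k).coeFn_toHardy, coef_zpow]
    simp [eq_comm]
  have hGh : MemHardy q fun t => G t * h t := ⟨memLp_bdd_mul hG hK hh.1, fun n hn => by
    obtain ⟨k, rfl⟩ : ∃ k : ℕ, n = -k := ⟨n.natAbs, by lia⟩
    rw [hcoef, if_neg (by lia)]⟩
  have hGh0 : coef (fun t => G t * h t) 0 = 1 := by simpa using hcoef 0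
  have hu := MemHardy.mul hp hq φ.2 hGh
  have hv := MemHardyConj.mul hp hq hψ hh
  have e1 : (fun t => (φ : Lp ℂ p circleMeasure) t * (G t * h t)) = fun t => ψ t * h t := by
    ext t; simp only [hψdef]; ring
  -- `φ · (G h) = ψ · h` is analytic and antianalytic, hence constant. The constant is nonzero
  -- because neither `φ` nor `G h` vanishes identically, so `φ` and `ψ` are invertible with inverses
  -- in the required spaces.
  have hconst := ae_eq_const_of_mem_conj hu hv (by rw [e1])
  set c := coef (fun t => (φ : Lp ℂ p circleMeasure) t * (G t * h t)) 0
  have hc : c ≠ 0 := fun hc0 => by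
    rw [hc0] at hconst
    rcases MemHardy.ae_eq_zero_or_of_mul hp hq φ.2 hGh hconst with h1 | h1
    · have h2 := hψ0 0 le_rfl
      rw [coef_congr (h := fun _ => 0) (h1.mono fun t ht => by simp [hψdef, ht])] at h2
      simp [coef] at h2
    · rw [coef_congr (h := fun _ => 0) h1] at hGh0
      simp [coef] at hGh0
  have hφne : ∀ᵐ t ∂circleMeasure, (φ : Lp ℂ p circleMeasure) t ≠ 0 := hconst.mono fun t ht h0 =>
    hc (by rw [← ht, h0, zero_mul])
  have hψinv : ∀ᵐ t ∂circleMeasure, ψ t * (c⁻¹ * h t) = 1 := hconst.mono fun t ht => by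
    have : ψ t * h t = c := by rw [← ht]; simp only [hψdef]; ring
    rw [mul_left_comm, this, inv_mul_cancel₀ hc]
  have hch : MemHardyConj q fun t => (ψ t)⁻¹ := by
    refine MemHardyConj.congr (f := fun t => c⁻¹ * h t) ⟨hh.1.const_mul _, fun n hn => ?_⟩
      (hψinv.mono fun t ht => eq_inv_of_mul_eq_one_right ht)
    rw [coef_const_mul, hh.2 n hn, mul_zero]
  refine ⟨ψ, ⟨hψinv.mono fun t ht h0 => ?_, hφne.mono fun t ht => inv_ne_zero ht, ?_, ?_, hψ,
    hch, hψ0 0 le_rfl, ?_, ?_⟩⟩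
  · rw [h0, zero_mul] at ht
    exact zero_ne_one ht
  · refine MemHardy.congr (f := fun t => c⁻¹ * (G t * h t)) ⟨hGh.1.const_mul _, fun n hn => ?_⟩
      (hconst.mono fun t ht => eq_inv_of_mul_eq_one_right ?_)
    · rw [coef_const_mul, hGh.2 n hn, mul_zero]
    · rw [mul_left_comm, ht, inv_mul_cancel₀ hc]
  · simp only [inv_inv]
    exact φ.2
  · filter_upwards [hφne] with t ht
    have h1 : (t : ℂ) ^ n * (t : ℂ) ^ (-n) = 1 := by
      rw [← coe_zpow_add, add_neg_cancel, zpow_zero]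
    simp only [hψdef, hGdef]
    field_simp
    linear_combination -(g t) * h1
  · refine ⟨‖(e.symm : Hardy p →L[ℂ] Hardy p)‖₊, fun s r hr => ?_⟩
    simp only [inv_inv]
    have hφr := φ.2.mul_polynomial hp1 hp r
    -- Here `r = P (ψ⁻¹ s)`, so `N = ψ⁻¹ s - r` has only negative frequencies and so does `ψ N`.
    -- Thus `G φ r = ψ r = s - ψ N` projects to `s`, that is `φ r = B⁻¹ s`, and the bound is the
    -- norm of `B⁻¹`.
    have hBs : B hφr.toHardy = (memHardy_polynomial p s).toHardy := by
      refine hardy_ext_coef fun m hm => ?_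
      rw [hB.coef_eq _ hm, coef_congr (memHardy_polynomial p s).coeFn_toHardy]
      obtain ⟨Ks, hKs⟩ := exists_bound_polynomial s
      have hs : MemLp (fun t => (ψ t)⁻¹ * s.eval (t : ℂ)) q circleMeasure := by
        simp only [mul_comm (ψ _)⁻¹]
        exact memLp_bdd_mul (continuous_polynomial_circle s).aestronglyMeasurable
          (ae_of_all _ hKs) hch.1
      have hrq := (continuous_polynomial_circle r).memLp_circle q
      have hq1 : 1 ≤ q := ENNReal.HolderConjugate.one_le q p
      have hNc : ∀ m : ℤ, 0 ≤ m →
          coef (fun t => (ψ t)⁻¹ * s.eval (t : ℂ) - r.eval (t : ℂ)) m = 0 := fun m hm => by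
        rw [coef_sub (hs.integrable hq1) (hrq.integrable hq1), hr m, if_pos hm, sub_self]
      have hN : MemHardyConj q fun t => (ψ t)⁻¹ * s.eval (t : ℂ) - r.eval (t : ℂ) :=
        ⟨hs.sub hrq, fun m hm => hNc m hm.le⟩
      have h1 : ∀ m : ℤ, 0 ≤ m →
          coef (fun t => ψ t * ((ψ t)⁻¹ * s.eval (t : ℂ) - r.eval (t : ℂ))) m = 0 := fun m hm => by
        rcases hm.eq_or_lt with rfl | hm
        · rw [MemHardyConj.coef_zero_mul hp hq hψ hN, hNc 0 le_rfl, mul_zero]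
        · exact (MemHardyConj.mul hp hq hψ hN).2 m hm
      have h2 := coef_sub ((continuous_polynomial_circle s).integrable_circle)
        (memLp_one_iff_integrable.1 (MemHardyConj.mul hp hq hψ hN).1) m
      rw [h1 m hm, sub_zero] at h2
      rw [← h2]
      refine coef_congr ?_ m
      filter_upwards [hφr.coeFn_toHardy, hψinv] with t h1 h3
      have h4 : ψ t ≠ 0 := fun h0 => by rw [h0, zero_mul] at h3; exact zero_ne_one h3
      rw [h1, mul_sub, mul_inv_cancel_left₀ h4, hψdef]
      ring
    have h5 : hφr.toHardy = e.symm (memHardy_polynomial p s).toHardy := by rw [← hBs, he]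
    have h6 : ‖hφr.toHardy‖ ≤ ‖(e.symm : Hardy p →L[ℂ] Hardy p)‖ * ‖(memHardy_polynomial p s).toHardy‖ := by
      rw [h5]
      exact (e.symm : Hardy p →L[ℂ] Hardy p).le_opNorm _
    have h7 : ∀ {f : Circle → ℂ} (hf : MemHardy p f),
        eLpNorm f p circleMeasure = ENNReal.ofReal ‖hf.toHardy‖ := fun hf => by
      rw [← eLpNorm_congr_ae hf.coeFn_toHardy, Submodule.coe_norm, Lp.norm_def,
        ENNReal.ofReal_toReal (Lp.eLpNorm_ne_top _)]
    rw [h7 hφr, h7 (memHardy_polynomial p s), ← ENNReal.ofReal_coe_nnreal, ← ENNReal.ofReal_mul (by positivity)]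
    exact ENNReal.ofReal_le_ofReal h6

end Factorization

/-! ### Uniqueness of the Wiener–Hopf factorization -/

section Uniqueness

variable {p : ℝ≥0∞}

theorem IsWienerHopfFactorization.coef_gm_inv {g gm gp : Circle → ℂ} {m : ℤ} (hp1 : 1 < p)
    (hp : p ≠ ∞) (h : IsWienerHopfFactorization p g m gm gp) :
    coef (fun t => (gm t)⁻¹) 0 = 1 := by
  have := ENNReal.HolderConjugate.conjExponent hp1.le
  have h1 := MemHardyConj.coef_zero_mul hp (conj_ne_top_of_one_lt hp1) h.gm_mem h.gm_inv_mem
  rw [h.gm_infty, one_mul, coef_congr (h := fun _ => 1) (h.gm_ne_zero.mono fun t ht =>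
    mul_inv_cancel₀ ht), coef_const, if_pos rfl] at h1
  exact h1.symm

theorem IsWienerHopfFactorization.quotient_eq {g gm gp gm' gp' : Circle → ℂ} {m k : ℤ}
    (h : IsWienerHopfFactorization p g m gm gp) (h' : IsWienerHopfFactorization p g k gm' gp') :
    ∀ᵐ t ∂circleMeasure, (gp t)⁻¹ * gp' t = (t : ℂ) ^ (m - k) * (gm t * (gm' t)⁻¹) := by
  filter_upwards [h.factorization, h'.factorization, h.gp_ne_zero, h'.gm_ne_zero] with t h1 h2 h3 h4
  have h5 : (t : ℂ) ^ k ≠ 0 := zpow_ne_zero _ (Circle.coe_ne_zero t)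
  rw [zpow_sub₀ (Circle.coe_ne_zero t)]
  field_simp
  linear_combination h2.symm.trans h1

/-- The quotient of the two plus factors is analytic and equals `t^(m-k)` times an antianalytic
function. If `m < k` no frequency is left for it, yet it is nonzero almost everywhere. -/
theorem IsWienerHopfFactorization.not_lt {g gm gp gm' gp' : Circle → ℂ} {m k : ℤ} (hp1 : 1 < p)
    (hp : p ≠ ∞) (h : IsWienerHopfFactorization p g m gm gp)
    (h' : IsWienerHopfFactorization p g k gm' gp') : ¬ m < k := by
  intro hmk
  have := ENNReal.HolderConjugate.conjExponent hp1.le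
  have hq := conj_ne_top_of_one_lt (q := p.conjExponent) hp1
  have hu := MemHardy.mul hp hq h.gp_inv_mem h'.gp_mem
  have hv := MemHardyConj.mul hp hq h.gm_mem h'.gm_inv_mem
  have h0 := ae_eq_zero_of_coef_eq_zero (memLp_one_iff_integrable.1 hu.1) fun n => by
    rcases lt_or_ge n 0 with hn | hn
    · exact hu.2 n hn
    · rw [coef_congr (h.quotient_eq h'), coef_zpow_mul]
      exact hv.2 _ (by lia)
  obtain ⟨t, h1, h2, h3⟩ := (h0.and (h.gp_ne_zero.and h'.gp_ne_zero)).exists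
  exact mul_ne_zero (inv_ne_zero h2) h3 h1

theorem IsWienerHopfFactorization.index_unique {g gm gp gm' gp' : Circle → ℂ} {m k : ℤ}
    (hp1 : 1 < p) (hp : p ≠ ∞) (h : IsWienerHopfFactorization p g m gm gp)
    (h' : IsWienerHopfFactorization p g k gm' gp') : m = k :=
  le_antisymm (_root_.not_lt.1 (h'.not_lt hp1 hp h)) (_root_.not_lt.1 (h.not_lt hp1 hp h'))

/-- With equal exponents the quotient of the plus factors is constant, and the normalization at
infinity makes the constant `1`. -/
theorem IsWienerHopfFactorization.gp_unique {g gm gp gm' gp' : Circle → ℂ} {m : ℤ}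
    (hp1 : 1 < p) (hp : p ≠ ∞) (h : IsWienerHopfFactorization p g m gm gp)
    (h' : IsWienerHopfFactorization p g m gm' gp') : gp =ᵐ[circleMeasure] gp' := by
  have := ENNReal.HolderConjugate.conjExponent hp1.le
  have hq := conj_ne_top_of_one_lt (q := p.conjExponent) hp1
  have hu := MemHardy.mul hp hq h.gp_inv_mem h'.gp_mem
  have hv := MemHardyConj.mul hp hq h.gm_mem h'.gm_inv_mem
  have h0 := h.quotient_eq h'
  simp only [sub_self, zpow_zero, one_mul] at h0
  have hc := ae_eq_const_of_mem_conj hu hv h0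
  rw [coef_congr h0, MemHardyConj.coef_zero_mul hp hq h.gm_mem h'.gm_inv_mem, h.gm_infty,
    h'.coef_gm_inv hp1 hp, one_mul] at hc
  filter_upwards [hc, h.gp_ne_zero] with t h1 h2
  exact (eq_of_inv_mul_eq_one h1).symm ▸ rfl

end Uniqueness

/-! ### Boundary values of functions holomorphic on the closed disk -/

section DiskAlgebra

variable {f : ℂ → ℂ}

theorem continuous_circle_of_differentiableOn (hf : DifferentiableOn ℂ f (Metric.closedBall 0 1)) :
    Continuous fun t : Circle => f t :=
  hf.continuousOn.comp_continuous continuous_circle_coe fun t => by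
    rw [mem_closedBall_zero_iff, Circle.norm_coe]

theorem integral_circle_of_differentiableOn (hf : DifferentiableOn ℂ f (Metric.closedBall 0 1)) :
    ∫ t : Circle, f t ∂circleMeasure = f 0 := by
  rw [integral_circle_eq_circleAverage _ (continuous_circle_of_differentiableOn hf).aestronglyMeasurable]
  refine DiffContOnCl.circleAverage (DifferentiableOn.diffContOnCl ?_)
  rwa [abs_one, closure_ball _ one_ne_zero]

theorem coef_neg_of_differentiableOn (hf : DifferentiableOn ℂ f (Metric.closedBall 0 1)) (m : ℕ) :
    coef (fun t => f t) (-(m : ℤ)) = 0 ^ m * f 0 := by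
  have := integral_circle_of_differentiableOn (f := fun z => z ^ m * f z) (by fun_prop)
  simpa [coef] using this

theorem memHardy_of_differentiableOn (p : ℝ≥0∞)
    (hf : DifferentiableOn ℂ f (Metric.closedBall 0 1)) : MemHardy p fun t => f t := by
  refine ⟨(continuous_circle_of_differentiableOn hf).memLp_circle p, fun n hn => ?_⟩
  obtain ⟨m, rfl⟩ : ∃ m : ℕ, n = -m := ⟨n.natAbs, by lia⟩
  rw [coef_neg_of_differentiableOn hf, zero_pow (by lia), zero_mul]

theorem memHardyConj_inv_of_differentiableOn (p : ℝ≥0∞)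
    (hf : DifferentiableOn ℂ f (Metric.closedBall 0 1)) :
    MemHardyConj p fun t => f ((t⁻¹ : Circle) : ℂ) := by
  refine ⟨((continuous_circle_of_differentiableOn hf).comp continuous_inv).memLp_circle p,
    fun n hn => ?_⟩
  rw [coef_inv fun t : Circle => f t]
  exact (memHardy_of_differentiableOn p hf).2 _ (by lia)

theorem coef_zero_inv_of_differentiableOn (hf : DifferentiableOn ℂ f (Metric.closedBall 0 1)) :
    coef (fun t : Circle => f ((t⁻¹ : Circle) : ℂ)) 0 = f 0 := by
  rw [coef_inv fun t : Circle => f t, ← Nat.cast_zero, coef_neg_of_differentiableOn hf, pow_zero,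
    one_mul]

end DiskAlgebra

/-! ### Change of variables by the shift -/

section Shift

variable {β : ℂ} (hβ : 1 < ‖β‖)

theorem coe_shift (t : Circle) : (shift β hβ t : ℂ) = ((t : ℂ) - β) / (conj β * t - 1) := rfl

include hβ

theorem shift_ne_zero : β ≠ 0 := norm_pos_iff.1 (zero_lt_one.trans hβ)

theorem shift_sub_ne_zero {z : ℂ} (hz : ‖z‖ ≤ 1) : z - β ≠ 0 := fun h => by
  rw [sub_eq_zero.1 h] at hz
  exact hz.not_gt hβ

theorem shift_conj_sub_ne_zero {z : ℂ} (hz : ‖z‖ ≤ 1) : conj β - z ≠ 0 := fun h => by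
  rw [← sub_eq_zero.1 h, RCLike.norm_conj] at hz
  exact hz.not_gt hβ

theorem norm_sq_sub_one_ne_zero : β * conj β - 1 ≠ 0 := fun h => by
  have h1 : ‖β * conj β‖ = 1 := by rw [sub_eq_zero.1 h, norm_one]
  rw [norm_mul, RCLike.norm_conj] at h1
  nlinarith

theorem continuous_shift : Continuous (shift β hβ) := by
  refine Continuous.subtype_mk (Continuous.div ?_ ?_ fun t => shift_denom_ne_zero hβ t) _
  · exact continuous_circle_coe.sub continuous_const
  · exact (continuous_const.mul continuous_circle_coe).sub continuous_const

omit hβ in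
theorem shift_shift_aux {x b : ℂ} (h : b * x - 1 ≠ 0) :
    (x - β) / (b * x - 1) - β = x * (b * ((x - β) / (b * x - 1)) - 1) := by
  linear_combination -div_mul_cancel₀ (x - β) h

omit hβ in
theorem inv_one_sub_inv_mul_inv {x b : ℂ} (h : b * x - 1 ≠ 0) (hx : x ≠ 0) (hb : b ≠ 0) :
    (1 - b⁻¹ * x⁻¹)⁻¹ = b * x / (b * x - 1) := by
  have : 1 - b⁻¹ * x⁻¹ = (b * x - 1) / (b * x) := by field_simp
  rw [this, inv_div]

theorem shift_shift (t : Circle) : shift β hβ (shift β hβ t) = t := by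
  refine Circle.ext ?_
  have h1 := shift_denom_ne_zero hβ t
  have h2 := shift_denom_ne_zero hβ (shift β hβ t)
  rw [coe_shift, div_eq_iff h2, coe_shift]
  exact shift_shift_aux h1

theorem shift_sub (t : Circle) :
    (shift β hβ t : ℂ) - β = (1 - β * conj β) * t / (conj β * t - 1) := by
  rw [coe_shift, eq_div_iff (shift_denom_ne_zero hβ t), sub_mul,
    div_mul_cancel₀ _ (shift_denom_ne_zero hβ t)]
  ring

/-- The Jacobian of the shift is a Poisson kernel. -/
theorem ofReal_poissonKer_shift (s : Circle) :
    (poissonKer ((conj β)⁻¹ * ((s⁻¹ : Circle) : ℂ)) : ℂ) =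
      (β * conj β - 1) * s / ((conj β * s - 1) * (β - s)) := by
  have h1 := shift_denom_ne_zero hβ s
  have h2 : β - (s : ℂ) ≠ 0 := fun h => shift_sub_ne_zero hβ (Circle.norm_coe s).le
    (by linear_combination -h)
  have h3 := shift_ne_zero hβ
  have h4 : conj β ≠ 0 := by simpa using h3
  have h5 := Circle.coe_ne_zero s
  have e1 : (1 - (conj β)⁻¹ * ((s⁻¹ : Circle) : ℂ))⁻¹ = conj β * s / (conj β * s - 1) := by
    rw [Circle.coe_inv]
    exact inv_one_sub_inv_mul_inv h1 h5 h4
  have e2 : conj (1 - (conj β)⁻¹ * ((s⁻¹ : Circle) : ℂ))⁻¹ = β / (β - s) := by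
    rw [map_inv₀, map_sub, map_one, map_mul, map_inv₀, Complex.conj_conj, Circle.coe_inv_eq_conj,
      Complex.conj_conj, eq_div_iff h2]
    have : 1 - β⁻¹ * (s : ℂ) = (β - s) / β := by field_simp
    rw [this, inv_div, div_mul_cancel₀ _ h2]
  rw [ofReal_poissonKer, e2, e1]
  field_simp
  ring

theorem norm_conj_inv_lt : ‖(conj β)⁻¹‖ < 1 := by
  rw [norm_inv, RCLike.norm_conj]
  exact inv_lt_one_of_one_lt₀ hβ

/-- The inverse of `α` extends holomorphically to the closed disk with value `1/β` at `0`, so the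
mean value property gives the negative powers and conjugation the positive ones. The right side is
the Poisson integral of `sⁿ` at `1/β̄`. -/
theorem integral_shift_zpow (n : ℤ) :
    ∫ t : Circle, (shift β hβ t : ℂ) ^ n ∂circleMeasure =
      ∫ s : Circle, (poissonKer ((conj β)⁻¹ * ((s⁻¹ : Circle) : ℂ)) : ℂ) * (s : ℂ) ^ n
        ∂circleMeasure := by
  have key : ∀ m : ℕ, ∫ t : Circle, (shift β hβ t : ℂ) ^ (-(m : ℤ)) ∂circleMeasure = β⁻¹ ^ m := by
    intro m
    have h1 : ∀ z ∈ Metric.closedBall (0 : ℂ) 1, z - β ≠ 0 := fun z hz =>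
      shift_sub_ne_zero hβ (by simpa using hz)
    have := integral_circle_of_differentiableOn (f := fun z => ((conj β * z - 1) / (z - β)) ^ m)
      (by fun_prop (disch := assumption))
    simp only [mul_zero, zero_sub, neg_div_neg_eq, one_div] at this
    rw [← this]
    simp only [zpow_neg, zpow_natCast, coe_shift, ← inv_pow, inv_div]
  have key' : ∀ m : ℕ, ∫ t : Circle, (shift β hβ t : ℂ) ^ (m : ℤ) ∂circleMeasure =
      (conj β)⁻¹ ^ m := by
    intro m
    have h1 := congrArg conj (key m)
    rw [← integral_conj] at h1
    simp only [conj_coe_zpow, neg_neg, map_pow, map_inv₀] at h1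
    exact h1
  obtain ⟨t, ht⟩ := coe_norm_mul_exists (conj β)⁻¹
  set r := ‖(conj β)⁻¹‖ with hr
  have h0 : 0 < r := norm_pos_iff.2 (inv_ne_zero (by simpa using shift_ne_zero hβ))
  have h1 : r < 1 := norm_conj_inv_lt hβ
  have h2 := poissonInt_zpow h0 h1 n t
  rw [poissonInt, ← ht] at h2
  rw [h2]
  rcases Int.eq_nat_or_neg n with ⟨m, rfl | rfl⟩
  · rw [key', ht]
    simp [mul_pow]
  · have ht' : β⁻¹ = r * (t : ℂ)⁻¹ := by
      have := congrArg conj ht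
      simpa [← Circle.coe_inv_eq_conj] using this
    rw [key, ht']
    simp [mul_pow]

theorem continuous_shiftJacobian :
    Continuous fun s : Circle => poissonKer ((conj β)⁻¹ * ((s⁻¹ : Circle) : ℂ)) :=
  Continuous.poissonKer (continuous_const.mul continuous_circle_coe_inv) fun s => by
    rw [norm_mul, Circle.norm_coe, mul_one]
    exact norm_conj_inv_lt hβ

theorem shiftJacobian_nonneg (s : Circle) :
    0 ≤ poissonKer ((conj β)⁻¹ * ((s⁻¹ : Circle) : ℂ)) :=
  poissonKer_nonneg (by
    rw [norm_mul, Circle.norm_coe, mul_one]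
    exact norm_conj_inv_lt hβ)

theorem integral_comp_shift_of_continuous {f : Circle → ℂ} (hf : Continuous f) :
    ∫ t, f (shift β hβ t) ∂circleMeasure =
      ∫ s : Circle, (poissonKer ((conj β)⁻¹ * ((s⁻¹ : Circle) : ℂ)) : ℂ) * f s ∂circleMeasure := by
  set J : Circle → ℝ := fun s => poissonKer ((conj β)⁻¹ * ((s⁻¹ : Circle) : ℂ)) with hJ
  have hJc : Continuous fun s => (J s : ℂ) :=
    Complex.continuous_ofReal.comp (continuous_shiftJacobian hβ)
  have htrig : ∀ a, ∫ t, trigPoly a (shift β hβ t) ∂circleMeasure =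
      ∫ s, (J s : ℂ) * trigPoly a s ∂circleMeasure := fun a => by
    simp only [trigPoly, Finsupp.sum, Finset.mul_sum]
    rw [integral_finsetSum, integral_finsetSum]
    · refine Finset.sum_congr rfl fun k _ => ?_
      simp only [mul_left_comm (J _ : ℂ)]
      rw [integral_const_mul, integral_const_mul, integral_shift_zpow hβ k]
    · exact fun k _ => (hJc.mul (continuous_const.mul (continuous_coe_zpow k))).integrable_circle
    · exact fun k _ => (continuous_const.mul
        ((continuous_coe_zpow k).comp (continuous_shift hβ))).integrable_circle
  obtain ⟨M, hM⟩ := (isCompact_range hJc).isBounded.exists_norm_le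
  replace hM : ∀ s, ‖(J s : ℂ)‖ ≤ M := fun s => hM _ ⟨s, rfl⟩
  have hM0 : 0 ≤ M := (norm_nonneg _).trans (hM 1)
  refine eq_of_norm_sub_le_zero (le_of_forall_pos_le_add fun ε hε => ?_)
  obtain ⟨a, ha⟩ := exists_trigPoly_norm_sub_le hf (ε := ε / (1 + M)) (by positivity)
  have hc := continuous_trigPoly a
  have i1 := (hf.comp (continuous_shift hβ)).integrable_circle
  have i2 := (hc.comp (continuous_shift hβ)).integrable_circle
  have e1 := integral_sub i1 i2
  have i3 := (hJc.mul hf).integrable_circle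
  have i4 := (hJc.mul hc).integrable_circle
  have e2 := integral_sub i3 i4
  simp only [Function.comp_apply, Pi.mul_apply] at e1 e2
  have b1 : ‖∫ t, f (shift β hβ t) - trigPoly a (shift β hβ t) ∂circleMeasure‖ ≤ ε / (1 + M) := by
    simpa using norm_integral_le_of_norm_le_const (μ := circleMeasure)
      (ae_of_all _ fun t => ha (shift β hβ t))
  have b2 : ‖∫ s, (J s : ℂ) * f s - (J s : ℂ) * trigPoly a s ∂circleMeasure‖ ≤
      M * (ε / (1 + M)) := by
    have := norm_integral_le_of_norm_le_const (μ := circleMeasure) (C := M * (ε / (1 + M)))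
      (f := fun s => (J s : ℂ) * f s - (J s : ℂ) * trigPoly a s) (ae_of_all _ fun s => by
        rw [← mul_sub, norm_mul]
        exact mul_le_mul (hM s) (ha s) (norm_nonneg _) hM0)
    simpa using this
  have e3 : ∫ t, f (shift β hβ t) ∂circleMeasure - ∫ s, (J s : ℂ) * f s ∂circleMeasure =
      ∫ t, f (shift β hβ t) - trigPoly a (shift β hβ t) ∂circleMeasure -
        ∫ s, (J s : ℂ) * f s - (J s : ℂ) * trigPoly a s ∂circleMeasure := by
    rw [e1, e2, htrig]
    ring
  rw [e3, zero_add]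
  refine (norm_sub_le _ _).trans ((add_le_add b1 b2).trans (le_of_eq ?_))
  field_simp

/-- The powers of `t` determine the integrals of all continuous functions by uniform approximation,
and these determine a finite measure. -/
theorem map_shift : circleMeasure.map (shift β hβ) = circleMeasure.withDensity fun s =>
    ENNReal.ofReal (poissonKer ((conj β)⁻¹ * ((s⁻¹ : Circle) : ℂ))) := by
  have hJc := continuous_shiftJacobian hβ
  have hfin : IsFiniteMeasure (circleMeasure.withDensity fun s =>
      ENNReal.ofReal (poissonKer ((conj β)⁻¹ * ((s⁻¹ : Circle) : ℂ)))) :=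
    isFiniteMeasure_withDensity_ofReal hJc.integrable_circle.2
  have : IsFiniteMeasure (circleMeasure.map (shift β hβ)) :=
    Measure.isFiniteMeasure_map _ _
  refine ext_of_forall_integral_eq_of_IsFiniteMeasure fun f => ?_
  rw [integral_map (continuous_shift hβ).aemeasurable f.continuous.aestronglyMeasurable,
    integral_withDensity_eq_integral_toReal_smul hJc.measurable.ennreal_ofReal (by simp)]
  have h := integral_comp_shift_of_continuous hβ (Complex.continuous_ofReal.comp f.continuous)
  simp only [Function.comp_apply, ← Complex.ofReal_mul] at h
  rw [integral_complex_ofReal, integral_complex_ofReal] at h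
  rw [Complex.ofReal_injective h]
  refine integral_congr_ae (ae_of_all _ fun s => ?_)
  simp only [ENNReal.toReal_ofReal (shiftJacobian_nonneg hβ s), smul_eq_mul]

theorem quasiMeasurePreserving_shift :
    Measure.QuasiMeasurePreserving (shift β hβ) circleMeasure circleMeasure :=
  ⟨(continuous_shift hβ).measurable, by
    rw [map_shift]
    exact withDensity_absolutelyContinuous _ _⟩

theorem MeasureTheory.MemLp.comp_shift {p : ℝ≥0∞} {F : Circle → ℂ} (hF : MemLp F p circleMeasure) :
    MemLp (fun t => F (shift β hβ t)) p circleMeasure := by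
  have hJc := continuous_shiftJacobian hβ
  obtain ⟨M, hM⟩ := (isCompact_range hJc).isBounded.exists_norm_le
  have hle : circleMeasure.map (shift β hβ) ≤ ENNReal.ofReal M • circleMeasure := by
    rw [map_shift, ← withDensity_const]
    exact withDensity_mono (ae_of_all _ fun s =>
      ENNReal.ofReal_le_ofReal ((le_abs_self _).trans (hM _ ⟨s, rfl⟩)))
  have h := (hF.smul_measure ENNReal.ofReal_ne_top).mono_measure hle
  exact (memLp_map_measure_iff h.1 (continuous_shift hβ).aemeasurable).1 h

theorem integral_comp_shift {F : Circle → ℂ} (hF : AEStronglyMeasurable F circleMeasure) :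
    ∫ t, F (shift β hβ t) ∂circleMeasure =
      ∫ s : Circle, (poissonKer ((conj β)⁻¹ * ((s⁻¹ : Circle) : ℂ)) : ℂ) * F s ∂circleMeasure := by
  have hac : circleMeasure.map (shift β hβ) ≪ circleMeasure := (quasiMeasurePreserving_shift hβ).2
  rw [← integral_map (continuous_shift hβ).aemeasurable (hF.mono_ac hac), map_shift,
    integral_withDensity_eq_integral_toReal_smul
      ((continuous_shiftJacobian hβ).measurable.ennreal_ofReal) (by simp)]
  refine integral_congr_ae (ae_of_all _ fun s => ?_)
  simp only [ENNReal.toReal_ofReal (shiftJacobian_nonneg hβ s), Complex.real_smul]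

end Shift

/-! ### Hardy spaces and the shift -/

section HardyShift

variable {p q : ℝ≥0∞} [p.HolderConjugate q]

theorem MemHardy.differentiableOn_mul (hp : p ≠ ∞) (hq : q ≠ ∞) {f : Circle → ℂ} (hf : MemHardy p f)
    {d : ℂ → ℂ} (hd : DifferentiableOn ℂ d (Metric.closedBall 0 1)) :
    MemHardy p fun t => d t * f t := by
  have hc := continuous_circle_of_differentiableOn hd
  obtain ⟨K, hK⟩ := (isCompact_range hc).isBounded.exists_norm_le
  refine ⟨memLp_bdd_mul hc.aestronglyMeasurable (ae_of_all _ fun t => hK _ ⟨t, rfl⟩) hf.1, ?_⟩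
  have := (hf.mul hp hq (memHardy_of_differentiableOn q hd)).2
  simpa only [mul_comm] using this

theorem MemHardyConj.differentiableOn_inv_mul (hp : p ≠ ∞) (hq : q ≠ ∞) {f : Circle → ℂ}
    (hf : MemHardyConj p f) {d : ℂ → ℂ} (hd : DifferentiableOn ℂ d (Metric.closedBall 0 1)) :
    MemHardyConj p fun t => d ((t⁻¹ : Circle) : ℂ) * f t := by
  have hc := (continuous_circle_of_differentiableOn hd).comp continuous_inv
  obtain ⟨K, hK⟩ := (isCompact_range hc).isBounded.exists_norm_le
  refine ⟨memLp_bdd_mul hc.aestronglyMeasurable (ae_of_all _ fun t => hK _ ⟨t, rfl⟩) hf.1, ?_⟩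
  have := (hf.mul hp hq (memHardyConj_inv_of_differentiableOn q hd)).2
  simpa only [mul_comm] using this

variable {β : ℂ} (hβ : 1 < ‖β‖)

theorem shiftJacobian_mul_pow_aux {x c y D : ℂ} (hx : x ≠ 0) (hD : D ≠ 0) (hy : y ≠ 0) (k : ℕ) :
    c * x / (D * -y) * (y / D) ^ (k + 1) = -c * x⁻¹ * (y / x) ^ k / (D / x) ^ (k + 2) := by
  simp only [div_pow, pow_succ]
  field_simp

/-- Geometrically, `α` carries the disk onto the exterior. Here, a coefficient of `F ∘ α` at a
negative frequency becomes, after the change of variables, the mean of `F` times an antianalytic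
function vanishing at infinity. -/
theorem MemHardyConj.comp_shift (hp : p ≠ ∞) (hq : q ≠ ∞) {F : Circle → ℂ} (hF : MemHardyConj p F) :
    MemHardy p fun t => F (shift β hβ t) := by
  refine ⟨hF.1.comp_shift hβ, fun n hn => ?_⟩
  obtain ⟨k, rfl⟩ : ∃ k : ℕ, n = -(k + 1 : ℕ) := ⟨n.natAbs - 1, by lia⟩
  have hs : Continuous fun s : Circle => (shift β hβ s : ℂ) ^ (k + 1) :=
    (continuous_circle_coe.comp (continuous_shift hβ)).pow _
  have h1 := integral_comp_shift hβ (hs.aestronglyMeasurable.mul hF.1.1)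
  simp only [Pi.mul_apply, shift_shift] at h1
  rw [coef, neg_neg]
  simp only [zpow_natCast]
  rw [h1]
  -- With `w = s⁻¹` this is the Jacobian times `α(s)^(k+1)`. It is holomorphic on the closed disk,
  -- and its factor `w` makes it vanish at `0`.
  set d : ℂ → ℂ := fun w => -(β * conj β - 1) * w * (1 - β * w) ^ k / (conj β - w) ^ (k + 2) with hd
  have hne : ∀ w ∈ Metric.closedBall (0 : ℂ) 1, (conj β - w) ^ (k + 2) ≠ 0 := fun w hw =>
    pow_ne_zero _ (shift_conj_sub_ne_zero hβ (by simpa using hw))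
  have hdd : DifferentiableOn ℂ d (Metric.closedBall 0 1) := by
    rw [hd]
    fun_prop (disch := assumption)
  have h2 := MemHardyConj.coef_zero_mul hp hq hF (memHardyConj_inv_of_differentiableOn q hdd)
  rw [coef_zero_inv_of_differentiableOn hdd, coef_zero, hd] at h2
  simp only [mul_zero, zero_mul, zero_div] at h2
  rw [← h2]
  refine integral_congr_ae (ae_of_all _ fun s => ?_)
  have hx := Circle.coe_ne_zero s
  have hD := shift_denom_ne_zero hβ s
  have hy := shift_sub_ne_zero hβ (Circle.norm_coe s).le
  have h3 := shiftJacobian_mul_pow_aux (c := β * conj β - 1) hx hD hy k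
  have e1 : ((s : ℂ) - β) / s = 1 - β * (s : ℂ)⁻¹ := by field_simp
  have e2 : (conj β * (s : ℂ) - 1) / s = conj β - (s : ℂ)⁻¹ := by field_simp
  rw [e1, e2, neg_sub] at h3
  simp only [ofReal_poissonKer_shift hβ]
  simp only [coe_shift, Circle.coe_inv]
  rw [← mul_assoc, h3]
  ring

theorem MemHardy.comp_shift (hp : p ≠ ∞) (hq : q ≠ ∞) {F : Circle → ℂ} (hF : MemHardy p F) :
    MemHardyConj p fun t => F (shift β hβ t) := by
  have := (hF.conj.comp_shift hβ hp hq).conj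
  simpa only [Complex.conj_conj] using this

omit [p.HolderConjugate q] in
theorem shiftJacobian_cauchy_aux {x b y D : ℂ} (hD : D ≠ 0) (hy : y ≠ 0) (h : β * b - 1 ≠ 0)
    (e : b * y - D = 1 - β * b) :
    (β * b - 1) * x / (D * -y) * (b * (y / D) / (b * (y / D) - 1)) = b * x / D := by
  have h1 : b * (y / D) - 1 = -(β * b - 1) / D := by
    field_simp
    linear_combination e
  rw [h1]
  field_simp

/-- `α` sends `1/β̄` to infinity. In the integral, the Jacobian turns the transformed Cauchy kernel
at `1/β̄` back into that kernel, and the Cauchy integral of an antianalytic function is its value at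
infinity. -/
theorem diskExtension_comp_shift (hp1 : 1 ≤ p) {F : Circle → ℂ} (hF : MemHardyConj p F) :
    diskExtension (fun t => F (shift β hβ t)) (conj β)⁻¹ = coef F 0 := by
  have hb : conj β ≠ 0 := by simpa using shift_ne_zero hβ
  have hz := norm_conj_inv_lt hβ
  rw [← integral_cauchy_mul ((hF.1.comp_shift hβ).integrable hp1) hz]
  have hk := continuous_cauchy hz
  have h1 := integral_comp_shift hβ ((hk.comp (continuous_shift hβ)).aestronglyMeasurable.mul hF.1.1)
  simp only [Pi.mul_apply, Function.comp_apply, shift_shift] at h1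
  have h2 : diskExtension F (conj β)⁻¹ = coef F 0 := by
    rw [diskExtension, tsum_eq_single 0 fun k hk => by rw [hF.2 k (by lia), zero_mul]]
    simp
  rw [h1, ← h2, ← integral_cauchy_mul (hF.1.integrable hp1) hz]
  refine integral_congr_ae (ae_of_all _ fun s => ?_)
  have hx := Circle.coe_ne_zero s
  have hD := shift_denom_ne_zero hβ s
  have hy := shift_sub_ne_zero hβ (Circle.norm_coe s).le
  have h3 := shiftJacobian_cauchy_aux (x := s) hD hy (norm_sq_sub_one_ne_zero hβ) (by ring)
  simp only [ofReal_poissonKer_shift hβ]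
  simp only [Circle.coe_inv]
  rw [inv_one_sub_inv_mul_inv hD hx hb, inv_one_sub_inv_mul_inv
    (shift_denom_ne_zero hβ (shift β hβ s)) (Circle.coe_ne_zero _) hb, ← mul_assoc, ← h3, coe_shift,
    neg_sub]

omit [p.HolderConjugate q] in
-- Write `t - β = (t - z) + (z - β)`: the Cauchy integral of `(t - z) f` at `z` is the mean of `t
-- f`, which is the coefficient assumed to vanish.
theorem diskExtension_sub_mul {f : Circle → ℂ} (hf : Integrable f circleMeasure)
    (hf1 : coef f (-1) = 0) {z : ℂ} (hz : ‖z‖ < 1) :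
    diskExtension (fun t => ((t : ℂ) - β) * f t) z = (z - β) * diskExtension f z := by
  have i1 : Integrable (fun t : Circle => (t : ℂ) * f t) circleMeasure := by
    simpa using integrable_zpow_mul hf 1
  have e : (fun t : Circle => ((t : ℂ) - β) * f t) =
      fun t : Circle => ((t : ℂ) * f t - z * f t) + (z - β) * f t := by ext t; ring
  have i2 : Integrable (fun t : Circle => (t : ℂ) * f t - z * f t) circleMeasure :=
    i1.sub (hf.const_mul z)
  rw [e, diskExtension_add i2 (hf.const_mul _) hz, diskExtension_const_mul,
    add_eq_right, ← integral_cauchy_mul i2 hz, ← hf1, coef]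
  refine integral_congr_ae (ae_of_all _ fun s => ?_)
  have h1 : 1 - z * ((s⁻¹ : Circle) : ℂ) ≠ 0 := one_sub_mul_coe_ne_zero hz s⁻¹
  have h2 : (s : ℂ) * ((s⁻¹ : Circle) : ℂ) = 1 := by
    rw [Circle.coe_inv, mul_inv_cancel₀ (Circle.coe_ne_zero s)]
  simp only [neg_neg, zpow_one]
  rw [inv_mul_eq_iff_eq_mul₀ h1]
  linear_combination (z * f s) * h2

include hβ in
theorem differentiableOn_sub_zpow (n : ℤ) :
    DifferentiableOn ℂ (fun z => (z - β) ^ n) (Metric.closedBall 0 1) :=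
  DifferentiableOn.zpow (by fun_prop)
    (Or.inl fun z hz => shift_sub_ne_zero hβ (by simpa using hz))

include hβ in
theorem differentiableOn_conj_sub_zpow (n : ℤ) :
    DifferentiableOn ℂ (fun z => (conj β - z) ^ n) (Metric.closedBall 0 1) :=
  DifferentiableOn.zpow (by fun_prop)
    (Or.inl fun z hz => shift_conj_sub_ne_zero hβ (by simpa using hz))

include hβ in
theorem diskExtension_sub_zpow_mul (hp : p ≠ ∞) (hq : q ≠ ∞) {f : Circle → ℂ} (hf : MemHardy p f)
    {z : ℂ} (hz : ‖z‖ < 1) (n : ℤ) :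
    diskExtension (fun t => ((t : ℂ) - β) ^ n * f t) z = (z - β) ^ n * diskExtension f z := by
  have hp1 : 1 ≤ p := ENNReal.HolderConjugate.one_le p q
  have key : ∀ m : ℤ, diskExtension (fun t => ((t : ℂ) - β) ^ (m + 1) * f t) z =
      (z - β) * diskExtension (fun t => ((t : ℂ) - β) ^ m * f t) z := fun m => by
    have h := hf.differentiableOn_mul hp hq (differentiableOn_sub_zpow hβ m)
    rw [← diskExtension_sub_mul (h.1.integrable hp1) (h.2 _ (by lia)) hz]
    congr 1
    ext t
    rw [zpow_add_one₀ (shift_sub_ne_zero hβ (Circle.norm_coe t).le)]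
    ring
  have hz0 := shift_sub_ne_zero hβ hz.le
  induction n using Int.induction_on with
  | zero => simp
  | succ m ih => rw [key, ih, zpow_add_one₀ hz0]; ring
  | pred m ih =>
    have := key (-m - 1)
    rw [sub_add_cancel, ih] at this
    rw [zpow_sub_one₀ hz0, mul_right_comm, this]
    field_simp

end HardyShift

/-! ### Factorization of matching functions -/

section Matching

theorem lam_sq {β : ℂ} (hβ : 1 < ‖β‖) : lam β ^ 2 = 1 - β * conj β := by
  have h0 : 0 ≤ ‖β‖ ^ 2 - 1 := by nlinarith
  rw [lam, mul_pow, Complex.I_sq, ← Complex.ofReal_pow, Real.sq_sqrt h0, Complex.mul_conj,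
    Complex.normSq_eq_norm_sq]
  push_cast
  ring

theorem lam_ne_zero {β : ℂ} (hβ : 1 < ‖β‖) : lam β ≠ 0 := fun h => by
  have h1 := lam_sq hβ
  rw [h, zero_pow two_ne_zero] at h1
  exact norm_sq_sub_one_ne_zero hβ (by linear_combination h1)

variable {β : ℂ} (hβ : 1 < ‖β‖)

include hβ in
-- The right side splits `t α(t)` into an analytic factor and an antianalytic one, both invertible;
-- this replaces the powers of `t` and `α(t)` in the matching relation.
theorem coe_mul_coe_shift (t : Circle) :
    (t : ℂ) * shift β hβ t = ((t : ℂ) - β) / (conj β - ((t⁻¹ : Circle) : ℂ)) := by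
  have h1 := shift_denom_ne_zero hβ t
  have h2 := shift_conj_sub_ne_zero hβ (Circle.norm_coe t⁻¹).le
  have h3 : (t : ℂ) * ((t⁻¹ : Circle) : ℂ) = 1 := by
    rw [Circle.coe_inv, mul_inv_cancel₀ (Circle.coe_ne_zero t)]
  rw [coe_shift, eq_div_iff h2, mul_assoc, div_mul_eq_mul_div, ← mul_div_assoc, div_eq_iff h1]
  linear_combination -((t : ℂ) - β) * h3

include hβ in
theorem shift_sub_mul (t : Circle) :
    ((shift β hβ t : ℂ) - β) * (conj β - ((t⁻¹ : Circle) : ℂ)) = 1 - β * conj β := by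
  have h1 := shift_denom_ne_zero hβ t
  have h3 : (t : ℂ) * ((t⁻¹ : Circle) : ℂ) = 1 := by
    rw [Circle.coe_inv, mul_inv_cancel₀ (Circle.coe_ne_zero t)]
  rw [shift_sub, div_mul_eq_mul_div, div_eq_iff h1]
  linear_combination -(1 - β * conj β) * h3

theorem matching_aux {G G' F F' x x' y d : ℂ} {n : ℤ} (hG : G ≠ 0) (hF' : F' ≠ 0) (hx : x ≠ 0)
    (hx' : x' ≠ 0) (hy : y ≠ 0) (hd : d ≠ 0) (e : x * x' = y / d)
    (h : G * x ^ (-n) * F * (G' * x' ^ (-n) * F') = 1) :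
    y ^ (-n) * G' * F = d ^ (-n) * G⁻¹ * F'⁻¹ := by
  have h1 : (x * x') ^ n = y ^ n / d ^ n := by rw [e, div_zpow]
  rw [mul_zpow] at h1
  have a1 := zpow_ne_zero n hx
  have a2 := zpow_ne_zero n hx'
  have a3 := zpow_ne_zero n hy
  have a4 := zpow_ne_zero n hd
  rw [eq_div_iff a4] at h1
  simp only [zpow_neg] at h ⊢
  field_simp at h ⊢
  linear_combination (d ^ n) * h + h1

/-- For a factorization of a matching function, the value in the definition of the signature is
`c λⁿ`, where `c` is the constant in the relation between `g₊` and `g₊ ∘ α`. -/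
theorem IsWienerHopfFactorization.exists_matching_const {p : ℝ≥0∞} (hp1 : 1 < p) (hp : p ≠ ∞)
    {g gm gp : Circle → ℂ} {n : ℤ} (hmatch : IsAlphaMatching β hβ g)
    (h : IsWienerHopfFactorization p g (-n) gm gp) :
    ∃ c : ℂ, c ≠ 0 ∧
      (lam β / conj β) ^ n * diskExtension (fun t => (gp t)⁻¹) (1 / conj β) = c * lam β ^ n ∧
      ∀ᵐ t : Circle ∂circleMeasure, g t * (gp t)⁻¹ =
        c * (((shift β hβ t : ℂ) - β) / t) ^ n * (gp (shift β hβ t))⁻¹ := by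
  have := ENNReal.HolderConjugate.conjExponent hp1.le
  set q := p.conjExponent
  have hq : q ≠ ∞ := conj_ne_top_of_one_lt hp1
  have hqs := quasiMeasurePreserving_shift hβ
  have hy : ∀ t : Circle, (t : ℂ) - β ≠ 0 := fun t => shift_sub_ne_zero hβ (Circle.norm_coe t).le
  have hd : ∀ t : Circle, conj β - ((t⁻¹ : Circle) : ℂ) ≠ 0 := fun t =>
    shift_conj_sub_ne_zero hβ (Circle.norm_coe t⁻¹).le
  -- After inserting the factorization, `g · (g ∘ α) = 1` has `(t - β)⁻ⁿ (g₋ ∘ α) g₊` on one side,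
  -- which is analytic, and `(β̄ - t⁻¹)⁻ⁿ g₋⁻¹ (g₊⁻¹ ∘ α)` on the other, which is antianalytic.
  have hA := ((h.gm_mem.comp_shift hβ hp hq).differentiableOn_mul hp hq
    (differentiableOn_sub_zpow hβ (-n))).mul hp hq h.gp_mem
  have hB := (h.gm_inv_mem.differentiableOn_inv_mul hq hp
    (differentiableOn_conj_sub_zpow hβ (-n))).mul hq hp (h.gp_inv_mem.comp_shift hβ hp hq)
  have hAB : ∀ᵐ t : Circle ∂circleMeasure, ((t : ℂ) - β) ^ (-n) * gm (shift β hβ t) * gp t =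
      (conj β - ((t⁻¹ : Circle) : ℂ)) ^ (-n) * (gm t)⁻¹ * (gp (shift β hβ t))⁻¹ := by
    filter_upwards [hmatch, h.factorization, hqs.ae h.factorization, h.gm_ne_zero,
      hqs.ae h.gp_ne_zero] with t h1 h2 h3 h4 h5
    rw [h2, h3] at h1
    exact matching_aux h4 h5 (Circle.coe_ne_zero t) (Circle.coe_ne_zero _) (hy t) (hd t)
      (coe_mul_coe_shift hβ t) h1
  have hc := ae_eq_const_of_mem_conj hA hB hAB
  set c := coef (fun t : Circle => ((t : ℂ) - β) ^ (-n) * gm (shift β hβ t) * gp t) 0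
  have hc' := hqs.ae hc
  simp only [shift_shift] at hc'
  -- Multiply the antianalytic expression at `t` by the analytic one at `α(t)`: the factors of `g`
  -- cancel and `(α(t) - β)(β̄ - t⁻¹) = λ²` remains.
  have hc2 : c ^ 2 * (lam β ^ 2) ^ n = 1 := by
    obtain ⟨t, h1, h2, h3, h4, h5⟩ :=
      (hc.and (hc'.and (hAB.and (h.gm_ne_zero.and (hqs.ae h.gp_ne_zero))))).exists
    rw [h3] at h1
    rw [lam_sq hβ, ← shift_sub_mul hβ t, mul_zpow]
    have h6 := zpow_ne_zero n (hd t)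
    have h7 := zpow_ne_zero n (hy (shift β hβ t))
    rw [sq]
    nth_rewrite 1 [← h1]
    rw [← h2, zpow_neg, zpow_neg]
    field_simp
  have hc0 : c ≠ 0 := fun h0 => by
    rw [h0] at hc2
    simp at hc2
  have hl := lam_ne_zero hβ
  have hb : conj β ≠ 0 := by simpa using shift_ne_zero hβ
  refine ⟨c, hc0, ?_, ?_⟩
  -- Evaluate `g₋ ∘ α = c (t - β)ⁿ g₊⁻¹` at `1/β̄`, where the left side is `g₋(∞) = 1` and `1/β̄ - β
  -- = λ²/β̄`. This gives the signature as `1/(c λⁿ)`, which equals `c λⁿ`.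
  · have h1 := diskExtension_comp_shift hβ hp1.le h.gm_mem
    have h2 : (fun t => gm (shift β hβ t)) =ᵐ[circleMeasure]
        fun t : Circle => c * (((t : ℂ) - β) ^ n * (gp t)⁻¹) := by
      filter_upwards [hc, h.gp_ne_zero] with t ht ht'
      rw [← ht, zpow_neg]
      have := zpow_ne_zero n (hy t)
      field_simp
    rw [diskExtension_congr h2, h.gm_infty, diskExtension_const_mul, diskExtension_sub_zpow_mul hβ hp hq
      h.gp_inv_mem (norm_conj_inv_lt hβ)] at h1
    have e : (conj β)⁻¹ - β = lam β ^ 2 / conj β := by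
      rw [lam_sq hβ]
      field_simp
    rw [e, div_zpow] at h1
    rw [one_div, div_zpow]
    linear_combination (-(lam β ^ n / conj β ^ n * diskExtension (fun t => (gp t)⁻¹) (conj β)⁻¹)) * hc2
      + c * lam β ^ n * h1
  · filter_upwards [hc', h.factorization, h.gp_ne_zero, hqs.ae h.gp_ne_zero] with t h1 h2 h3 h4
    rw [h2, ← h1, zpow_neg, zpow_neg, div_zpow]
    have := zpow_ne_zero n (hy (shift β hβ t))
    have := zpow_ne_zero n (Circle.coe_ne_zero t)
    field_simp

end Matching

/-! ### Local regularity at a fixed point of the shift -/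

section Local

/-- The Riemann–Lebesgue lemma. -/
theorem tendsto_coef_cofinite {f : Circle → ℂ} (hf : Integrable f circleMeasure) :
    Tendsto (coef f) cofinite (𝓝 0) := by
  rw [Metric.tendsto_nhds]
  intro ε hε
  obtain ⟨a, ha⟩ := exists_trigPoly_eLpNorm_sub_le ENNReal.one_ne_top (memLp_one_iff_integrable.2 hf)
    (ε := ENNReal.ofReal (ε / 2)) (by simpa using hε) le_rfl
  have hi : Integrable (fun t => f t - trigPoly a t) circleMeasure :=
    hf.sub (continuous_trigPoly a).integrable_circle
  have h1 : ∫ t, ‖f t - trigPoly a t‖ ∂circleMeasure ≤ ε / 2 := by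
    rw [integral_norm_eq_lintegral_enorm hi.1]
    rw [eLpNorm_one_eq_lintegral_enorm] at ha
    exact ENNReal.toReal_le_of_le_ofReal (by positivity) ha
  filter_upwards [a.hasFiniteSupport.compl_mem_cofinite] with n hn
  have h2 := coef_sub hf (continuous_trigPoly a).integrable_circle n
  have h3 : a n = 0 := by simpa using hn
  rw [coef_trigPoly, h3, sub_zero] at h2
  rw [dist_zero_right, ← h2]
  exact ((norm_coef_le _ n).trans h1).trans_lt (half_lt_self hε)

/-- From `(t - τ) k = 1`, the coefficients of `k` have constant modulus on each of the half-lines `n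
≥ 0` and `n ≤ -1`. By Riemann–Lebesgue they all vanish, contradicting the relation at frequency `0`.
-/
theorem not_integrable_inv_sub (τ : Circle) (hτ : ∀ᵐ t ∂circleMeasure, t ≠ τ) :
    ¬ Integrable (fun t : Circle => ((t : ℂ) - τ)⁻¹) circleMeasure := by
  intro hk
  set k : Circle → ℂ := fun t => ((t : ℂ) - τ)⁻¹ with hkdef
  have hrec : ∀ n : ℤ, coef k (n - 1) - τ * coef k n = if n = 0 then 1 else 0 := fun n => by
    have i1 : Integrable (fun t : Circle => (t : ℂ) ^ (1 : ℤ) * k t) circleMeasure :=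
      integrable_zpow_mul hk 1
    have h1 := coef_sub i1 (hk.const_mul (τ : ℂ)) n
    rw [coef_zpow_mul, coef_const_mul] at h1
    rw [← h1, ← coef_const]
    refine coef_congr (hτ.mono fun t ht => ?_) n
    have h2 : (t : ℂ) - τ ≠ 0 := sub_ne_zero.2 fun h => ht (Circle.ext h)
    simp only [hkdef, zpow_one]
    rw [← sub_mul, mul_inv_cancel₀ h2]
  have hnorm : ∀ n : ℤ, n ≠ 0 → ‖coef k (n - 1)‖ = ‖coef k n‖ := fun n hn => by
    have h1 := hrec n
    rw [if_neg hn, sub_eq_zero] at h1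
    rw [h1, norm_mul, Circle.norm_coe, one_mul]
  have hpos : ∀ m : ℕ, ‖coef k m‖ = ‖coef k 0‖ := fun m => by
    induction m with
    | zero => rfl
    | succ m ih =>
      rw [← ih, ← hnorm (m + 1 : ℕ) (by lia)]
      congr 2
      lia
  have hneg : ∀ m : ℕ, ‖coef k (-1 - m)‖ = ‖coef k (-1)‖ := fun m => by
    induction m with
    | zero => simp
    | succ m ih =>
      rw [← ih, ← hnorm (-1 - m) (by lia)]
      congr 2
      lia
  have hlim := (tendsto_coef_cofinite hk).norm
  rw [norm_zero] at hlim
  have h0 : ‖coef k 0‖ = 0 := by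
    have h1 := hlim.comp (Nat.cast_injective (R := ℤ)).tendsto_cofinite
    simp only [Function.comp_def, hpos] at h1
    exact tendsto_nhds_unique tendsto_const_nhds h1
  have h1 : ‖coef k (-1)‖ = 0 := by
    have h1 := hlim.comp (f := fun m : ℕ => (-1 - m : ℤ))
      (Function.Injective.tendsto_cofinite fun a b h => by simpa using h)
    simp only [Function.comp_def, hneg] at h1
    exact tendsto_nhds_unique tendsto_const_nhds h1
  have h2 := hrec 0
  rw [zero_sub, norm_eq_zero.1 h0, norm_eq_zero.1 h1] at h2
  simp at h2

theorem diskExtension_of_memHardyConj {p : ℝ≥0∞} {F : Circle → ℂ} (hF : MemHardyConj p F) (z : ℂ) :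
    diskExtension F z = coef F 0 := by
  rw [diskExtension, tsum_eq_single 0 fun k hk => by rw [hF.2 k (by lia), zero_mul]]
  simp

theorem Circle.dist_eq_norm_sub (t s : Circle) : dist t s = ‖(t : ℂ) - s‖ :=
  dist_eq_norm (t : ℂ) s

/-- The quantity is `|s - r t|`, which is at least `1 - r`; hence `|s - t| ≤ |s - r t| + (1 - r) ≤ 2
|s - r t|`, while `|s - t| > δ/2`. -/
theorem norm_one_sub_ge {r : ℝ} (h0 : 0 ≤ r) (h1 : r < 1) {δ : ℝ} {τ t s : Circle}
    (ht : dist t τ < δ / 2) (hs : δ ≤ dist s τ) :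
    δ / 4 ≤ ‖1 - (r : ℂ) * t * ((s⁻¹ : Circle) : ℂ)‖ := by
  have e : ‖1 - (r : ℂ) * t * ((s⁻¹ : Circle) : ℂ)‖ = ‖(s : ℂ) - r * t‖ := by
    have : (s : ℂ) - r * t = s * (1 - r * t * ((s⁻¹ : Circle) : ℂ)) := by
      have h2 : (s : ℂ) * ((s⁻¹ : Circle) : ℂ) = 1 := by
        rw [Circle.coe_inv, mul_inv_cancel₀ (Circle.coe_ne_zero s)]
      linear_combination (r * t : ℂ) * h2
    rw [this, norm_mul, Circle.norm_coe, one_mul]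
  rw [e]
  have h2 : 1 - r ≤ ‖(s : ℂ) - r * t‖ := by
    have := norm_sub_norm_le (s : ℂ) (r * t)
    rwa [norm_mul, Circle.norm_coe, Circle.norm_coe, mul_one, Complex.norm_real, Real.norm_of_nonneg h0]
      at this
  have h3 : dist s t ≤ ‖(s : ℂ) - r * t‖ + (1 - r) := by
    rw [Circle.dist_eq_norm_sub]
    have e2 : (s : ℂ) - t = (s - r * t) - ((1 - r : ℝ) : ℂ) * t := by push_cast; ring
    rw [e2]
    refine (norm_sub_le _ _).trans ?_
    rw [norm_mul, Circle.norm_coe, mul_one, Complex.norm_real, Real.norm_of_nonneg (by linarith)]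
  have h4 := dist_triangle s t τ
  linarith

/-- A function in `H^1` which agrees on an arc with a function in the conjugate Hardy space is
locally Lipschitz in the arc. -/
theorem MemHardy.exists_lipschitz {φ F : Circle → ℂ} (hφ : MemHardy 1 φ) (hF : MemHardyConj 1 F)
    {τ : Circle} {δ : ℝ} (hδ : 0 < δ) (h : ∀ᵐ t ∂circleMeasure, dist t τ < δ → φ t = F t) :
    ∃ C : ℝ, 0 ≤ C ∧ ∃ S : Set Circle, (∀ᵐ t ∂circleMeasure, t ∈ S) ∧
      ∀ t ∈ S, ∀ t' ∈ S, dist t τ < δ / 2 → dist t' τ < δ / 2 → ‖φ t - φ t'‖ ≤ C * dist t t' := by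
  have iφ := memLp_one_iff_integrable.1 hφ.1
  have iF := memLp_one_iff_integrable.1 hF.1
  have iw : Integrable (fun t => φ t - F t) circleMeasure := iφ.sub iF
  set w : Circle → ℂ := fun t => φ t - F t with hw
  replace h : ∀ᵐ s ∂circleMeasure, w s = 0 ∨ δ ≤ dist s τ := h.mono fun s hs => by
    rcases lt_or_ge (dist s τ) δ with h1 | h1
    · left
      rw [hw]
      exact sub_eq_zero.2 (hs h1)
    · exact Or.inr h1
  -- `F` contributes only a constant to the Cauchy integral, and `φ - F` vanishes near `τ`, so there
  -- the kernel is integrated only over points far from the singularity.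
  have hrep : ∀ z : ℂ, ‖z‖ < 1 → diskExtension φ z =
      ∫ s : Circle, (1 - z * ((s⁻¹ : Circle) : ℂ))⁻¹ * w s ∂circleMeasure + coef F 0 := fun z hz => by
    rw [integral_cauchy_mul iw hz, hw, diskExtension_sub iφ iF hz, diskExtension_of_memHardyConj hF]
    ring
  -- A difference of two Cauchy kernels has two denominators, each at least `δ/4`.
  set C := 16 / δ ^ 2 * ∫ s, ‖w s‖ ∂circleMeasure with hC
  have hlip : ∀ r : ℝ, 0 ≤ r → r < 1 → ∀ t t' : Circle, dist t τ < δ / 2 → dist t' τ < δ / 2 →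
      ‖poissonInt r φ t - poissonInt r φ t'‖ ≤ C * dist t t' := fun r h0 h1 t t' ht ht' => by
    have hz := norm_ofReal_mul_coe_lt h0 h1 t
    have hz' := norm_ofReal_mul_coe_lt h0 h1 t'
    rw [poissonInt_of_analytic h0 h1 iφ hφ.2, poissonInt_of_analytic h0 h1 iφ hφ.2, hrep _ hz,
      hrep _ hz', add_sub_add_right_eq_sub,
      ← integral_sub (integrable_cauchy_mul iw hz) (integrable_cauchy_mul iw hz'), hC, mul_right_comm,
      ← integral_const_mul]
    refine norm_integral_le_of_norm_le (iw.norm.const_mul _) (h.mono fun s hs => ?_)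
    rcases hs with hs | hs
    · rw [hs]; simp
    · have b1 := norm_one_sub_ge h0 h1 ht hs
      have b2 := norm_one_sub_ge h0 h1 ht' hs
      have p1 : 0 < ‖1 - (r : ℂ) * t * ((s⁻¹ : Circle) : ℂ)‖ := by linarith
      have p2 : 0 < ‖1 - (r : ℂ) * t' * ((s⁻¹ : Circle) : ℂ)‖ := by linarith
      rw [← sub_mul, norm_mul]
      refine mul_le_mul_of_nonneg_right ?_ (norm_nonneg _)
      rw [inv_sub_inv (norm_pos_iff.1 p1) (norm_pos_iff.1 p2), norm_div, norm_mul]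
      have e : 1 - (r : ℂ) * t' * ((s⁻¹ : Circle) : ℂ) - (1 - r * t * ((s⁻¹ : Circle) : ℂ)) =
          r * ((s⁻¹ : Circle) : ℂ) * (t - t') := by ring
      rw [e, norm_mul, norm_mul, Circle.norm_coe, ← Circle.dist_eq_norm_sub, Complex.norm_real,
        Real.norm_of_nonneg h0, mul_one, div_le_iff₀ (mul_pos p1 p2)]
      have b3 : δ / 4 * (δ / 4) ≤ ‖1 - (r : ℂ) * t * ((s⁻¹ : Circle) : ℂ)‖ * ‖1 - (r : ℂ) * t' * ((s⁻¹ : Circle) : ℂ)‖ :=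
        mul_le_mul b1 b2 (by positivity) p1.le
      calc r * dist t t' ≤ 1 * dist t t' := by gcongr
        _ = 16 / δ ^ 2 * dist t t' * (δ / 4 * (δ / 4)) := by field_simp; norm_num
        _ ≤ _ := by gcongr
  set ρ : ℕ → ℝ := fun k => 1 - 1 / ((k : ℝ) + 1) with hρ
  have hρ0 : ∀ k, 0 ≤ ρ k := fun k => by
    have : 1 / ((k : ℝ) + 1) ≤ 1 := by
      rw [div_le_one (by positivity)]
      linarith [(Nat.cast_nonneg k : (0 : ℝ) ≤ k)]
    simp only [hρ]
    linarith
  have hρ1 : ∀ k, ρ k < 1 := fun k => by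
    have : (0 : ℝ) < 1 / ((k : ℝ) + 1) := by positivity
    simp only [hρ]
    linarith
  have hρt : Tendsto ρ atTop (𝓝[<] 1) := by
    refine tendsto_nhdsWithin_iff.2 ⟨?_, Eventually.of_forall hρ1⟩
    have := tendsto_one_div_add_atTop_nhds_zero_nat (𝕜 := ℝ)
    have h1 := this.const_sub 1
    rwa [sub_zero] at h1
  -- Convergence in `L¹` gives almost everywhere convergence along a subsequence of radii; the
  -- Lipschitz bound, uniform in the radius, holds for the limit where it exists.
  have hm : TendstoInMeasure circleMeasure (fun k => poissonInt (ρ k) φ) atTop φ :=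
    tendstoInMeasure_of_tendsto_eLpNorm one_ne_zero
      (fun k => (continuous_poissonInt (hρ0 k) (hρ1 k) iφ).aestronglyMeasurable) iφ.1
      ((tendsto_eLpNorm_poissonInt le_rfl ENNReal.one_ne_top hφ.1).comp hρt)
  obtain ⟨ns, -, hns⟩ := hm.exists_seq_tendsto_ae
  refine ⟨C, mul_nonneg (by positivity) (integral_nonneg fun _ => norm_nonneg _), _, hns,
    fun t ht t' ht' hd hd' => ?_⟩
  have ht : Tendsto (fun i => poissonInt (ρ (ns i)) φ t) atTop (𝓝 (φ t)) := ht
  have ht' : Tendsto (fun i => poissonInt (ρ (ns i)) φ t') atTop (𝓝 (φ t')) := ht'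
  exact le_of_tendsto (ht.sub ht').norm (Eventually.of_forall fun i =>
    hlip _ (hρ0 _) (hρ1 _) t t' hd hd')

variable {β : ℂ} (hβ : 1 < ‖β‖)

theorem exists_dist_shift_le : ∃ Λ : ℝ, 0 ≤ Λ ∧ ∀ t s : Circle,
    dist (shift β hβ t) (shift β hβ s) ≤ Λ * dist t s := by
  have hlow : ∀ t : Circle, ‖β‖ - 1 ≤ ‖conj β * (t : ℂ) - 1‖ := fun t => by
    have := norm_sub_norm_le (conj β * (t : ℂ)) 1
    rwa [norm_mul, RCLike.norm_conj, Circle.norm_coe, mul_one, norm_one] at this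
  have hpos : 0 < ‖β‖ - 1 := by linarith
  refine ⟨‖β * conj β - 1‖ / ((‖β‖ - 1) * (‖β‖ - 1)), by positivity, fun t s => ?_⟩
  have h1 := shift_denom_ne_zero hβ t
  have h2 := shift_denom_ne_zero hβ s
  have e : (shift β hβ t : ℂ) - shift β hβ s =
      (β * conj β - 1) * (t - s) / ((conj β * t - 1) * (conj β * s - 1)) := by
    rw [coe_shift, coe_shift, div_sub_div _ _ h1 h2]
    congr 1
    ring
  rw [Circle.dist_eq_norm_sub, Circle.dist_eq_norm_sub, e, norm_div, norm_mul, norm_mul, div_mul_eq_mul_div]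
  refine div_le_div_of_nonneg_left (by positivity) (by positivity) ?_
  exact mul_le_mul (hlow t) (hlow s) hpos.le (norm_nonneg _)

include hβ in
theorem shift_sub_div_eq (t : Circle) :
    ((shift β hβ t : ℂ) - β) / t =
      (1 - β * conj β) * ((t⁻¹ : Circle) : ℂ) / (conj β - ((t⁻¹ : Circle) : ℂ)) := by
  have h2 := shift_conj_sub_ne_zero hβ (Circle.norm_coe t⁻¹).le
  have h3 : (t : ℂ) * ((t⁻¹ : Circle) : ℂ) = 1 := by
    rw [Circle.coe_inv, mul_inv_cancel₀ (Circle.coe_ne_zero t)]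
  rw [div_eq_div_iff (Circle.coe_ne_zero t) h2, shift_sub_mul]
  linear_combination -(1 - β * conj β) * h3

/-- If `u ∈ H^p` satisfies a reflection relation near a fixed point `τ` of the shift, then the
coefficient of the relation is `1` at `τ`, since otherwise `u` would vanish at `τ`. -/
theorem MemHardy.reflection_coeff_eq_one {p q : ℝ≥0∞} [p.HolderConjugate q] (hp : p ≠ ∞) (hq : q ≠ ∞)
    {u : Circle → ℂ} (hu : MemHardy p u) (hu0 : ∀ᵐ t ∂circleMeasure, u t ≠ 0)
    (hui : Integrable (fun t => (u t)⁻¹) circleMeasure) {τ : Circle} (hτ : shift β hβ τ = τ)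
    {κ : ℂ} {m : ℕ} {δ : ℝ} (hδ : 0 < δ)
    (h : ∀ᵐ t : Circle ∂circleMeasure, dist t τ < δ →
      u t = κ * (((shift β hβ t : ℂ) - β) / t) ^ m * u (shift β hβ t)) :
    κ * (((τ : ℂ) - β) / τ) ^ m = 1 := by
  have hp1 : 1 ≤ p := ENNReal.HolderConjugate.one_le p q
  by_contra hne
  set R : Circle → ℂ := fun t => κ * (((shift β hβ t : ℂ) - β) / t) ^ m with hR
  have hRτ : R τ ≠ 1 := by
    simp only [hR, hτ]
    exact hne
  have hRc : Continuous R := by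
    refine continuous_const.mul (Continuous.pow (Continuous.div ?_ continuous_circle_coe
      Circle.coe_ne_zero) m)
    exact (continuous_circle_coe.comp (continuous_shift hβ)).sub continuous_const
  -- `u ∘ α` is antianalytic, and `(α(t) - β)/t` is a function of `t⁻¹` holomorphic on the closed
  -- disk.
  have hF : MemHardyConj p fun t => R t * u (shift β hβ t) := by
    have hw : ∀ w ∈ Metric.closedBall (0 : ℂ) 1, conj β - w ≠ 0 := fun w hw =>
      shift_conj_sub_ne_zero hβ (by simpa using hw)
    have := (hu.comp_shift hβ hp hq).differentiableOn_inv_mul hp hq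
      (d := fun w => κ * ((1 - β * conj β) * w / (conj β - w)) ^ m) (by fun_prop (disch := assumption))
    simpa only [hR, shift_sub_div_eq] using this
  obtain ⟨C, hC, S, hS, hlip⟩ := MemHardy.exists_lipschitz
    (φ := u) ⟨hu.1.mono_exponent hp1, hu.2⟩ ⟨hF.1.mono_exponent hp1, hF.2⟩ hδ h
  obtain ⟨Λ, hΛ, hdist⟩ := exists_dist_shift_le hβ
  have hη : 0 < ‖1 - R τ‖ / 2 := half_pos (norm_pos_iff.2 (sub_ne_zero.2 hRτ.symm))
  have h1 : ∀ᶠ t in 𝓝 τ, ‖1 - R τ‖ / 2 < ‖1 - R t‖ := by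
    have hc : Continuous fun t => ‖1 - R t‖ := (continuous_const.sub hRc).norm
    exact (hc.tendsto τ).eventually (lt_mem_nhds (by linarith))
  have h2 : ∀ᶠ t in 𝓝 τ, ‖R t‖ < ‖R τ‖ + 1 :=
    (hRc.norm.tendsto τ).eventually (gt_mem_nhds (by linarith))
  have h3 : ∀ᶠ t in 𝓝 τ, dist (shift β hβ t) τ < δ / 2 := by
    have := (continuous_shift hβ).tendsto τ
    rw [hτ] at this
    exact this.eventually (Metric.ball_mem_nhds τ (half_pos hδ))
  obtain ⟨ρ, hρ, hρb⟩ := Metric.eventually_nhds_iff.1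
    (((h1.and h2).and h3).and (Metric.ball_mem_nhds τ (half_pos hδ)))
  set M := (‖R τ‖ + 1) * (C * (Λ + 1)) / (‖1 - R τ‖ / 2) with hM
  -- The relation reads `u (1 - R) = R (u ∘ α - u)`. Near `τ` the factor `1 - R` is bounded away
  -- from zero, and the Lipschitz estimate bounds the right side by a multiple of `|α(t) - t|`,
  -- hence of `|t - τ|`.
  have hbound : ∀ᵐ t ∂circleMeasure, dist t τ < ρ → ‖u t‖ ≤ M * dist t τ := by
    filter_upwards [h, hS, (quasiMeasurePreserving_shift hβ).ae hS] with t ht htS htS' hd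
    obtain ⟨⟨⟨b1, b2⟩, b3⟩, b4⟩ := hρb hd
    have b4 : dist t τ < δ / 2 := b4
    have e1 : u t * (1 - R t) = R t * (u (shift β hβ t) - u t) := by
      have := ht (by linarith)
      simp only [hR]
      linear_combination this
    have e2 := hlip _ htS' _ htS b3 b4
    have e3 : dist (shift β hβ t) t ≤ (Λ + 1) * dist t τ := by
      have a1 := dist_triangle (shift β hβ t) τ t
      have a2 := hdist t τ
      rw [hτ] at a2
      rw [dist_comm τ t] at a1
      linarith
    have e4 : ‖u t‖ * ‖1 - R t‖ ≤ (‖R τ‖ + 1) * (C * ((Λ + 1) * dist t τ)) := by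
      rw [← norm_mul, e1, norm_mul]
      have : C * dist (shift β hβ t) t ≤ C * ((Λ + 1) * dist t τ) := mul_le_mul_of_nonneg_left e3 hC
      exact mul_le_mul b2.le (e2.trans this) (norm_nonneg _) (by positivity)
    rw [hM, div_mul_eq_mul_div, le_div_iff₀ hη]
    calc ‖u t‖ * (‖1 - R τ‖ / 2) ≤ ‖u t‖ * ‖1 - R t‖ := by gcongr
      _ ≤ _ := e4
      _ = _ := by ring
  have hM0 : 0 ≤ M := by positivity
  have hneτ : ∀ᵐ t ∂circleMeasure, t ≠ τ := by
    filter_upwards [hbound, hu0] with t ht ht0 htτ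
    subst htτ
    have := ht (by simpa using hρ)
    rw [dist_self, mul_zero] at this
    exact ht0 (norm_le_zero_iff.1 this)
  -- Near `τ`, `1/|t - τ|` is dominated by a multiple of the integrable `1/|u|`; elsewhere it is at
  -- most `1/ρ`.
  refine not_integrable_inv_sub τ hneτ ?_
  refine ((hui.norm.const_mul M).add (integrable_const ρ⁻¹)).mono' ?_ ?_
  · exact (continuous_circle_coe.sub continuous_const).measurable.inv.aestronglyMeasurable
  · filter_upwards [hbound, hu0, hneτ] with t ht ht0 htτ
    have hdp : 0 < dist t τ := dist_pos.2 htτ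
    rw [Pi.add_apply, norm_inv, norm_inv, ← Circle.dist_eq_norm_sub]
    rcases lt_or_ge (dist t τ) ρ with hd | hd
    · have h4 := ht hd
      have h5 : 0 < ‖u t‖ := norm_pos_iff.2 ht0
      have h6 : (dist t τ)⁻¹ ≤ M * ‖u t‖⁻¹ := by
        rw [← div_eq_mul_inv, le_div_iff₀ h5, inv_mul_le_iff₀ hdp, mul_comm]
        exact h4
      have := inv_nonneg.2 hρ.le
      linarith
    · have h4 : (dist t τ)⁻¹ ≤ ρ⁻¹ := inv_anti₀ hρ hd
      have : 0 ≤ M * ‖u t‖⁻¹ := by positivity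
      linarith

end Local

/-! ### The signature -/

section Signature

variable {β : ℂ} (hβ : 1 < ‖β‖)

/-- Treats both fixed points at once, with `μ = λ` or `μ = -λ`; the quotient `λ/μ` produces the
factor `1` or `(-1)ⁿ` in the result. -/
theorem coe_sub_eq_of_fixed {μ τ : ℂ} (hβ : 1 < ‖β‖) (hμ : μ ^ 2 = lam β ^ 2)
    (hτ : τ = (1 + μ) / conj β) : τ - β = μ * τ ∧ conj β * τ - 1 = μ := by
  have hb : conj β ≠ 0 := by simpa using shift_ne_zero hβ
  rw [lam_sq hβ] at hμ
  have h1 : conj β * τ = 1 + μ := by rw [hτ, mul_div_cancel₀ _ hb]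
  refine ⟨mul_left_cancel₀ hb ?_, by rw [h1, add_sub_cancel_left]⟩
  linear_combination (1 - μ) * h1 - hμ

theorem shift_eq_self_of_fixed {μ : ℂ} {τ : Circle} (hμ : μ ^ 2 = lam β ^ 2)
    (hτ : (τ : ℂ) = (1 + μ) / conj β) : shift β hβ τ = τ := by
  obtain ⟨h1, h2⟩ := coe_sub_eq_of_fixed hβ hμ hτ
  have hμ0 : μ ≠ 0 := fun h => by
    rw [h, zero_pow two_ne_zero] at hμ
    exact lam_ne_zero hβ (pow_eq_zero_iff two_ne_zero |>.1 hμ.symm)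
  refine Circle.ext ?_
  rw [coe_shift, h1, h2, mul_div_cancel_left₀ _ hμ0]

/-- The signature of a matching function which is constant near a fixed point of the shift. -/
theorem IsWienerHopfFactorization.signature_eq_of_locally_const {p : ℝ≥0∞} (hp1 : 1 < p) (hp : p ≠ ∞)
    {g gm gp : Circle → ℂ} {n : ℤ} (hmatch : IsAlphaMatching β hβ g)
    (h : IsWienerHopfFactorization p g (-n) gm gp) {τ : Circle} (hτ : shift β hβ τ = τ)
    {ε : ℂ} (hε : ε ≠ 0) {δ : ℝ} (hδ : 0 < δ) (hconst : ∀ t, dist t τ < δ → g t = ε) :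
    (lam β / conj β) ^ n * diskExtension (fun t => (gp t)⁻¹) (1 / conj β) =
      ε * (lam β / (((τ : ℂ) - β) / τ)) ^ n := by
  have := ENNReal.HolderConjugate.conjExponent hp1.le
  have hq : p.conjExponent ≠ ∞ := conj_ne_top_of_one_lt hp1
  have hqs := quasiMeasurePreserving_shift hβ
  obtain ⟨c, hc0, hσ, hrel⟩ := h.exists_matching_const hβ hp1 hp hmatch
  have hX : ∀ t : Circle, ((shift β hβ t : ℂ) - β) / t ≠ 0 := fun t =>
    div_ne_zero (shift_sub_ne_zero hβ (Circle.norm_coe _).le) (Circle.coe_ne_zero t)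
  have hμ0 : ((τ : ℂ) - β) / τ ≠ 0 := by
    have := hX τ
    rwa [hτ] at this
  suffices hc : c * (((τ : ℂ) - β) / τ) ^ n = ε by
    rw [hσ, ← hc, mul_assoc, ← mul_zpow, mul_div_cancel₀ _ hμ0]
  -- The reflection argument needs a nonnegative power of `(α(t) - β)/t`, since only such powers are
  -- antianalytic. It is applied to `g₊⁻¹` for `n ≥ 0` and to `g₊` for `n ≤ 0`; in either case the
  -- inverse is integrable.
  rcases Int.eq_nat_or_neg n with ⟨m, rfl | rfl⟩
  · have := h.gp_inv_mem.reflection_coeff_eq_one (κ := c / ε) (m := m) hβ hp hq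
      (h.gp_ne_zero.mono fun t ht => inv_ne_zero ht)
      (by simpa only [inv_inv] using h.gp_mem.1.integrable (ENNReal.HolderConjugate.one_le _ p)) hτ hδ
      (by
        filter_upwards [hrel] with t ht hd
        rw [hconst t hd] at ht
        rw [zpow_natCast] at ht
        rw [div_mul_eq_mul_div, div_mul_eq_mul_div, ← ht, mul_div_cancel_left₀ _ hε])
    rw [zpow_natCast]
    rwa [div_mul_eq_mul_div, div_eq_one_iff_eq hε] at this
  · have := h.gp_mem.reflection_coeff_eq_one (κ := ε / c) (m := m) hβ hq hp h.gp_ne_zero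
      (h.gp_inv_mem.1.integrable hp1.le) hτ hδ
      (by
        filter_upwards [hrel, h.gp_ne_zero, hqs.ae h.gp_ne_zero] with t ht h1 h2 hd
        rw [hconst t hd, zpow_neg, zpow_natCast] at ht
        have h3 := pow_ne_zero m (hX t)
        rw [← div_eq_mul_inv, div_eq_iff h1] at ht
        rw [ht]
        field_simp)
    rw [zpow_neg, zpow_natCast, ← div_eq_mul_inv]
    rw [div_mul_eq_mul_div, div_eq_one_iff_eq hc0] at this
    rw [div_eq_iff (pow_ne_zero m hμ0), this]

theorem exists_clm_diskExtension {p : ℝ≥0∞} [Fact (1 ≤ p)] {z : ℂ} (hz : ‖z‖ < 1) :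
    ∃ D : Hardy p →L[ℂ] ℂ, ∀ φ : Hardy p, D φ = diskExtension (φ : Lp ℂ p circleMeasure) z := by
  have := ENNReal.HolderConjugate.conjExponent (Fact.out : 1 ≤ p)
  obtain ⟨L, hL⟩ := exists_clm_integral_mul (p := p) ((continuous_cauchy hz).memLp_circle p.conjExponent)
  refine ⟨L.comp (Hardy p).subtypeL, fun φ => ?_⟩
  have h1 := hL _ (Lp.memLp (φ : Lp ℂ p circleMeasure))
  rw [Lp.toLp_coeFn, integral_cauchy_mul (integrable_of_memLp _) hz] at h1
  exact h1

instance : circleMeasure.IsOpenPosMeasure :=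
  isOpenPosMeasure_of_mulLeftInvariant_of_compact Set.univ isCompact_univ (by simp)

/-- A set of full measure is dense, so the matching relation holds at points tending to the fixed
point. -/
theorem IsAlphaMatching.sq_eq_one {g : Circle → ℂ} (hmatch : IsAlphaMatching β hβ g) {τ : Circle}
    (hτ : shift β hβ τ = τ) (hc : ContinuousAt g τ) : g τ * g τ = 1 := by
  have h1 : Tendsto (fun t => g t * g (shift β hβ t)) (𝓝 τ) (𝓝 (g τ * g τ)) := by
    have h2 : Tendsto (shift β hβ) (𝓝 τ) (𝓝 τ) := by
      have := (continuous_shift hβ).tendsto τ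
      rwa [hτ] at this
    exact hc.tendsto.mul (hc.tendsto.comp h2)
  have hfr : ∃ᶠ t in 𝓝 τ, g t * g (shift β hβ t) = 1 :=
    mem_closure_iff_frequently.1 (Measure.dense_of_ae hmatch τ)
  by_contra hne
  exact hfr (h1.eventually_ne hne)

/-- A matching function which is continuous at a fixed point of the shift is a uniform limit of
matching functions which are constant near this point. -/
theorem IsAlphaMatching.exists_locally_const {g : Circle → ℂ} (hmatch : IsAlphaMatching β hβ g)
    (hg : AEStronglyMeasurable g circleMeasure) {τ : Circle} (hτ : shift β hβ τ = τ)
    (hc : ContinuousAt g τ) {η : ℝ} (hη : 0 < η) :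
    ∃ g' : Circle → ℂ, IsAlphaMatching β hβ g' ∧ AEStronglyMeasurable g' circleMeasure ∧
      (∀ t, ‖g' t - g t‖ ≤ η) ∧ ∃ δ > 0, ∀ t, dist t τ < δ → g' t = g τ := by
  classical
  obtain ⟨δ, hδ, hδg⟩ := Metric.continuousAt_iff.1 hc η hη
  -- An `α`-invariant neighbourhood: on it `g` may be replaced by `g(τ)` without destroying the
  -- matching relation, because `g(τ)² = 1`.
  set U : Set Circle := Metric.ball τ δ ∩ shift β hβ ⁻¹' Metric.ball τ δ with hU
  have hUo : IsOpen U := Metric.isOpen_ball.inter (Metric.isOpen_ball.preimage (continuous_shift hβ))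
  have hUα : ∀ t, shift β hβ t ∈ U ↔ t ∈ U := fun t => by
    simp only [hU, Set.mem_inter_iff, Set.mem_preimage, shift_shift, and_comm]
  have hτU : τ ∈ U := by
    simp only [hU, Set.mem_inter_iff, Set.mem_preimage, hτ, Metric.mem_ball_self hδ, and_self]
  refine ⟨U.piecewise (fun _ => g τ) g, ?_, ?_, fun t => ?_, ?_⟩
  · filter_upwards [hmatch] with t ht
    by_cases h : t ∈ U
    · rw [Set.piecewise_eq_of_mem _ _ _ h, Set.piecewise_eq_of_mem _ _ _ ((hUα t).2 h)]
      exact hmatch.sq_eq_one hβ hτ hc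
    · rwa [Set.piecewise_eq_of_notMem _ _ _ h, Set.piecewise_eq_of_notMem _ _ _ (mt (hUα t).1 h)]
  · exact (aestronglyMeasurable_const.piecewise hUo.measurableSet hg.restrict)
  · by_cases h : t ∈ U
    · rw [Set.piecewise_eq_of_mem _ _ _ h, norm_sub_rev, ← dist_eq_norm]
      exact (hδg h.1).le
    · rw [Set.piecewise_eq_of_notMem _ _ _ h, sub_self, norm_zero]
      exact hη.le
  · obtain ⟨δ', hδ', hball⟩ := Metric.isOpen_iff.1 hUo τ hτU
    exact ⟨δ', hδ', fun t ht => Set.piecewise_eq_of_mem _ _ _ (hball ht)⟩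

theorem IsToeplitzOperator.add {p : ℝ≥0∞} [Fact (1 ≤ p)] {G H : Circle → ℂ} {A B : Hardy p →L[ℂ] Hardy p}
    {K M : ℝ} (hG : AEStronglyMeasurable G circleMeasure) (hGK : ∀ᵐ t ∂circleMeasure, ‖G t‖ ≤ K)
    (hH : AEStronglyMeasurable H circleMeasure) (hHM : ∀ᵐ t ∂circleMeasure, ‖H t‖ ≤ M)
    (hA : IsToeplitzOperator p G A) (hB : IsToeplitzOperator p H B) :
    IsToeplitzOperator p (fun t => G t + H t) (A + B) :=
  isToeplitzOperator_of_coef fun φ n hn => by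
    have hp1 : 1 ≤ p := Fact.out
    have e : coef ((A + B) φ : Lp ℂ p circleMeasure) n =
        coef (fun t => (A φ : Lp ℂ p circleMeasure) t + (B φ : Lp ℂ p circleMeasure) t) n :=
      coef_congr (Lp.coeFn_add (A φ : Lp ℂ p circleMeasure) (B φ : Lp ℂ p circleMeasure)) n
    rw [e, coef_add (integrable_of_memLp _) (integrable_of_memLp _), hA.coef_eq φ hn, hB.coef_eq φ hn,
      ← coef_add ((memLp_bdd_mul hG hGK (Lp.memLp _)).integrable hp1)
        ((memLp_bdd_mul hH hHM (Lp.memLp _)).integrable hp1)]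
    simp only [add_mul]

theorem MemLp.exists_ae_bound {g : Circle → ℂ} (hg : MemLp g ⊤ circleMeasure) :
    ∃ K : ℝ, ∀ᵐ t ∂circleMeasure, ‖g t‖ ≤ K := by
  have h := hg.2
  rw [eLpNorm_exponent_top] at h
  refine ⟨(eLpNormEssSup g circleMeasure).toReal, (ae_le_eLpNormEssSup (f := g)).mono fun t ht => ?_⟩
  rw [← toReal_enorm]
  exact ENNReal.toReal_mono h.ne ht

/-- The value is computed by perturbing `g` to matching functions constant near `τ`. Existence comes
from the invertibility of `T(tⁿ g)`, uniqueness from that of the factorization. -/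
theorem isAlphaSignature_iff {p : ℝ≥0∞} [Fact (1 ≤ p)] (hp1 : 1 < p) (hp : p ≠ ∞)
    {g : Circle → ℂ} (hg : MemLp g ⊤ circleMeasure) (hmatch : IsAlphaMatching β hβ g)
    {n : ℤ} (hT : ToeplitzFredholmWithIndex p g n) {τ : Circle} (hτ : shift β hβ τ = τ)
    (hc : ContinuousAt g τ) (ξ : ℂ) :
    IsAlphaSignature β p g ξ ↔ ξ = g τ * (lam β / (((τ : ℂ) - β) / τ)) ^ n := by
  obtain ⟨K, hK⟩ := MemLp.exists_ae_bound hg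
  have hG : AEStronglyMeasurable (fun t : Circle => (t : ℂ) ^ n * g t) circleMeasure :=
    (continuous_coe_zpow n).aestronglyMeasurable.mul hg.1
  have hGK : ∀ᵐ t : Circle ∂circleMeasure, ‖(t : ℂ) ^ n * g t‖ ≤ K := hK.mono fun t ht => by
    rwa [norm_mul, norm_coe_zpow, one_mul]
  obtain ⟨B, hB, hBF, hBi⟩ := exists_toeplitz_index_zero hp1 hp hT
  have hBb : Function.Bijective B := toeplitz_bijective hp1 hp hG hGK
    (hmatch.mono fun t ht => mul_ne_zero (zpow_ne_zero n (Circle.coe_ne_zero t))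
      (left_ne_zero_of_mul_eq_one ht)) hB hBF hBi
  have hBu : IsUnit B := ContinuousLinearMap.isUnit_iff_bijective.2 hBb
  set e1 : Hardy p := (memHardy_coe_pow p 0).toHardy with he1
  have hinv : ∀ A : Hardy p →L[ℂ] Hardy p, IsUnit A → A (Ring.inverse A e1) = e1 := fun A hA => by
    have := Ring.mul_inverse_cancel A hA
    exact congrArg (fun T : Hardy p →L[ℂ] Hardy p => T e1) this
  have hz : ‖1 / conj β‖ < 1 := by
    rw [one_div]
    exact norm_conj_inv_lt hβ
  obtain ⟨D, hD⟩ := exists_clm_diskExtension (p := p) hz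
  -- The signature as a function of the operator `T(tⁿ g)`, continuous at invertible operators;
  -- elsewhere `Ring.inverse` is zero and the value is irrelevant.
  set Ψ : (Hardy p →L[ℂ] Hardy p) → ℂ := fun A => (lam β / conj β) ^ n * D (Ring.inverse A e1) with hΨ
  set v := g τ * (lam β / (((τ : ℂ) - β) / τ)) ^ n with hv
  have hΨc : ContinuousAt Ψ B := by
    obtain ⟨u, hu⟩ := hBu
    have h1 : ContinuousAt (Ring.inverse : (Hardy p →L[ℂ] Hardy p) → _) B := by
      rw [← hu]
      exact NormedRing.inverse_continuousAt (R := Hardy p →L[ℂ] Hardy p) u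
    exact continuousAt_const.mul (D.continuous.continuousAt.comp
      (h1.clm_apply continuousAt_const))
  have hΨB : Ψ B = v := by
    refine eq_of_norm_sub_le_zero (le_of_forall_pos_le_add fun ε hε => ?_)
    have hev : ∀ᶠ A in 𝓝 B, IsUnit A ∧ dist (Ψ A) (Ψ B) < ε := by
      have h1 : ∀ᶠ A in 𝓝 B, IsUnit A := (Units.isOpen (R := Hardy p →L[ℂ] Hardy p)).mem_nhds hBu
      exact h1.and (hΨc.eventually (Metric.ball_mem_nhds _ hε))
    obtain ⟨ρ, hρ, hρA⟩ :=
      (Metric.eventually_nhds_iff (α := Hardy p →L[ℂ] Hardy p)).1 hev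
    obtain ⟨C, hC, hCT⟩ := exists_toeplitz hp1 hp
    -- This tolerance makes the perturbation of the operator, at most `C` times it, smaller than
    -- `ρ`, also when `C = 0`.
    obtain ⟨g', hm', hg', hη, δ, hδ, hconst⟩ := hmatch.exists_locally_const hβ hg.1 hτ hc
      (η := ρ / (2 * (C + 1))) (by positivity)
    have hE : AEStronglyMeasurable (fun t : Circle => (t : ℂ) ^ n * (g' t - g t)) circleMeasure :=
      (continuous_coe_zpow n).aestronglyMeasurable.mul (hg'.sub hg.1)
    have hEK : ∀ᵐ t : Circle ∂circleMeasure, ‖(t : ℂ) ^ n * (g' t - g t)‖ ≤ ρ / (2 * (C + 1)) :=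
      ae_of_all _ fun t => by
        rw [norm_mul, norm_coe_zpow, one_mul]
        exact hη t
    obtain ⟨E, hET, hEn⟩ := hCT _ hE _ (by positivity) hEK
    have hA : IsToeplitzOperator p (fun t => (t : ℂ) ^ n * g' t) (B + E) := by
      have := hB.add hG hGK hE hEK hET
      simpa only [← mul_add, add_sub_cancel] using this
    have hAB : dist (B + E) B < ρ := by
      have h1 : dist (B + E) B = ‖E‖ :=
        (dist_eq_norm (B + E) B).trans (congrArg norm (add_sub_cancel_left B E))
      rw [h1]
      refine hEn.trans_lt ?_
      rw [← mul_div_assoc, div_lt_iff₀ (by positivity)]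
      nlinarith
    obtain ⟨hAu, hAΨ⟩ := hρA hAB
    -- The perturbed operator is still invertible, so `g'` has a factorization with the same
    -- exponent `-n`; its signature is known exactly and is within `ε` of `Ψ B`.
    obtain ⟨gm, hfac⟩ := exists_factorization_of_bijective hp1 hp hg'
      (K := K + ρ / (2 * (C + 1))) (hK.mono fun t ht => by
        have := norm_add_le (g t) (g' t - g t)
        rw [add_sub_cancel] at this
        exact this.trans (add_le_add ht (hη t))) hA
      (ContinuousLinearMap.isUnit_iff_bijective.1 hAu) (hinv _ hAu)
    have h1 := hfac.signature_eq_of_locally_const hβ hp1 hp hm' hτ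
      (left_ne_zero_of_mul_eq_one (hmatch.sq_eq_one hβ hτ hc)) hδ hconst
    simp only [inv_inv] at h1
    have h2 : Ψ (B + E) = v := by
      rw [hΨ]
      simp only [hD]
      exact h1
    rw [h2, dist_comm, dist_eq_norm] at hAΨ
    rw [zero_add]
    exact hAΨ.le
  obtain ⟨gm, hfac⟩ := exists_factorization_of_bijective hp1 hp hg.1 hK hB hBb (hinv B hBu)
  have hval : (lam β / conj β) ^ n * diskExtension
      (fun t => (((Ring.inverse B e1 : Hardy p) : Lp ℂ p circleMeasure) t)⁻¹⁻¹) (1 / conj β) = v := by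
    rw [← hΨB, hΨ]
    simp only [hD, inv_inv]
  constructor
  · rintro ⟨n', gm', gp', hfac', rfl⟩
    obtain rfl : n' = n := neg_injective (hfac'.index_unique hp1 hp hfac)
    have he : (fun t => (gp' t)⁻¹) =ᵐ[circleMeasure]
        fun t => (((Ring.inverse B e1 : Hardy p) : Lp ℂ p circleMeasure) t)⁻¹⁻¹ :=
      (hfac'.gp_unique hp1 hp hfac).mono fun t ht => congrArg (·⁻¹) ht
    rw [← hval, diskExtension_congr he]
  · rintro rfl
    exact ⟨n, gm, _, hfac, hval.symm⟩

end Signature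

/-- Let `1 < p < ∞` and let `g ∈ L^∞` be `α`-matching with `T(g) : H^p → H^p` Fredholm of index `n`.
If `g` is continuous at `t₊`, then `g` has an `α`-signature, it is unique, and it equals `g(t₊)`;
if `g` is continuous at `t₋`, the same holds with `g(t₋) (-1)ⁿ`. -/
theorem proposition4p5 (β : ℂ) (hβ : 1 < ‖β‖) (p : ℝ≥0∞) [Fact (1 ≤ p)] (hp1 : 1 < p) (hp : p < ⊤)
    (g : Circle → ℂ) (hg : MemLp g ⊤ circleMeasure) (hmatch : IsAlphaMatching β hβ g)
    (n : ℤ) (hT : ToeplitzFredholmWithIndex p g n) :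
    (ContinuousAt g (tPlus β hβ) →
      ∀ ξ : ℂ, IsAlphaSignature β p g ξ ↔ ξ = g (tPlus β hβ)) ∧
    (ContinuousAt g (tMinus β hβ) →
      ∀ ξ : ℂ, IsAlphaSignature β p g ξ ↔ ξ = g (tMinus β hβ) * (-1) ^ n) := by
  have hl := lam_ne_zero hβ
  refine ⟨fun hc ξ => ?_, fun hc ξ => ?_⟩
  · have hτ : (tPlus β hβ : ℂ) = (1 + lam β) / conj β := rfl
    rw [isAlphaSignature_iff hβ hp1 hp.ne hg hmatch hT (shift_eq_self_of_fixed hβ rfl hτ) hc,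
      (coe_sub_eq_of_fixed hβ rfl hτ).1, mul_div_cancel_right₀ _ (Circle.coe_ne_zero _), div_self hl,
      one_zpow, mul_one]
  · have hτ : (tMinus β hβ : ℂ) = (1 + -lam β) / conj β := by
      rw [← sub_eq_add_neg]
      rfl
    rw [isAlphaSignature_iff hβ hp1 hp.ne hg hmatch hT (shift_eq_self_of_fixed hβ (neg_sq _) hτ) hc,
      (coe_sub_eq_of_fixed hβ (neg_sq _) hτ).1, mul_div_cancel_right₀ _ (Circle.coe_ne_zero _),
      div_neg, div_self hl]
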